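/- Vertex Cover Discovery (VC-D) is the following decision problem. Given a finite simple undirected graph $G=(V,E)$, a set $S\subseteq V$ (the vertices initially occupied by tokens) and an integer $b\ge 0$ (the budget), decide whether there are a vertex cover $T$ of $G$, an integer $0\le \ell\le b$ and a sequence of sets $S=S_0,S_1,\dots,S_\ell=T$ of vertices such that for each $i\in\{1,\dots,\ell\}$ there are $x\in S_{i-1}$ and $y\in V\setminus S_{i-1}$ with $xy\in E$ and $S_i=(S_{i-1}\cup\{y\})\setminus\{x\}$ (one token slides along an edge to an unoccupied vertex). A split graph is a graph whose vertex set can be partitioned into a clique and an independent set (either of which may be empty). Theorem. VC-D can be solved in $O(n^4)$ time on split graphs, where $n=|V|$. That is, there are a single word-RAM program and constants $c,d$ such that for every split graph $G$ on $\{0,\dots,n-1\}$, every set $S$ of vertices of $G$ and every integer $b\ge 0$, the program, given $n$, $b$, the adjacency matrix of $G$ and the indicator vector of $S$ (no partition of $G$ into a clique and an independent set is given), halts after at most $c\,(n^4+1)$ steps with output $1$ if $(G,S,b)$ is a yes-instance of VC-D and output $0$ otherwise, while all numbers and memory addresses that it uses are less than $(n+b+2)^d$, so that they fit into words of $O(\log(n+b+2))$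 bits. Constants, register and memory accesses (including indirect addressing), additions, truncated subtractions, multiplications, comparisons of words, and tests cost one step each. -/

import Mathlib

namespace WordRAM

/-- The state of a random access machine: registers, and a memory that is addressed by numbers. -/
structure State where
  reg : ℕ → ℕ
  mem : ℕ → ℕ

/-- Machine operations on two words. -/
inductive BinOp where
  | add
  | sub
  | mul
  | lt
  | eq

/-- Subtraction is truncated at `0`; comparisons return `1` for true and `0` for false. -/
def BinOp.eval : BinOp → ℕ → ℕ → ℕ
  | .add, a, b => a + b
  | .sub, a, b => a - b
  | .mul, a, b => a * b
  | .lt, a, b => if a < b then 1 else 0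
  | .eq, a, b => if a = b then 1 else 0

/-- Expressions: constants, registers, indirect memory access, and machine operations. -/
inductive Expr where
  | const (k : ℕ)
  | reg (x : ℕ)
  | load (addr : Expr)
  | op (o : BinOp) (e₁ e₂ : Expr)

def Expr.eval : Expr → State → ℕ
  | .const k, _ => k
  | .reg x, s => s.reg x
  | .load e, s => s.mem (e.eval s)
  | .op o e₁ e₂, s => o.eval (e₁.eval s) (e₂.eval s)

/-- Every constant, operation and register or memory access in an expression costs one step. -/
def Expr.cost : Expr → ℕ
  | .const _ => 1
  | .reg _ => 1
  | .load e => e.cost + 1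
  | .op _ e₁ e₂ => e₁.cost + e₂.cost + 1

/-- Every number that occurs in the evaluation of the expression, in particular every address and
every intermediate result, is less than `W`: it fits into a machine word. -/
def Expr.Fits (W : ℕ) : Expr → State → Prop
  | .const k, _ => k < W
  | .reg x, s => s.reg x < W
  | .load e, s => e.Fits W s ∧ s.mem (e.eval s) < W
  | .op o e₁ e₂, s => e₁.Fits W s ∧ e₂.Fits W s ∧ o.eval (e₁.eval s) (e₂.eval s) < W

/-- Programs, with structured control flow. A test succeeds if its value is not `0`. -/
inductive Prog where
  | skip
  | assign (x : ℕ) (e : Expr)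
  | store (addr e : Expr)
  | seq (p q : Prog)
  | ifte (e : Expr) (p q : Prog)
  | loop (e : Expr) (p : Prog)

/-- `Exec W p s t s'`: with machine words that hold the numbers less than `W`, the program `p`
started in the state `s` halts after exactly `t` steps in the state `s'`. If a number does not fit
into a word, there is no rule, and the execution does not halt properly. -/
inductive Exec (W : ℕ) : Prog → State → ℕ → State → Prop where
  | skip (s : State) : Exec W .skip s 1 s
  | assign (x : ℕ) (e : Expr) (s : State) (he : e.Fits W s) :
      Exec W (.assign x e) s (e.cost + 1)
        { s with reg := Function.update s.reg x (e.eval s) }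
  | store (a e : Expr) (s : State) (ha : a.Fits W s) (he : e.Fits W s) :
      Exec W (.store a e) s (a.cost + e.cost + 1)
        { s with mem := Function.update s.mem (a.eval s) (e.eval s) }
  | seq (p q : Prog) (s s' s'' : State) (t t' : ℕ) (hp : Exec W p s t s')
      (hq : Exec W q s' t' s'') : Exec W (.seq p q) s (t + t') s''
  | ifte_true (e : Expr) (p q : Prog) (s s' : State) (t : ℕ) (he : e.Fits W s)
      (h : e.eval s ≠ 0) (hp : Exec W p s t s') :
      Exec W (.ifte e p q) s (e.cost + 1 + t) s'
  | ifte_false (e : Expr) (p q : Prog) (s s' : State) (t : ℕ) (he : e.Fits W s)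
      (h : e.eval s = 0) (hq : Exec W q s t s') :
      Exec W (.ifte e p q) s (e.cost + 1 + t) s'
  | loop_true (e : Expr) (p : Prog) (s s' s'' : State) (t t' : ℕ) (he : e.Fits W s)
      (h : e.eval s ≠ 0) (hp : Exec W p s t s') (hl : Exec W (.loop e p) s' t' s'') :
      Exec W (.loop e p) s (e.cost + 1 + t + t') s''
  | loop_false (e : Expr) (p : Prog) (s : State) (he : e.Fits W s) (h : e.eval s = 0) :
      Exec W (.loop e p) s (e.cost + 1) s

/-- The machine is deterministic: a halting execution of a program is its only execution. -/
theorem Exec.unique {W : ℕ} {p : Prog} {s s₁ s₂ : State} {t₁ t₂ : ℕ}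
    (h₁ : Exec W p s t₁ s₁) (h₂ : Exec W p s t₂ s₂) : t₁ = t₂ ∧ s₁ = s₂ := by
  induction h₁ generalizing t₂ s₂ with
  | skip s => cases h₂; exact ⟨rfl, rfl⟩
  | assign x e s he => cases h₂; exact ⟨rfl, rfl⟩
  | store a e s ha he => cases h₂; exact ⟨rfl, rfl⟩
  | seq p q s s' s'' t t' hp hq ihp ihq =>
    cases h₂ with
    | seq _ _ _ _ _ _ _ hp' hq' =>
      obtain ⟨rfl, rfl⟩ := ihp hp'
      obtain ⟨rfl, rfl⟩ := ihq hq'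
      exact ⟨rfl, rfl⟩
  | ifte_true e p q s s' t he h hp ih =>
    cases h₂ with
    | ifte_true _ _ _ _ _ _ _ _ hp' => obtain ⟨rfl, rfl⟩ := ih hp'; exact ⟨rfl, rfl⟩
    | ifte_false _ _ _ _ _ _ _ h' _ => exact absurd h' h
  | ifte_false e p q s s' t he h hq ih =>
    cases h₂ with
    | ifte_true _ _ _ _ _ _ _ h' _ => exact absurd h h'
    | ifte_false _ _ _ _ _ _ _ _ hq' => obtain ⟨rfl, rfl⟩ := ih hq'; exact ⟨rfl, rfl⟩
  | loop_true e p s s' s'' t t' he h hp hl ihp ihl =>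
    cases h₂ with
    | loop_true _ _ _ _ _ _ _ _ _ hp' hl' =>
      obtain ⟨rfl, rfl⟩ := ihp hp'
      obtain ⟨rfl, rfl⟩ := ihl hl'
      exact ⟨rfl, rfl⟩
    | loop_false _ _ _ _ h' => exact absurd h' h
  | loop_false e p s he h =>
    cases h₂ with
    | loop_true _ _ _ _ _ _ _ _ h' _ _ => exact absurd h h'
    | loop_false _ _ _ _ _ => exact ⟨rfl, rfl⟩

end WordRAM

namespace Discovery

/-- A split graph: its vertex set can be partitioned into a clique and an independent set. -/
def IsSplit {V : Type*} (G : SimpleGraph V) : Prop :=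
  ∃ Q I : Set V, IsCompl Q I ∧ G.IsClique Q ∧ G.IsIndepSet I

/-- Adjacent configurations: one token slides along an edge to an unoccupied vertex. -/
def Slide {V : Type*} [DecidableEq V] (G : SimpleGraph V) (S S' : Finset V) : Prop :=
  ∃ x ∈ S, ∃ y, y ∉ S ∧ G.Adj x y ∧ S' = (S ∪ {y}) \ {x}

/-- The configuration `T` is reachable from `S` in exactly `l` steps. -/
def ReachableIn {V : Type*} [DecidableEq V] (G : SimpleGraph V) (l : ℕ) (S T : Finset V) : Prop :=
  ∃ C : ℕ → Finset V, C 0 = S ∧ C l = T ∧ ∀ i < l, Slide G (C i) (C (i + 1))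

/-- The instance `(G, S, b)` of Vertex Cover Discovery is a yes-instance: some vertex cover of `G`
is reachable from `S` in at most `b` steps. -/
def VCD {V : Type*} [DecidableEq V] (G : SimpleGraph V) (S : Finset V) (b : ℕ) : Prop :=
  ∃ T : Finset V, G.IsVertexCover (T : Set V) ∧ ∃ l ≤ b, ReachableIn G l S T

open Classical in
/-- The input `(G, S, b)` as given to the machine: register `0` holds the number `n` of vertices and
register `1` the budget; cells `0, …, n² - 1` of the memory hold the adjacency matrix, row by row,
and cells `n², …, n² + n - 1` the indicator vector of `S`; everything else is `0`. -/
noncomputable def input {n : ℕ} (G : SimpleGraph (Fin n)) (S : Finset (Fin n)) (b : ℕ) :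
    WordRAM.State where
  reg x := if x = 0 then n else if x = 1 then b else 0
  mem a :=
    if (∃ i j : Fin n, a = i.val * n + j.val ∧ G.Adj i j) ∨ (∃ i : Fin n, a = n * n + i.val ∧ i ∈ S)
    then 1 else 0

end Discovery

namespace WordRAM

/-! ### Executions without a bound on the word size -/

/-! Fix a partition of the split graph into a clique `Q` and an independent set. A vertex cover
contains `Q`, or it misses some `v ∈ Q` and then contains all neighbours of `v`. Conversely, every
superset of `Q` or of such a neighbourhood is a vertex cover. So there are at most `n + 1`
candidates, and for each one it has to be decided whether some superset of it can be reached within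
the budget.

Reaching a superset of a candidate `R` from `S` costs the minimum of the sum of the distances
between `f d` and `d`, over injections `f` from the deficit `R \ S` into `S \ R`. Tokens can be
moved one after the other, since a token in the way can take over the rest of the walk
(`exists_reachableIn_of_assignment`). In the other direction, a sequence of slides yields an
assignment by induction on its first slide (`ReachableIn.exists_assignment`).

The assignment problem reduces to unweighted matching because the relevant distances are 1, 2 or 3.
Take 2 as the base cost of a target in `Q` and 3 as that of a target outside. A token outside `Q`
saves at most 1, and the pairs that save 1 are the edges of `Close`. By `eq_some_of_mem_available`,
the only available token inside `Q` can be the one on `v` when `R` is the neighbourhood of `v`. It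
is adjacent to every target, so it saves 1 on targets in `Q` and 2 on the others. If the deficit
lies in `Q`, its pairs are ordinary edges of `Close`. Otherwise `bonus` pays 1 for using it at all,
and only its pairs with targets outside `Q` are edges; by an exchange, some largest matching uses
such an edge. Hence `Good` holds exactly if a maximum matching in `Close` is large enough
(`vcd_iff_exists_good`).

No partition is given. In a splitting with the smallest clique, the clique is the set of vertices of
degree at least some `k`, or the neighbourhood of a vertex
(`IsSplit.exists_threshold_or_neighbors`), so `O(n)` sets are tested.

Maximum matchings are computed by `n` rounds of breadth first search and augmentation, in time `O(n
^ 3)`, for each of the at most `n + 1` candidates. The algorithm is written in a small language with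
loops of length `n + k`, where the running time is read off from the nesting depth (`run_compile`).
Its compiled program writes only tame values, so numbers grow linearly with time and fit into words
of logarithmic length (`Run.exec`). -/

/-- Executions of programs on a machine with unbounded words. -/
inductive Run : Prog → State → ℕ → State → Prop where
  | skip (s : State) : Run .skip s 1 s
  | assign (x : ℕ) (e : Expr) (s : State) :
      Run (.assign x e) s (e.cost + 1) { s with reg := Function.update s.reg x (e.eval s) }
  | store (a e : Expr) (s : State) :
      Run (.store a e) s (a.cost + e.cost + 1)
        { s with mem := Function.update s.mem (a.eval s) (e.eval s) }
  | seq {p q : Prog} {s s' s'' : State} {t t' : ℕ} (hp : Run p s t s') (hq : Run q s' t' s'') :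
      Run (.seq p q) s (t + t') s''
  | ifte_true {e : Expr} {p q : Prog} {s s' : State} {t : ℕ} (h : e.eval s ≠ 0)
      (hp : Run p s t s') : Run (.ifte e p q) s (e.cost + 1 + t) s'
  | ifte_false {e : Expr} {p q : Prog} {s s' : State} {t : ℕ} (h : e.eval s = 0)
      (hq : Run q s t s') : Run (.ifte e p q) s (e.cost + 1 + t) s'
  | loop_true {e : Expr} {p : Prog} {s s' s'' : State} {t t' : ℕ} (h : e.eval s ≠ 0)
      (hp : Run p s t s') (hl : Run (.loop e p) s' t' s'') :
      Run (.loop e p) s (e.cost + 1 + t + t') s''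
  | loop_false {e : Expr} {p : Prog} {s : State} (h : e.eval s = 0) :
      Run (.loop e p) s (e.cost + 1) s

/-- All registers and memory cells hold numbers that are at most `M`. -/
def State.Bounded (M : ℕ) (s : State) : Prop := (∀ x, s.reg x ≤ M) ∧ ∀ a, s.mem a ≤ M

theorem State.Bounded.mono {M M' : ℕ} {s : State} (h : s.Bounded M) (hM : M ≤ M') :
    s.Bounded M' :=
  ⟨fun x => (h.1 x).trans hM, fun a => (h.2 a).trans hM⟩

/-- A measure of the size of an expression that takes constants into account. -/
def Expr.weight : Expr → ℕ
  | .const k => k + 1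
  | .reg _ => 1
  | .load e => e.weight + 1
  | .op _ e₁ e₂ => e₁.weight + e₂.weight + 1

/-- Expressions whose value exceeds the largest number in the state by a constant at most. -/
def Expr.tame : Expr → Bool
  | .const _ => true
  | .reg _ => true
  | .load _ => true
  | .op .add e (.const _) => e.tame
  | .op .sub e _ => e.tame
  | .op .lt _ _ => true
  | .op .eq _ _ => true
  | _ => false

theorem Expr.Fits.mono {W W' : ℕ} (hW : W ≤ W') {s : State} :
    ∀ {e : Expr}, e.Fits W s → e.Fits W' s
  | .const _, h => lt_of_lt_of_le h hW
  | .reg _, h => lt_of_lt_of_le h hW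
  | .load e, h => ⟨Expr.Fits.mono hW (e := e) h.1, h.2.trans_le hW⟩
  | .op _ e₁ e₂, h =>
    ⟨Expr.Fits.mono hW (e := e₁) h.1, Expr.Fits.mono hW (e := e₂) h.2.1, h.2.2.trans_le hW⟩

/-- Multiplication adds exponents and dominates the other operations up to a factor 2, which the
extra factor `M + 2` absorbs. Constants contribute their own value to the weight because `k < 2 ^ (k
+ 1)`. -/
theorem Expr.eval_lt_pow {M : ℕ} {s : State} (hs : s.Bounded M) (e : Expr) :
    e.eval s < (M + 2) ^ e.weight := by
  have one (e : Expr) : 1 ≤ (M + 2) ^ e.weight := Nat.one_le_pow _ _ (by omega)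
  have two (e : Expr) : M + 2 ≤ (M + 2) ^ (e.weight + 1) := by
    rw [pow_succ]; exact Nat.le_mul_of_pos_left _ (one e)
  induction e with
  | const k =>
    calc k < k + 1 := Nat.lt_succ_self k
      _ < 2 ^ (k + 1) := Nat.lt_two_pow_self
      _ ≤ (M + 2) ^ (k + 1) := Nat.pow_le_pow_left (by omega) _
  | reg x => have := hs.1 x; simp only [eval, weight, pow_one]; omega
  | load e ih =>
    have := hs.2 (e.eval s)
    have := two e
    simp only [eval, weight]; omega
  | op o e₁ e₂ ih₁ ih₂ =>
    have h₁ := one e₁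
    have h₂ := one e₂
    simp only [eval, weight]
    have key : (M + 2) ^ (e₁.weight + e₂.weight + 1)
        = (M + 2) ^ e₁.weight * (M + 2) ^ e₂.weight * (M + 2) := by ring
    rw [key]
    generalize (M + 2) ^ e₁.weight = A at *
    generalize (M + 2) ^ e₂.weight = B at *
    have hAB : 1 ≤ A * B := Nat.mul_pos h₁ h₂
    have hAB2 : A * B * 2 ≤ A * B * (M + 2) := Nat.mul_le_mul_left _ (by omega)
    have hA : A ≤ A * B := Nat.le_mul_of_pos_right _ h₂
    have hB : B ≤ A * B := Nat.le_mul_of_pos_left _ h₁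
    cases o with
    | add => simp only [BinOp.eval]; omega
    | sub => simp only [BinOp.eval]; omega
    | mul =>
      simp only [BinOp.eval]
      have : e₁.eval s * e₂.eval s < A * B := Nat.mul_lt_mul'' ih₁ ih₂
      omega
    | lt => simp only [BinOp.eval]; split <;> omega
    | eq => simp only [BinOp.eval]; split <;> omega

theorem Expr.fits_pow {M : ℕ} {s : State} (hs : s.Bounded M) :
    ∀ e : Expr, e.Fits ((M + 2) ^ e.weight) s
  | .const k => eval_lt_pow hs (.const k)
  | .reg x => eval_lt_pow hs (.reg x)
  | .load e =>
    ⟨(fits_pow hs e).mono (Nat.pow_le_pow_right (by omega) (by simp only [weight]; omega)),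
      eval_lt_pow hs (.load e)⟩
  | .op o e₁ e₂ =>
    ⟨(fits_pow hs e₁).mono (Nat.pow_le_pow_right (by omega) (by simp only [weight]; omega)),
      (fits_pow hs e₂).mono (Nat.pow_le_pow_right (by omega) (by simp only [weight]; omega)),
      eval_lt_pow hs (.op o e₁ e₂)⟩

theorem Expr.fits_of_bounded {M K W : ℕ} {s : State} (hs : s.Bounded M) {e : Expr}
    (he : e.weight ≤ K) (hW : (M + 2) ^ K ≤ W) : e.Fits W s :=
  (e.fits_pow hs).mono ((Nat.pow_le_pow_right (by omega) he).trans hW)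

/-- Only additive growth is allowed in stored values. Products may occur in addresses, in tests and
inside comparisons, where their size does not accumulate over time; this is why the programs
normalise computed entries by `less 0`. -/
theorem Expr.eval_le_of_tame {M : ℕ} {s : State} (hs : s.Bounded M) (e : Expr)
    (he : e.tame = true) : e.eval s ≤ M + e.weight := by
  fun_induction Expr.tame e with
  | case1 k => simp only [eval, weight]; omega
  | case2 x => have := hs.1 x; simp only [eval]; omega
  | case3 e => have := hs.2 (e.eval s); simp only [eval]; omega
  | case4 e k ih =>
    have := ih he
    simp only [eval, weight, BinOp.eval]; omega
  | case5 e f ih =>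
    have := ih he
    simp only [eval, weight, BinOp.eval]; omega
  | case6 e f => simp only [eval, weight, BinOp.eval]; split <;> omega
  | case7 e f => simp only [eval, weight, BinOp.eval]; split <;> omega
  | case8 => simp at he

/-- A measure of the size of a program that takes constants into account. -/
def Prog.weight : Prog → ℕ
  | .skip => 0
  | .assign _ e => e.weight
  | .store a e => a.weight + e.weight
  | .seq p q => p.weight + q.weight
  | .ifte e p q => e.weight + p.weight + q.weight
  | .loop e p => e.weight + p.weight

/-- Programs that write values of tame expressions only. -/
def Prog.tame : Prog → Bool
  | .skip => true
  | .assign _ e => e.tame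
  | .store _ e => e.tame
  | .seq p q => p.tame && q.tame
  | .ifte _ p q => p.tame && q.tame
  | .loop _ p => p.tame

/-- The numbers that occur in a run of a tame program grow at most linearly with time. -/
theorem Run.exec {p : Prog} {s s' : State} {t : ℕ} (h : Run p s t s') {M K W : ℕ}
    (hs : s.Bounded M) (hp : p.tame = true) (hK : p.weight ≤ K)
    (hW : (M + K * t + 2) ^ K ≤ W) : Exec W p s t s' ∧ s'.Bounded (M + K * t) := by
  -- The word size is chosen for the end of the whole run. The next two facts pass this bound on to
  -- the start and to shorter parts of the run.
  have low {M t : ℕ} (h : (M + K * t + 2) ^ K ≤ W) : (M + 2) ^ K ≤ W :=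
    (Nat.pow_le_pow_left (by omega) _).trans h
  have low' {M t t' : ℕ} (h : (M + K * t' + 2) ^ K ≤ W) (ht : t ≤ t') :
      (M + K * t + 2) ^ K ≤ W :=
    (Nat.pow_le_pow_left (by have := Nat.mul_le_mul_left K ht; omega) _).trans h
  induction h generalizing M with
  | skip s => exact ⟨.skip s, hs.mono (by omega)⟩
  | assign x e s =>
    refine ⟨.assign x e s (Expr.fits_of_bounded hs hK (low hW)), fun y => ?_, fun a => ?_⟩
    · have h₁ := e.eval_le_of_tame hs hp
      -- A single write raises the bound by at most the weight of the expression, and the time it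
      -- takes pays for at least `K`.
      have h₂ : e.weight ≤ K * (e.cost + 1) := hK.trans (Nat.le_mul_of_pos_right _ (by omega))
      have h₃ := hs.1 y
      simp only [Function.update_apply]
      split <;> omega
    · exact (hs.2 a).trans (by omega)
  | store a e s =>
    simp only [Prog.weight] at hK
    refine ⟨.store a e s (Expr.fits_of_bounded hs (by omega) (low hW))
      (Expr.fits_of_bounded hs (by omega) (low hW)), fun y => ?_, fun c => ?_⟩
    · exact (hs.1 y).trans (by omega)
    · have h₁ := e.eval_le_of_tame hs hp
      have h₂ : e.weight ≤ K * (a.cost + e.cost + 1) :=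
        (show e.weight ≤ K by omega).trans (Nat.le_mul_of_pos_right _ (by omega))
      have h₃ := hs.2 c
      simp only [Function.update_apply]
      split <;> omega
  | @seq p q s s' s'' t t' _ _ ihp ihq =>
    simp only [Prog.tame, Bool.and_eq_true] at hp
    simp only [Prog.weight] at hK
    obtain ⟨e₁, b₁⟩ := ihp hs hp.1 (by omega) (low' hW (by omega))
    obtain ⟨e₂, b₂⟩ := ihq b₁ hp.2 (by omega) (by rwa [add_assoc M, ← mul_add])
    exact ⟨.seq _ _ _ _ _ _ _ e₁ e₂, b₂.mono (by rw [mul_add]; omega)⟩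
  | @ifte_true e p q s s' t h _ ih =>
    simp only [Prog.tame, Bool.and_eq_true] at hp
    simp only [Prog.weight] at hK
    obtain ⟨e₁, b₁⟩ := ih hs hp.1 (by omega) (low' hW (by omega))
    exact ⟨.ifte_true _ _ _ _ _ _ (Expr.fits_of_bounded hs (by omega) (low hW)) h e₁,
      b₁.mono (by rw [mul_add]; omega)⟩
  | @ifte_false e p q s s' t h _ ih =>
    simp only [Prog.tame, Bool.and_eq_true] at hp
    simp only [Prog.weight] at hK
    obtain ⟨e₁, b₁⟩ := ih hs hp.2 (by omega) (low' hW (by omega))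
    exact ⟨.ifte_false _ _ _ _ _ _ (Expr.fits_of_bounded hs (by omega) (low hW)) h e₁,
      b₁.mono (by rw [mul_add]; omega)⟩
  | @loop_true e p s s' s'' t t' h _ _ ihp ihl =>
    have hp' : p.tame = true := hp
    have hK' := hK
    simp only [Prog.weight] at hK'
    obtain ⟨e₁, b₁⟩ := ihp hs hp' (by omega) (low' hW (by omega))
    obtain ⟨e₂, b₂⟩ := ihl b₁ hp hK (by
      rw [add_assoc M, ← mul_add]; exact low' hW (by omega))
    exact ⟨.loop_true _ _ _ _ _ _ _ (Expr.fits_of_bounded hs (by omega) (low hW)) h e₁ e₂,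
      b₂.mono (by rw [add_assoc M, ← mul_add]; gcongr; omega)⟩
  | @loop_false e p s h =>
    simp only [Prog.weight] at hK
    exact ⟨.loop_false _ _ _ (Expr.fits_of_bounded hs (by omega) (low hW)) h,
      hs.mono (by omega)⟩

end WordRAM

namespace WordRAM

/-! ### A language with named variables, named arrays and bounded loops -/

namespace Bounded

/-- The variables of the language. -/
inductive Var where
  | i | j | l | c | cnt | ans | deficit | avail | outside | round | step | row | col
  | cur | found | tip | next
  deriving DecidableEq

/-- The arrays of the language. -/
inductive Arr where
  | deg | common | cand | part | req | edge | mateL | mateR | reach | par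
  deriving DecidableEq

theorem Var.ctorIdx_injective : Function.Injective Var.ctorIdx := fun a b h => by
  rw [← Var.ofNat_ctorIdx a, ← Var.ofNat_ctorIdx b, h]

theorem Arr.ctorIdx_injective : Function.Injective Arr.ctorIdx := fun a b h => by
  rw [← Arr.ofNat_ctorIdx a, ← Arr.ofNat_ctorIdx b, h]

/-- The arrays are interleaved with stride 16, so an offset below 16 makes the array and the index
recoverable from an address. -/
theorem Arr.ctorIdx_lt (a : Arr) : a.ctorIdx < 16 := by cases a <;> decide

/-- The read-only part of a state: two numbers and a memory. -/
structure Input where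
  n : ℕ
  b : ℕ
  mem : ℕ → ℕ

/-- The values of the variables and arrays. -/
@[ext]
structure Store where
  var : Var → ℕ
  arr : Arr → ℕ → ℕ

/-- Everything is `0`. -/
def Store.zero : Store := ⟨fun _ => 0, fun _ _ => 0⟩

def Store.set (a : Store) (x : Var) (v : ℕ) : Store :=
  { a with var := Function.update a.var x v }

def Store.put (a : Store) (k : Arr) (idx v : ℕ) : Store :=
  { a with arr := Function.update a.arr k (Function.update (a.arr k) idx v) }

@[simp] theorem Store.set_var (a : Store) (x : Var) (v : ℕ) (y : Var) :
    (a.set x v).var y = if y = x then v else a.var y := by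
  simp [Store.set, Function.update_apply]

@[simp] theorem Store.set_arr (a : Store) (x : Var) (v : ℕ) : (a.set x v).arr = a.arr := (rfl)

@[simp] theorem Store.put_var (a : Store) (k : Arr) (idx v : ℕ) :
    (a.put k idx v).var = a.var := (rfl)

@[simp] theorem Store.put_arr (a : Store) (k : Arr) (idx v : ℕ) (k' : Arr) (i : ℕ) :
    (a.put k idx v).arr k' i = if k' = k ∧ i = idx then v else a.arr k' i := by
  unfold Store.put
  by_cases h : k' = k
  · subst h; simp [Function.update_apply]
  · simp [h]

inductive BExpr where
  | const (k : ℕ)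
  | order
  | budget
  | inp (e : BExpr)
  | var (x : Var)
  | elem (k : Arr) (e : BExpr)
  | op (o : BinOp) (e₁ e₂ : BExpr)

namespace BExpr

instance : Add BExpr := ⟨.op .add⟩
instance : Sub BExpr := ⟨.op .sub⟩
instance : Mul BExpr := ⟨.op .mul⟩
instance (k : ℕ) : OfNat BExpr k := ⟨.const k⟩

/-- The comparison `e₁ < e₂`. -/
def less (e₁ e₂ : BExpr) : BExpr := .op .lt e₁ e₂

/-- The comparison `e₁ = e₂`. -/
def same (e₁ e₂ : BExpr) : BExpr := .op .eq e₁ e₂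

/-- The entry of the adjacency matrix in row `e₁` and column `e₂`. -/
def adj (e₁ e₂ : BExpr) : BExpr := .inp (.op .add (.op .mul e₁ .order) e₂)

/-- The entry of the indicator vector of the initial configuration. -/
def token (e : BExpr) : BExpr := .inp (.op .add (.op .mul .order .order) e)

def eval (Γ : Input) (a : Store) : BExpr → ℕ
  | .const k => k
  | .order => Γ.n
  | .budget => Γ.b
  | .inp e => Γ.mem (e.eval Γ a)
  | .var x => a.var x
  | .elem k e => a.arr k (e.eval Γ a)
  | .op o e₁ e₂ => o.eval (e₁.eval Γ a) (e₂.eval Γ a)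

section
variable (Γ : Input) (a : Store) (e₁ e₂ : BExpr)

@[simp] theorem eval_ofNat (k : ℕ) : (no_index (OfNat.ofNat k) : BExpr).eval Γ a = k := (rfl)
@[simp] theorem eval_order : BExpr.order.eval Γ a = Γ.n := (rfl)
@[simp] theorem eval_budget : BExpr.budget.eval Γ a = Γ.b := (rfl)
@[simp] theorem eval_var (x : Var) : (BExpr.var x).eval Γ a = a.var x := (rfl)
@[simp] theorem eval_elem (k : Arr) : (BExpr.elem k e₁).eval Γ a = a.arr k (e₁.eval Γ a) := (rfl)
@[simp] theorem eval_add : (e₁ + e₂).eval Γ a = e₁.eval Γ a + e₂.eval Γ a := (rfl)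
@[simp] theorem eval_sub : (e₁ - e₂).eval Γ a = e₁.eval Γ a - e₂.eval Γ a := (rfl)
@[simp] theorem eval_mul : (e₁ * e₂).eval Γ a = e₁.eval Γ a * e₂.eval Γ a := (rfl)
@[simp] theorem eval_less :
    (less e₁ e₂).eval Γ a = if e₁.eval Γ a < e₂.eval Γ a then 1 else 0 := (rfl)
@[simp] theorem eval_same :
    (same e₁ e₂).eval Γ a = if e₁.eval Γ a = e₂.eval Γ a then 1 else 0 := (rfl)
@[simp] theorem eval_adj :
    (adj e₁ e₂).eval Γ a = Γ.mem (e₁.eval Γ a * Γ.n + e₂.eval Γ a) := (rfl)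
@[simp] theorem eval_token : (token e₁).eval Γ a = Γ.mem (Γ.n * Γ.n + e₁.eval Γ a) := (rfl)

end

/-- The read-only memory occupies `n² + n` cells; the arrays follow, interleaved. -/
def compile : BExpr → Expr
  | .const k => .const k
  | .order => .reg 0
  | .budget => .reg 1
  -- The factor masks reads beyond the input, since those cells hold the arrays on the machine but
  -- count as `0` in the language.
  | .inp e =>
    .op .mul (.op .lt e.compile (.op .add (.op .mul (.reg 0) (.reg 0)) (.reg 0)))
      (.load e.compile)
  | .var x => .reg (x.ctorIdx + 2)
  | .elem k e =>
    .load (.op .add (.op .add (.op .mul (.reg 0) (.reg 0)) (.reg 0))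
      (.op .add (.op .mul (.const 16) e.compile) (.const k.ctorIdx)))
  | .op o e₁ e₂ => .op o e₁.compile e₂.compile

end BExpr

/-- The machine state `s` represents the store `a`. -/
structure Represents (Γ : Input) (s : State) (a : Store) : Prop where
  size : s.reg 0 = Γ.n
  budget : s.reg 1 = Γ.b
  var : ∀ x : Var, s.reg (x.ctorIdx + 2) = a.var x
  inp : ∀ i < Γ.n * Γ.n + Γ.n, s.mem i = Γ.mem i
  arr : ∀ (k : Arr) (i : ℕ), s.mem (Γ.n * Γ.n + Γ.n + (16 * i + k.ctorIdx)) = a.arr k i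

/-- The read-only memory is `0` outside of its `n² + n` cells. -/
def Input.Valid (Γ : Input) : Prop := ∀ i, Γ.n * Γ.n + Γ.n ≤ i → Γ.mem i = 0

theorem Represents.eval {Γ : Input} (hΓ : Γ.Valid) {s : State} {a : Store}
    (h : Represents Γ s a) (e : BExpr) : e.compile.eval s = e.eval Γ a := by
  induction e with
  | const k => rfl
  | order => exact h.size
  | budget => exact h.budget
  | inp e ih =>
    simp only [BExpr.compile, Expr.eval, BinOp.eval, ih, h.size, BExpr.eval]
    split_ifs with h'
    · rw [one_mul, h.inp _ h']
    · rw [zero_mul, hΓ _ (not_lt.1 h')]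
  | var x => exact h.var x
  | elem k e ih =>
    simp only [BExpr.compile, Expr.eval, BinOp.eval, ih, h.size, BExpr.eval, h.arr]
  | op o e₁ e₂ ih₁ ih₂ => simp only [BExpr.compile, Expr.eval, BExpr.eval, ih₁, ih₂]

theorem Represents.set {Γ : Input} {s : State} {a : Store} (h : Represents Γ s a) (x : Var)
    (v : ℕ) :
    Represents Γ { s with reg := Function.update s.reg (x.ctorIdx + 2) v } (a.set x v) where
  size := by simp [h.size]
  budget := by simp [h.budget]
  var y := by simp [Function.update_apply, h.var, Var.ctorIdx_injective.eq_iff]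
  inp := h.inp
  arr := h.arr

theorem Represents.put {Γ : Input} {s : State} {a : Store} (h : Represents Γ s a) (k : Arr)
    (i v : ℕ) : Represents Γ
      { s with mem := Function.update s.mem (Γ.n * Γ.n + Γ.n + (16 * i + k.ctorIdx)) v }
      (a.put k i v) where
  size := h.size
  budget := h.budget
  var := h.var
  inp j hj := by rw [← h.inp j hj]; exact Function.update_of_ne (by omega) _ _
  arr k' i' := by
    have hk := k.ctorIdx_lt
    have hk' := k'.ctorIdx_lt
    have : Γ.n * Γ.n + Γ.n + (16 * i' + k'.ctorIdx) = Γ.n * Γ.n + Γ.n + (16 * i + k.ctorIdx) ↔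
        k' = k ∧ i' = i := by
      rw [← Arr.ctorIdx_injective.eq_iff]; omega
    simp only [Function.update_apply, Store.put_arr, h.arr, this]

inductive BProg where
  | skip
  | set (x : Var) (e : BExpr)
  | put (k : Arr) (idx e : BExpr)
  | seq (p q : BProg)
  | ite (e : BExpr) (p q : BProg)
  /-- The variable `x` runs from `0` to `n + k - 1`. -/
  | loop (x : Var) (k : ℕ) (p : BProg)

/-- `iter f m a` applies `f 0`, `f 1`, …, `f (m - 1)` to `a`, in this order. -/
def iter (f : ℕ → Store → Store) : ℕ → Store → Store
  | 0, a => a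
  | m + 1, a => f m (iter f m a)

namespace BProg

def denote (Γ : Input) : BProg → Store → Store
  | .skip, a => a
  | .set x e, a => a.set x (e.eval Γ a)
  | .put k i e, a => a.put k (i.eval Γ a) (e.eval Γ a)
  | .seq p q, a => q.denote Γ (p.denote Γ a)
  | .ite e p q, a => if e.eval Γ a = 0 then q.denote Γ a else p.denote Γ a
  | .loop x k p, a =>
    -- The counter on the machine is incremented after the last pass and ends at `n + k`; the outer
    -- `set` records this value.
    (iter (fun m a => p.denote Γ (a.set x m)) (Γ.n + k) a).set x (Γ.n + k)

/-- The program writes the variable `x`. -/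
def writes (x : Var) : BProg → Bool
  | .skip => false
  | .set y _ => decide (y = x)
  | .put _ _ _ => false
  | .seq p q => p.writes x || q.writes x
  | .ite _ p q => p.writes x || q.writes x
  | .loop y _ p => decide (y = x) || p.writes x

/-- The program writes to the array `k`. -/
def writesArr (k : Arr) : BProg → Bool
  | .skip => false
  | .set _ _ => false
  | .put l _ _ => decide (l = k)
  | .seq p q => p.writesArr k || q.writesArr k
  | .ite _ p q => p.writesArr k || q.writesArr k
  | .loop _ _ p => p.writesArr k

/-- No loop variable is written in the body of its loop. -/
def wf : BProg → Bool
  | .skip => true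
  | .set _ _ => true
  | .put _ _ _ => true
  | .seq p q => p.wf && q.wf
  | .ite _ p q => p.wf && q.wf
  | .loop x _ p => !p.writes x && p.wf

/-- The nesting depth of loops. -/
def depth : BProg → ℕ
  | .skip => 0
  | .set _ _ => 0
  | .put _ _ _ => 0
  | .seq p q => max p.depth q.depth
  | .ite _ p q => max p.depth q.depth
  | .loop _ _ p => p.depth + 1

def compile : BProg → Prog
  | .skip => .skip
  | .set x e => .assign (x.ctorIdx + 2) e.compile
  | .put k i e =>
    .store (.op .add (.op .add (.op .mul (.reg 0) (.reg 0)) (.reg 0))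
      (.op .add (.op .mul (.const 16) i.compile) (.const k.ctorIdx))) e.compile
  | .seq p q => .seq p.compile q.compile
  | .ite e p q => .ifte e.compile p.compile q.compile
  | .loop x k p =>
    .seq (.assign (x.ctorIdx + 2) (.const 0))
      (.loop (.op .lt (.reg (x.ctorIdx + 2)) (.op .add (.reg 0) (.const k)))
        (.seq p.compile
          (.assign (x.ctorIdx + 2) (.op .add (.reg (x.ctorIdx + 2)) (.const 1)))))

theorem iter_induction {f : ℕ → Store → Store} (P : ℕ → Store → Prop) {m : ℕ} {a : Store}
    (h0 : P 0 a) (hs : ∀ j < m, ∀ a, P j a → P (j + 1) (f j a)) : P m (iter f m a) := by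
  induction m with
  | zero => exact h0
  | succ m ih => exact hs m (Nat.lt_succ_self m) _ (ih fun j hj => hs j (by omega))

/-- Loop invariants. -/
theorem denote_for {Γ : Input} {x : Var} {k : ℕ} {p : BProg} {a : Store}
    (P : ℕ → Store → Prop) (h0 : P 0 a)
    (hs : ∀ j < Γ.n + k, ∀ a, P j a → P (j + 1) (p.denote Γ (a.set x j)))
    {Q : Store → Prop} (hQ : ∀ a, P (Γ.n + k) a → Q (a.set x (Γ.n + k))) :
    Q ((BProg.loop x k p).denote Γ a) :=
  hQ _ (iter_induction P h0 hs)

/-- A frame rule by inspection of the syntax: `writes` computes on concrete programs, so its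
hypothesis is discharged by `rfl` where the rule is used. -/
theorem denote_var {Γ : Input} {x : Var} (p : BProg) (h : p.writes x = false) (a : Store) :
    (p.denote Γ a).var x = a.var x := by
  induction p generalizing a with
  | skip => rfl
  | set y e => simp_all [writes, denote, eq_comm]
  | put => rfl
  | seq p q ihp ihq => simp_all [writes, denote]
  | ite e p q ihp ihq =>
    simp only [writes, Bool.or_eq_false_iff] at h
    simp only [denote]
    split_ifs <;> simp_all
  | loop y k p ih =>
    simp only [writes, Bool.or_eq_false_iff, decide_eq_false_iff_not] at h
    simp only [denote, Store.set_var, if_neg (Ne.symm h.1)]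
    refine iter_induction (fun _ b => b.var x = a.var x) rfl fun j _ b hb => ?_
    rw [ih h.2, Store.set_var, if_neg (Ne.symm h.1), hb]

theorem denote_arr {Γ : Input} {k : Arr} (p : BProg) (h : p.writesArr k = false) (a : Store) :
    (p.denote Γ a).arr k = a.arr k := by
  induction p generalizing a with
  | skip => rfl
  | set y e => rfl
  | put l i e =>
    simp only [writesArr, decide_eq_false_iff_not] at h
    ext i; simp [denote, Ne.symm h]
  | seq p q ihp ihq => simp_all [writesArr, denote]
  | ite e p q ihp ihq =>
    simp only [writesArr, Bool.or_eq_false_iff] at h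
    simp only [denote]
    split_ifs <;> simp_all
  | loop y m p ih =>
    simp only [writesArr] at h
    simp only [denote, Store.set_arr]
    refine iter_induction (fun _ b => b.arr k = a.arr k) rfl fun j _ b hb => ?_
    rw [ih h, Store.set_arr, hb]

/-- The constant factor in the running time. -/
def factor : BProg → ℕ
  | .skip => 1
  | .set _ e => e.compile.cost + 1
  | .put _ i e => i.compile.cost + e.compile.cost + 11
  | .seq p q => p.factor + q.factor
  | .ite e p q => e.compile.cost + 1 + p.factor + q.factor
  | .loop _ k p => (k + 1) * (p.factor + 10) + 8

/-- A program with loops of nesting depth `d` runs in time `O(n ^ d)`. -/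
theorem run_compile {Γ : Input} (hΓ : Γ.Valid) (p : BProg) (hp : p.wf = true) {s : State}
    {a : Store} (h : Represents Γ s a) :
    ∃ t s', Run p.compile s t s' ∧ Represents Γ s' (p.denote Γ a) ∧
      t ≤ p.factor * (Γ.n + 1) ^ p.depth := by
  have mono {c d d' : ℕ} (hd : d ≤ d') : c * (Γ.n + 1) ^ d ≤ c * (Γ.n + 1) ^ d' :=
    Nat.mul_le_mul_left _ (Nat.pow_le_pow_right (by omega) hd)
  have le_mono (c d : ℕ) : c ≤ c * (Γ.n + 1) ^ d := by simpa using mono (c := c) (Nat.zero_le d)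
  induction p generalizing s a with
  | skip => exact ⟨1, s, .skip s, h, by simp [factor, depth]⟩
  | set x e =>
    refine ⟨_, _, .assign _ _ s, ?_, by simp [factor, depth]⟩
    rw [h.eval hΓ]; exact h.set x _
  | put k i e =>
    refine ⟨_, _, .store _ _ s, ?_, by simp [factor, depth, Expr.cost]; omega⟩
    simp only [Expr.eval, BinOp.eval, h.eval hΓ, h.size]; exact h.put k _ _
  | seq p q ihp ihq =>
    simp only [wf, Bool.and_eq_true] at hp
    obtain ⟨t₁, s₁, r₁, h₁, l₁⟩ := ihp hp.1 h
    obtain ⟨t₂, s₂, r₂, h₂, l₂⟩ := ihq hp.2 h₁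
    refine ⟨_, _, .seq r₁ r₂, h₂, ?_⟩
    simp only [factor, depth, add_mul]
    exact add_le_add (l₁.trans (mono (le_max_left _ _))) (l₂.trans (mono (le_max_right _ _)))
  | ite e p q ihp ihq =>
    simp only [wf, Bool.and_eq_true] at hp
    have h₀ := le_mono (e.compile.cost + 1) (max p.depth q.depth)
    by_cases he : e.eval Γ a = 0
    · obtain ⟨t, s', r, h', l⟩ := ihq hp.2 h
      refine ⟨_, s', .ifte_false ((h.eval hΓ e).trans he) r, by simpa [denote, he] using h', ?_⟩
      simp only [factor, depth, add_mul _ (q.factor), add_mul _ (p.factor)]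
      have := l.trans (mono (c := q.factor) (le_max_right p.depth q.depth))
      omega
    · obtain ⟨t, s', r, h', l⟩ := ihp hp.1 h
      refine ⟨_, s', .ifte_true (by rwa [h.eval hΓ e]) r, by simpa [denote, he] using h', ?_⟩
      simp only [factor, depth, add_mul _ (q.factor), add_mul _ (p.factor)]
      have := l.trans (mono (c := p.factor) (le_max_left p.depth q.depth))
      omega
  | loop x k p ih =>
    simp only [wf, Bool.and_eq_true, Bool.not_eq_true'] at hp
    set f : ℕ → Store → Store := fun m a => p.denote Γ (a.set x m) with hf
    set body : Prog := .seq p.compile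
      (.assign (x.ctorIdx + 2) (.op .add (.reg (x.ctorIdx + 2)) (.const 1))) with hbody
    set test : Expr := .op .lt (.reg (x.ctorIdx + 2)) (.op .add (.reg 0) (.const k)) with htest
    set T := p.factor * (Γ.n + 1) ^ p.depth with hT
    -- Induction on the number `m` of remaining passes. The test costs 6 steps and the increment 4,
    -- hence `T + 10` per pass and 6 for the final test; the initial assignment adds 2 more, giving
    -- the 8 in `factor`.
    have key : ∀ m, ∀ j, j + m = Γ.n + k → ∀ s, Represents Γ s ((iter f j a).set x j) →
        ∃ t s', Run (.loop test body) s t s' ∧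
          Represents Γ s' ((iter f (Γ.n + k) a).set x (Γ.n + k)) ∧ t ≤ m * (T + 10) + 6 := by
      intro m
      induction m with
      | zero =>
        intro j hj s hs
        obtain rfl : j = Γ.n + k := by omega
        refine ⟨_, s, .loop_false ?_, hs, by simp [htest, Expr.cost]⟩
        have := hs.var x
        simp [htest, Expr.eval, BinOp.eval, hs.size, this]
      | succ m ihm =>
        intro j hj s hs
        obtain ⟨t₁, s₁, r₁, h₁, l₁⟩ := ih hp.2 hs
        have hv : (p.denote Γ ((iter f j a).set x j)).var x = j := by
          rw [denote_var p hp.1]; simp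
        have h₂ := h₁.set x (j + 1)
        have e₁ : (Expr.op .add (.reg (x.ctorIdx + 2)) (.const 1)).eval s₁ = j + 1 := by
          simp [Expr.eval, BinOp.eval, h₁.var, hv]
        have e₂ : (iter f (j + 1) a).set x (j + 1)
            = (p.denote Γ ((iter f j a).set x j)).set x (j + 1) := rfl
        rw [← e₂] at h₂
        have r₂ := Run.assign (x.ctorIdx + 2) (.op .add (.reg (x.ctorIdx + 2)) (.const 1)) s₁
        rw [e₁] at r₂
        obtain ⟨t₃, s₃, r₃, h₃, l₃⟩ := ihm (j + 1) (by omega) _ h₂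
        have ht : test.eval s ≠ 0 := by
          have := hs.var x
          simp [htest, Expr.eval, BinOp.eval, hs.size, this]; omega
        refine ⟨_, _, .loop_true ht (.seq r₁ r₂) r₃, h₃, ?_⟩
        simp only [htest, Expr.cost]
        rw [add_mul, one_mul]
        omega
    have hs := h.set x 0
    obtain ⟨t, s', r, h', l⟩ := key (Γ.n + k) 0 (by omega) _ hs
    refine ⟨_, s', .seq (.assign _ _ s) r, h', ?_⟩
    -- The `k` additional passes are absorbed by `n + k ≤ (k + 1) * (n + 1)`.
    have h₁ : (Γ.n + k) * (T + 10) ≤ ((k + 1) * (p.factor + 10)) * (Γ.n + 1) ^ (p.depth + 1) := by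
      calc (Γ.n + k) * (T + 10)
          ≤ ((k + 1) * (Γ.n + 1)) * ((p.factor + 10) * (Γ.n + 1) ^ p.depth) := by
            refine Nat.mul_le_mul (by nlinarith [Nat.zero_le (k * Γ.n)]) ?_
            have := le_mono 10 p.depth
            rw [add_mul]; omega
        _ = _ := by ring
    have h₂ := le_mono 8 (p.depth + 1)
    simp only [factor, depth, Expr.cost]
    rw [add_mul]
    omega

end BProg

end Bounded

end WordRAM

/-! ### Bipartite matching -/

/-- The pairs in `M` are related by `E`, and no two of them share a component. -/
structure IsMatching {α β : Type*} (E : α → β → Prop) (M : Finset (α × β)) : Prop where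
  edge : ∀ p ∈ M, E p.1 p.2
  fst : Set.InjOn Prod.fst (M : Set (α × β))
  snd : Set.InjOn Prod.snd (M : Set (α × β))

namespace BipartiteSearch

/-- The vertices `x` and `y` are matched if `mL x = y + 1` and `mR y = x + 1`;
the value `0` belongs to unmatched vertices. -/
structure IsMate (n : ℕ) (E : ℕ → ℕ → Prop) (mL mR : ℕ → ℕ) : Prop where
  left_le : ∀ x < n, mL x ≤ n
  right_le : ∀ y < n, mR y ≤ n
  iff : ∀ x < n, ∀ y < n, mL x = y + 1 ↔ mR y = x + 1
  edge : ∀ x < n, ∀ y < n, mL x = y + 1 → E x y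

/-- The number of matched vertices. -/
def size (n : ℕ) (mL : ℕ → ℕ) : ℕ := ((Finset.range n).filter fun x => mL x ≠ 0).card

/-- The invariant of a breadth first search from the unmatched vertices on the left. A vertex `x`
on the left has been reached if `reach x ≠ 0`, and scanned in round `reach x - 2` if
`2 ≤ reach x`. A vertex `y` on the right has been reached from `x` if `par y = x + 1`. In the
current round `j`, the vertex `r` has been scanned up to its neighbour `m`. -/
structure Search (n : ℕ) (E : ℕ → ℕ → Prop) (mL mR reach par : ℕ → ℕ) (found j r m : ℕ) :
    Prop where
  free : ∀ x < n, mL x = 0 → reach x ≠ 0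
  scanned : ∀ x < n, 2 ≤ reach x → ∀ y < n, E x y → par y ≠ 0 ∨ (x = r ∧ m ≤ y)
  parent : ∀ y < n, par y ≠ 0 → ∃ x < n, par y = x + 1 ∧ 2 ≤ reach x ∧ E x y
  reached : ∀ y < n, par y ≠ 0 → mR y = 0 ∨ reach (mR y - 1) ≠ 0
  hit : ∀ y < n, par y ≠ 0 → mR y = 0 → found ≠ 0
  found : found ≠ 0 → ∃ y < n, found = y + 1 ∧ par y ≠ 0 ∧ mR y = 0
  back : ∀ x < n, reach x ≠ 0 → mL x = 0 ∨
    ∃ y < n, mL x = y + 1 ∧ par y ≠ 0 ∧ (2 ≤ reach x → reach (par y - 1) < reach x)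
  le : ∀ x < n, reach x ≤ j + 1

section
variable {n : ℕ} {E : ℕ → ℕ → Prop} {mL mR reach par : ℕ → ℕ} {found j r m : ℕ}

/-- An augmenting path ends here, but the search goes on: `found` keeps the most recent unmatched
vertex, and any of them will do. -/
theorem Search.visit_free (h : Search n E mL mR reach par found j r m) (hm : m < n) (hr : r < n)
    (hrr : 2 ≤ reach r) (hE : E r m) (hp : par m = 0) (hR : mR m = 0) {par' : ℕ → ℕ}
    (hp' : ∀ z, par' z = if z = m then r + 1 else par z) :
    Search n E mL mR reach par' (m + 1) j r (m + 1) where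
  free := h.free
  scanned x hx hx' y hy hxy := by
    rcases h.scanned x hx hx' y hy hxy with h' | h' <;> rw [hp'] <;> split_ifs <;> omega
  parent y hy hpy := by
    rw [hp'] at hpy ⊢
    split_ifs with h'
    · subst h'; exact ⟨r, hr, rfl, hrr, hE⟩
    · rw [if_neg h'] at hpy; exact h.parent y hy hpy
  reached y hy hpy := by
    by_cases h' : y = m
    · subst h'; exact .inl hR
    · rw [hp', if_neg h'] at hpy; exact h.reached y hy hpy
  hit _ _ _ _ := by omega
  found _ := ⟨m, hm, rfl, by rw [hp', if_pos rfl]; omega, hR⟩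
  back x hx hxr := by
    rcases h.back x hx hxr with h' | ⟨y, hy, h1, h2, h3⟩
    · exact .inl h'
    · have : y ≠ m := by rintro rfl; exact h2 hp
      exact .inr ⟨y, hy, h1, by rwa [hp', if_neg this], by rwa [hp', if_neg this]⟩
  le := h.le

/-- The mate of `m` cannot have been reached earlier: by `back`, a reached matched vertex has a mate
with a parent, and `par m = 0`. So the mark 1 overwrites no round number, and the order of the
rounds along parents stays intact. -/
theorem Search.visit_matched (h : Search n E mL mR reach par found j r m)
    (hM : IsMate n E mL mR) (hm : m < n) (hr : r < n)
    (hrr : 2 ≤ reach r) (hE : E r m) (hp : par m = 0) (hR : mR m ≠ 0) {par' reach' : ℕ → ℕ}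
    (hp' : ∀ z, par' z = if z = m then r + 1 else par z)
    (hr' : ∀ z, reach' z = if z = mR m - 1 then 1 else reach z) :
    reach (mR m - 1) = 0 ∧ Search n E mL mR reach' par' found j r (m + 1) := by
  obtain ⟨x, hx⟩ : ∃ x, mR m = x + 1 := ⟨mR m - 1, by omega⟩
  have hxn : x < n := by have := hM.right_le m hm; omega
  have hLx : mL x = m + 1 := (hM.iff x hxn m hm).2 hx
  simp only [hx, Nat.add_sub_cancel] at hr' ⊢
  have hx0 : reach x = 0 := by
    by_contra h0
    rcases h.back x hxn h0 with h' | ⟨y, hy, h1, h2, h3⟩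
    · omega
    · obtain rfl : y = m := by omega
      exact h2 hp
  have big {z : ℕ} (hz : 2 ≤ reach z) : reach' z = reach z := by
    rw [hr', if_neg]; rintro rfl; omega
  have big' {z : ℕ} (hz : 2 ≤ reach' z) : 2 ≤ reach z := by
    rw [hr'] at hz; split_ifs at hz <;> omega
  have pos {z : ℕ} (hz : reach z ≠ 0) : reach' z ≠ 0 := by
    rw [hr']; split_ifs <;> omega
  refine ⟨hx0, ?_, ?_, ?_, ?_, ?_, ?_, ?_, ?_⟩
  · exact fun z hz h0 => pos (h.free z hz h0)
  · intro z hz hz' y hy hzy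
    rcases h.scanned z hz (big' hz') y hy hzy with h' | h' <;> rw [hp'] <;> split_ifs <;> omega
  · intro y hy hpy
    rw [hp'] at hpy ⊢
    split_ifs with h'
    · subst h'; exact ⟨r, hr, rfl, by rwa [big hrr], hE⟩
    · rw [if_neg h'] at hpy
      obtain ⟨z, hz, h1, h2, h3⟩ := h.parent y hy hpy
      exact ⟨z, hz, h1, by rwa [big h2], h3⟩
  · intro y hy hpy
    by_cases h' : y = m
    · subst h'; right; rw [hr', if_pos (by omega)]; omega
    · rw [hp', if_neg h'] at hpy
      exact (h.reached y hy hpy).imp id pos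
  · intro y hy hpy h0
    have h' : y ≠ m := by rintro rfl; exact hR h0
    rw [hp', if_neg h'] at hpy
    exact h.hit y hy hpy h0
  · intro hf
    obtain ⟨y, hy, h1, h2, h3⟩ := h.found hf
    have h' : y ≠ m := by rintro rfl; exact hR h3
    exact ⟨y, hy, h1, by rwa [hp', if_neg h'], h3⟩
  · intro z hz hzr
    by_cases hzx : z = x
    · subst hzx
      refine .inr ⟨m, hm, hLx, by rw [hp', if_pos rfl]; omega, fun h2 => ?_⟩
      rw [hr', if_pos rfl] at h2; omega
    · have hre : reach' z = reach z := by rw [hr', if_neg hzx]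
      rw [hre] at hzr ⊢
      rcases h.back z hz hzr with h' | ⟨y, hy, h1, h2, h3⟩
      · exact .inl h'
      · have : y ≠ m := by rintro rfl; exact h2 hp
        obtain ⟨w, hw, e1, e2, e3⟩ := h.parent y hy h2
        refine .inr ⟨y, hy, h1, by rwa [hp', if_neg this], ?_⟩
        rw [hp', if_neg this, e1, Nat.add_sub_cancel, big e2]
        rwa [e1, Nat.add_sub_cancel] at h3
  · intro z hz
    have := h.le z hz
    rw [hr']; split_ifs <;> omega

theorem Search.visit_skip (h : Search n E mL mR reach par found j r m)
    (hs : E r m → par m ≠ 0) : Search n E mL mR reach par found j r (m + 1) :=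
  { h with
    scanned := fun x hx hx' y hy hxy => by
      rcases h.scanned x hx hx' y hy hxy with h' | ⟨rfl, h'⟩
      · exact .inl h'
      · by_cases hy' : y = m
        · subst hy'; exact .inl (hs hxy)
        · exact .inr ⟨rfl, by omega⟩ }

/-- With `m = n` the exception in `scanned` is empty, so the vertex that it names may be changed at
will. -/
theorem Search.next (h : Search n E mL mR reach par found j r n) (r' : ℕ) :
    Search n E mL mR reach par found (j + 1) r' n :=
  { h with
    scanned := fun x hx hx' y hy hxy => (h.scanned x hx hx' y hy hxy).imp id fun h' => by omega
    le := fun x hx => (h.le x hx).trans (by omega) }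

/-- By `le`, the new number `j + 2` exceeds all numbers given so far, which yields the strict
inequality that `back` requires of `s`. The exception in `scanned` now covers all neighbours of `s`.
-/
theorem Search.scan (h : Search n E mL mR reach par found j r n) {s : ℕ}
    (hs1 : reach s = 1) {reach' : ℕ → ℕ} (hr' : ∀ z, reach' z = if z = s then j + 2 else reach z) :
    Search n E mL mR reach' par found (j + 1) s 0 := by
  have big {z : ℕ} (hz : 2 ≤ reach z) : reach' z = reach z := by
    rw [hr', if_neg]; rintro rfl; omega
  have pos {z : ℕ} (hz : reach z ≠ 0) : reach' z ≠ 0 := by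
    rw [hr']; split_ifs <;> omega
  have pos' {z : ℕ} (hz : reach' z ≠ 0) : reach z ≠ 0 := by
    rw [hr'] at hz; split_ifs at hz with h'
    · subst h'; omega
    · exact hz
  refine ⟨?_, ?_, ?_, ?_, h.hit, h.found, ?_, ?_⟩
  · exact fun z hz h0 => pos (h.free z hz h0)
  · intro z hz hz' y hy hzy
    by_cases h' : z = s
    · exact .inr ⟨h', Nat.zero_le _⟩
    · rw [hr', if_neg h'] at hz'
      exact (h.scanned z hz hz' y hy hzy).imp id fun h' => by omega
  · intro y hy hpy
    obtain ⟨z, hz, h1, h2, h3⟩ := h.parent y hy hpy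
    exact ⟨z, hz, h1, by rwa [big h2], h3⟩
  · exact fun y hy hpy => (h.reached y hy hpy).imp id pos
  · intro z hz hzr
    rcases h.back z hz (pos' hzr) with h' | ⟨y, hy, h1, h2, h3⟩
    · exact .inl h'
    · obtain ⟨w, hw, e1, e2, e3⟩ := h.parent y hy h2
      refine .inr ⟨y, hy, h1, h2, ?_⟩
      rw [e1, Nat.add_sub_cancel] at h3 ⊢
      rw [big e2, hr']
      have := h.le w hw
      split_ifs
      · omega
      · exact h3
  · intro z hz
    have := h.le z hz
    rw [hr']; split_ifs <;> omega

/-- A search that ends without an augmenting path certifies that the matching is maximum. -/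
theorem Search.maximum (h : Search n E mL mR reach par 0 j r n)
    (hM : IsMate n E mL mR) (hr : ∀ x < n, reach x ≠ 1) {M : Finset (ℕ × ℕ)}
    (hmat : IsMatching (fun x y => x < n ∧ y < n ∧ E x y) M) : M.card ≤ size n mL := by
  have key : ∀ p ∈ M, reach p.1 ≠ 0 → ∃ z < n, mR p.2 = z + 1 ∧ reach z ≠ 0 ∧ mL z = p.2 + 1 := by
    intro p hp h0
    obtain ⟨h1, h2, h3⟩ := hmat.edge p hp
    have h4 : par p.2 ≠ 0 := by
      have := h.scanned p.1 h1 (by have := hr p.1 h1; omega) p.2 h2 h3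
      omega
    have h5 : mR p.2 ≠ 0 := fun h' => h.hit p.2 h2 h4 h' rfl
    have h6 := hM.right_le p.2 h2
    have h7 : mR p.2 = (mR p.2 - 1) + 1 := by omega
    exact ⟨mR p.2 - 1, by omega, h7, (h.reached p.2 h2 h4).resolve_left h5,
      (hM.iff _ (by omega) p.2 h2).2 h7⟩
  -- An edge with unreached left end is charged to that end, which is matched because unmatched
  -- vertices are reached. Any other edge is charged to the mate of its right end, a reached vertex.
  -- The two kinds of images are therefore disjoint.
  refine Finset.card_le_card_of_injOn (fun p => if reach p.1 = 0 then p.1 else mR p.2 - 1) ?_ ?_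
  · intro p hp
    obtain ⟨h1, h2, h3⟩ := hmat.edge p hp
    simp only [Finset.coe_filter, Finset.mem_range, Set.mem_ofPred_eq]
    split_ifs with h0
    · exact ⟨h1, fun h' => h.free _ h1 h' h0⟩
    · obtain ⟨z, hz, e1, e2, e3⟩ := key p hp h0
      rw [e1, Nat.add_sub_cancel]
      exact ⟨hz, by omega⟩
  · intro p hp q hq hpq
    simp only at hpq
    split_ifs at hpq with h1 h2 h2
    · exact hmat.fst hp hq hpq
    · obtain ⟨z, hz, e1, e2, e3⟩ := key q hq h2
      rw [e1, Nat.add_sub_cancel] at hpq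
      rw [hpq] at h1; exact absurd h1 e2
    · obtain ⟨z, hz, e1, e2, e3⟩ := key p hp h1
      rw [e1, Nat.add_sub_cancel] at hpq
      rw [← hpq] at h2; exact absurd h2 e2
    · obtain ⟨z, hz, e1, e2, e3⟩ := key p hp h1
      obtain ⟨z', hz', e1', e2', e3'⟩ := key q hq h2
      rw [e1, e1', Nat.add_sub_cancel, Nat.add_sub_cancel] at hpq
      subst hpq
      exact hmat.snd hp hq (show p.2 = q.2 by omega)

theorem card_le_of_isMatching {M : Finset (ℕ × ℕ)}
    (hmat : IsMatching (fun x y => x < n ∧ y < n ∧ E x y) M) : M.card ≤ n := by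
  have := Finset.card_le_card_of_injOn (t := Finset.range n) Prod.fst
    (fun p hp => by simpa using (hmat.edge p hp).1) hmat.fst
  simpa using this

theorem IsMate.exists_isMatching (hM : IsMate n E mL mR) :
    ∃ M, IsMatching (fun x y => x < n ∧ y < n ∧ E x y) M ∧ M.card = size n mL := by
  have key : ∀ x < n, mL x ≠ 0 → mL x - 1 < n ∧ E x (mL x - 1) ∧ mR (mL x - 1) = x + 1 := by
    intro x hx h0
    have h1 := hM.left_le x hx
    have h2 : mL x = (mL x - 1) + 1 := by omega
    exact ⟨by omega, hM.edge x hx _ (by omega) h2, (hM.iff x hx _ (by omega)).1 h2⟩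
  refine ⟨((Finset.range n).filter fun x => mL x ≠ 0).image fun x => (x, mL x - 1),
    ⟨?_, ?_, ?_⟩, Finset.card_image_of_injective _ fun x y hxy => (Prod.ext_iff.1 hxy).1⟩
  · simp only [Finset.mem_image, Finset.mem_filter, Finset.mem_range]
    rintro _ ⟨x, ⟨hx, h0⟩, rfl⟩
    exact ⟨hx, (key x hx h0).1, (key x hx h0).2.1⟩
  · intro p hp q hq hpq
    simp only [Finset.coe_image, Set.mem_image, Finset.coe_filter, Finset.mem_range,
      Set.mem_ofPred_eq] at hp hq
    obtain ⟨x, -, rfl⟩ := hp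
    obtain ⟨y, -, rfl⟩ := hq
    simp only at hpq
    rw [hpq]
  · intro p hp q hq hpq
    simp only [Finset.coe_image, Set.mem_image, Finset.coe_filter, Finset.mem_range,
      Set.mem_ofPred_eq] at hp hq
    obtain ⟨x, ⟨hx, h0⟩, rfl⟩ := hp
    obtain ⟨y, ⟨hy, h0'⟩, rfl⟩ := hq
    simp only at hpq
    have h1 := (key x hx h0).2.2
    have h2 := (key y hy h0').2.2
    rw [hpq] at h1
    have : x = y := by omega
    rw [this]

/-- Matching an unmatched vertex `y` on the right to an unmatched vertex `x` on the left. -/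
theorem IsMate.extend (hM : IsMate n E mL mR) {x y : ℕ} (hx : x < n) (hy : y < n) (hE : E x y)
    (hL : mL x = 0) (hR : mR y = 0) {mL' mR' : ℕ → ℕ}
    (hL' : ∀ z, mL' z = if z = x then y + 1 else mL z)
    (hR' : ∀ z, mR' z = if z = y then x + 1 else mR z) :
    IsMate n E mL' mR' ∧ size n mL' = size n mL + 1 := by
  refine ⟨⟨?_, ?_, ?_, ?_⟩, ?_⟩
  · intro z hz; have := hM.left_le z hz; rw [hL']; split_ifs <;> omega
  · intro z hz; have := hM.right_le z hz; rw [hR']; split_ifs <;> omega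
  · intro z hz w hw
    have := hM.iff z hz w hw
    have h1 := hM.iff x hx w hw
    have h2 := hM.iff z hz y hy
    rw [hL', hR']; split_ifs <;> omega
  · intro z hz w hw hzw
    rw [hL'] at hzw
    split_ifs at hzw with h'
    · obtain rfl : w = y := by omega
      rwa [h']
    · exact hM.edge z hz w hw hzw
  · have : (Finset.range n).filter (fun z => mL' z ≠ 0)
        = insert x ((Finset.range n).filter fun z => mL z ≠ 0) := by
      ext z
      simp only [Finset.mem_filter, Finset.mem_range, Finset.mem_insert, hL']
      by_cases h' : z = x
      · subst h'; simp [hx]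
      · simp [h']
    rw [size, this, Finset.card_insert_of_notMem (by simp [hL]), size]

/-- Matching an unmatched vertex `y` on the right to a vertex `x` on the left that is matched to
`y'`. -/
theorem IsMate.rematch (hM : IsMate n E mL mR) {x y y' : ℕ} (hx : x < n) (hy : y < n)
    (hy' : y' < n) (hE : E x y) (hL : mL x = y' + 1) (hR : mR y = 0) {mL' mR' : ℕ → ℕ}
    (hL' : ∀ z, mL' z = if z = x then y + 1 else mL z)
    (hR' : ∀ z, mR' z = if z = y' then 0 else if z = y then x + 1 else mR z) :
    IsMate n E mL' mR' ∧ size n mL' = size n mL := by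
  have hRy' := (hM.iff x hx y' hy').1 hL
  have hne : y ≠ y' := by rintro rfl; omega
  refine ⟨⟨?_, ?_, ?_, ?_⟩, ?_⟩
  · intro z hz; have := hM.left_le z hz; rw [hL']; split_ifs <;> omega
  · intro z hz; have := hM.right_le z hz; rw [hR']; split_ifs <;> omega
  · intro z hz w hw
    have := hM.iff z hz w hw
    have h1 := hM.iff x hx w hw
    have h2 := hM.iff z hz y hy
    have h3 := hM.iff z hz y' hy'
    rw [hL', hR']
    split_ifs with e1 e2 e3 e2 e3
    · simp only [iff_false]; omega
    · omega
    · subst e1; omega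
    · subst e2; simp only [iff_false]; omega
    · subst e3; omega
    · exact this
  · intro z hz w hw hzw
    rw [hL'] at hzw
    split_ifs at hzw with h'
    · obtain rfl : w = y := by omega
      rwa [h']
    · exact hM.edge z hz w hw hzw
  · have : (Finset.range n).filter (fun z => mL' z ≠ 0)
        = (Finset.range n).filter fun z => mL z ≠ 0 := by
      ext z
      simp only [Finset.mem_filter, Finset.mem_range, hL']
      by_cases h' : z = x
      · subst h'; simp [hL]
      · simp [h']
    rw [size, this, size]

/-- The invariant of the augmentation along the path that a search has found; `mL₀` is the
matching before the augmentation, and `tip - 1` is the vertex that has to be matched next. -/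
structure Augment (n : ℕ) (E : ℕ → ℕ → Prop) (mL₀ reach par : ℕ → ℕ) (mL mR : ℕ → ℕ)
    (tip j : ℕ) : Prop where
  mate : IsMate n E mL mR
  size_eq : size n mL = size n mL₀ + if tip = 0 then 1 else 0
  tip : tip ≠ 0 → ∃ y < n, tip = y + 1 ∧ mR y = 0 ∧ par y ≠ 0 ∧
    (∀ x < n, reach x ≤ reach (par y - 1) → mL x = mL₀ x) ∧ reach (par y - 1) + j ≤ n + 1

/-- The parent `x` of the tip is matched to it, and the former mate of `x`, if any, becomes the new
tip. By `back` the number of the new parent is strictly smaller, so the part of the matching that is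
still needed has not been changed, and the sum of this number and the step count stays at most `n +
1`. -/
theorem Augment.step {mL₀ mR₀ : ℕ → ℕ} (h₀ : Search n E mL₀ mR₀ reach par found n r n)
    {tip : ℕ} (h : Augment n E mL₀ reach par mL mR tip j) (ht : tip ≠ 0) {mL' mR' : ℕ → ℕ}
    (hL' : ∀ z, mL' z = if z = par (tip - 1) - 1 then tip - 1 + 1 else mL z)
    (hR' : ∀ z, mR' z = if mL (par (tip - 1) - 1) ≠ 0 ∧ z = mL (par (tip - 1) - 1) - 1 then 0 else
      if z = tip - 1 then par (tip - 1) - 1 + 1 else mR z) :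
    Augment n E mL₀ reach par mL' mR' (mL (par (tip - 1) - 1)) (j + 1) := by
  obtain ⟨y, hy, rfl, hRy, hpy, hle, hj⟩ := h.tip ht
  obtain ⟨x, hx, hxp, hx2, hE⟩ := h₀.parent y hy hpy
  simp only [Nat.add_sub_cancel, hxp] at hL' hR' hle hj ⊢
  have hLx : mL x = mL₀ x := hle x hx le_rfl
  have hsz := h.size_eq
  rw [if_neg ht, add_zero] at hsz
  by_cases h0 : mL x = 0
  · obtain ⟨h1, h2⟩ := h.mate.extend hx hy hE h0 hRy hL' (by simpa [h0] using hR')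
    exact ⟨h1, by simp [h0, h2, hsz], fun h' => absurd h0 h'⟩
  · obtain ⟨y', hy', e1, e2, e3⟩ := (h₀.back x hx (by omega)).resolve_left (by omega)
    rw [← hLx] at e1
    obtain ⟨h1, h2⟩ := h.mate.rematch hx hy hy' hE e1 hRy hL' (by simpa [e1] using hR')
    have e3 := e3 hx2
    refine ⟨h1, by simp [h0, h2, hsz], fun _ => ⟨y', hy', e1, ?_, e2, fun z hz hzr => ?_, by omega⟩⟩
    · rw [hR', if_pos ⟨h0, by omega⟩]
    · have : z ≠ x := by rintro rfl; omega
      rw [hL', if_neg this, hle z hz (by omega)]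

end

end BipartiteSearch

/-! ### Maximum matching by augmenting paths, as a program -/

namespace WordRAM.Bounded

namespace BProg

infixr:30 " ;; " => BProg.seq

/-- A conditional without alternative. -/
def when (e : BExpr) (p : BProg) : BProg := .ite e p .skip

section
variable (Γ : Input) (a : Store)

@[simp] theorem denote_set (x : Var) (e : BExpr) :
    (BProg.set x e).denote Γ a = a.set x (e.eval Γ a) := (rfl)
@[simp] theorem denote_put (k : Arr) (i e : BExpr) :
    (BProg.put k i e).denote Γ a = a.put k (i.eval Γ a) (e.eval Γ a) := (rfl)
@[simp] theorem denote_seq (p q : BProg) : (p ;; q).denote Γ a = q.denote Γ (p.denote Γ a) := (rfl)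
theorem denote_ite (e : BExpr) (p q : BProg) : (BProg.ite e p q).denote Γ a =
    if e.eval Γ a = 0 then q.denote Γ a else p.denote Γ a := (rfl)
theorem denote_when (e : BExpr) (p : BProg) : (when e p).denote Γ a =
    if e.eval Γ a = 0 then a else p.denote Γ a := (rfl)

end

end BProg

open BipartiteSearch BProg BExpr

/-- Scan the neighbours of the vertex `row`. -/
def scanRow : BProg :=
  .loop .col 0 (when (elem .edge (.var .row * order + .var .col) * same (elem .par (.var .col)) 0)
    (.put .par (.var .col) (.var .row + 1) ;;
      .ite (same (elem .mateR (.var .col)) 0)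
        (.set .found (.var .col + 1))
        (.put .reach (elem .mateR (.var .col) - 1) 1)))

/-- One round of the search: find a reached vertex that has not been scanned, and scan it. -/
def searchStep : BProg :=
  .set .cur 0 ;;
  .loop .i 0 (when (same (elem .reach (.var .i)) 1) (.set .cur (.var .i + 1))) ;;
  when (.var .cur)
    (.set .row (.var .cur - 1) ;; .put .reach (.var .row) (.var .step + 2) ;; scanRow)

/-- Search for an augmenting path. -/
def search : BProg :=
  .loop .i 0 (.put .reach (.var .i) (same (elem .mateL (.var .i)) 0) ;; .put .par (.var .i) 0) ;;
  .set .found 0 ;;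
  .loop .step 0 searchStep

/-- Match the vertex `tip - 1` on the right to its parent. -/
def augmentStep : BProg :=
  when (.var .tip)
    (.set .col (.var .tip - 1) ;;
      .set .row (elem .par (.var .col) - 1) ;;
      .set .next (elem .mateL (.var .row)) ;;
      .put .mateL (.var .row) (.var .col + 1) ;;
      .put .mateR (.var .col) (.var .row + 1) ;;
      when (.var .next) (.put .mateR (.var .next - 1) 0) ;;
      .set .tip (.var .next))

/-- Augment the matching along the path that the search has found. -/
def augment : BProg := .set .tip (.var .found) ;; .loop .i 0 augmentStep

/-- Compute the size of a maximum matching in the bipartite graph `edge`. -/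
def matching : BProg :=
  .loop .i 0 (.put .mateL (.var .i) 0 ;; .put .mateR (.var .i) 0) ;;
  .loop .round 0 (search ;; augment) ;;
  .set .cnt 0 ;;
  .loop .i 0 (when (elem .mateL (.var .i)) (.set .cnt (.var .cnt + 1)))

/-- The bipartite graph in the array `edge`. -/
def Store.edges (n : ℕ) (a : Store) (x y : ℕ) : Prop := a.arr .edge (x * n + y) ≠ 0

variable {Γ : Input}

/-- The second conclusion says that a scan only marks vertices as pending. It lets the scanned
vertices be counted from round to round. -/
theorem scanRow_spec {a : Store} {j r : ℕ}
    (hM : IsMate Γ.n (a.edges Γ.n) (a.arr .mateL) (a.arr .mateR))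
    (h : Search Γ.n (a.edges Γ.n) (a.arr .mateL) (a.arr .mateR) (a.arr .reach) (a.arr .par)
      (a.var .found) j r 0) (hr : r < Γ.n) (hrow : a.var .row = r) (hrr : 2 ≤ a.arr .reach r) :
    Search Γ.n (a.edges Γ.n) (a.arr .mateL) (a.arr .mateR) ((scanRow.denote Γ a).arr .reach)
      ((scanRow.denote Γ a).arr .par) ((scanRow.denote Γ a).var .found) j r Γ.n ∧
    ∀ z, 2 ≤ (scanRow.denote Γ a).arr .reach z ↔ 2 ≤ a.arr .reach z := by
  unfold scanRow
  refine denote_for (P := fun m a' => (a'.arr .edge = a.arr .edge ∧ a'.arr .mateL = a.arr .mateL ∧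
      a'.arr .mateR = a.arr .mateR ∧ a'.var .row = r) ∧
      Search Γ.n (a.edges Γ.n) (a.arr .mateL) (a.arr .mateR) (a'.arr .reach) (a'.arr .par)
      (a'.var .found) j r m ∧ ∀ z, 2 ≤ a'.arr .reach z ↔ 2 ≤ a.arr .reach z)
    (Q := fun a' => Search Γ.n (a.edges Γ.n) (a.arr .mateL) (a.arr .mateR) (a'.arr .reach)
      (a'.arr .par) (a'.var .found) j r Γ.n ∧ ∀ z, 2 ≤ a'.arr .reach z ↔ 2 ≤ a.arr .reach z)
    ⟨⟨rfl, rfl, rfl, hrow⟩, h, fun _ => Iff.rfl⟩ ?_ ?_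
  · rintro m hm b ⟨⟨e1, e2, e3, e4⟩, hS, hb⟩
    rw [add_zero] at hm
    rw [denote_when]
    split_ifs with hc
    · refine ⟨⟨e1, e2, e3, e4⟩, hS.visit_skip fun hE => ?_, hb⟩
      simp only [eval_mul, eval_elem, eval_add, eval_var, eval_order, eval_same, eval_ofNat,
        Store.set_arr, Store.set_var, e4, e1, mul_eq_zero] at hc
      simp only [reduceCtorEq, if_false, if_true] at hc
      rcases hc with hc | hc
      · exact absurd hc hE
      · simpa using hc
    · simp only [eval_mul, eval_elem, eval_add, eval_var, eval_order, eval_same, eval_ofNat,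
        Store.set_arr, Store.set_var, e4, e1, mul_eq_zero, not_or] at hc
      simp only [reduceCtorEq, if_false, if_true] at hc
      have hp : b.arr .par m = 0 := by simpa using hc.2
      have hE : a.edges Γ.n r m := hc.1
      have hrr' := (hb r).2 hrr
      rw [denote_seq, denote_ite]
      by_cases hR : a.arr .mateR m = 0
      · rw [if_neg (by simp [e3, hR])]
        refine ⟨by simpa using ⟨by ext; simp [e1], by ext; simp [e2], by ext; simp [e3], e4⟩,
          ?_, by simpa using hb⟩
        have := hS.visit_free hm hr hrr' hE hp hR
          (par' := ((denote Γ (.put .par (.var .col) (.var .row + 1)) (b.set .col m)).arr .par))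
          (fun z => by simp [e4])
        convert this using 1
        · ext; simp
        · simp
        · simp
      · rw [if_pos (by simp [e3, hR])]
        -- The fact `h1` is needed to see that the mark 1 does not lower an entry that was at least
        -- 2.
        obtain ⟨h1, h2⟩ := hS.visit_matched hM hm hr hrr' hE hp hR
          (par' := fun z => if z = m then r + 1 else b.arr .par z) (fun z => rfl)
          (reach' := fun z => if z = a.arr .mateR m - 1 then 1 else b.arr .reach z) (fun z => rfl)
        refine ⟨by simpa using ⟨by ext; simp [e1], by ext; simp [e2], by ext; simp [e3], e4⟩,
          ?_, ?_⟩
        · convert h2 using 1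
          · ext; simp [e3]
          · ext; simp [e4]
          · simp
        · intro z
          have := hb z
          simp only [denote_put, Store.put_arr, eval_sub, eval_elem, eval_var, eval_ofNat,
            Store.set_arr, Store.put_var, Store.set_var, e3]
          simp only [reduceCtorEq, if_false, if_true, true_and, false_and]
          split_ifs with hz
          · subst hz; omega
          · exact this
  · rintro b ⟨-, hS, hb⟩
    exact ⟨by simpa using hS, by simpa using hb⟩

end WordRAM.Bounded

/-! ### Correctness of the matching program -/

namespace WordRAM.Bounded

open BipartiteSearch BProg BExpr

variable {Γ : Input}

/-- The program looks for a vertex that has been reached and not scanned. -/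
theorem findPending_spec (a : Store) :
    let b := (BProg.loop .i 0
      (when (same (elem .reach (.var .i)) 1) (.set .cur (.var .i + 1)))).denote Γ (a.set .cur 0)
    (b.var .cur = 0 ∧ ∀ x < Γ.n, a.arr .reach x ≠ 1) ∨
      ∃ x < Γ.n, b.var .cur = x + 1 ∧ a.arr .reach x = 1 := by
  intro b
  refine denote_for (a := a.set .cur 0) (P := fun m b => b.arr .reach = a.arr .reach ∧
      ((b.var .cur = 0 ∧ ∀ x < m, a.arr .reach x ≠ 1) ∨
        ∃ x < Γ.n, b.var .cur = x + 1 ∧ a.arr .reach x = 1))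
    (Q := fun b => (b.var .cur = 0 ∧ ∀ x < Γ.n, a.arr .reach x ≠ 1) ∨
      ∃ x < Γ.n, b.var .cur = x + 1 ∧ a.arr .reach x = 1) 
    ⟨rfl, .inl ⟨by simp, fun x hx => absurd hx (Nat.not_lt_zero x)⟩⟩ ?_ ?_
  · rintro m hm b ⟨e, h⟩
    rw [denote_when]
    split_ifs with hc
    · refine ⟨e, h.imp (fun h => ⟨by simpa using h.1, fun x hx => ?_⟩) (by simp)⟩
      rcases Nat.lt_succ_iff_lt_or_eq.1 hx with h' | rfl
      · exact h.2 x h'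
      · simpa [e] using hc
    · have : a.arr .reach m = 1 := by simpa [e] using hc
      exact ⟨e, .inr ⟨m, hm, by simp, this⟩⟩
  · rintro b ⟨e, h⟩
    simpa using h

/-- The invariant of the search. -/
def Searching (n : ℕ) (a : Store) (j : ℕ) (b : Store) : Prop :=
  (b.arr .edge = a.arr .edge ∧ b.arr .mateL = a.arr .mateL ∧ b.arr .mateR = a.arr .mateR) ∧
  (∃ r, Search n (a.edges n) (a.arr .mateL) (a.arr .mateR) (b.arr .reach) (b.arr .par)
    (b.var .found) j r n) ∧
  ((∀ x < n, b.arr .reach x ≠ 1) ∨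
    j ≤ ((Finset.range n).filter fun x => 2 ≤ b.arr .reach x).card)

/-- A round without a pending vertex changes nothing relevant and leaves none pending. Any other
round adds exactly one vertex to those with an entry at least 2. This is the progress measure behind
the choice of `n` rounds. -/
theorem searchStep_spec {a b : Store} {j : ℕ}
    (hM : IsMate Γ.n (a.edges Γ.n) (a.arr .mateL) (a.arr .mateR))
    (h : Searching Γ.n a j b) :
    Searching Γ.n a (j + 1) (searchStep.denote Γ (b.set .step j)) := by
  obtain ⟨⟨e1, e2, e3⟩, ⟨r, hS⟩, hp⟩ := h
  have hf := findPending_spec (Γ := Γ) (b.set .step j)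
  unfold searchStep
  simp only [denote_seq, denote_set, eval_ofNat]
  set f := BProg.loop .i 0
    (when (same (elem .reach (.var .i)) 1) (.set .cur (.var .i + 1))) with hfdef
  set c := f.denote Γ ((b.set .step j).set .cur 0) with hc
  have hca : ∀ k, c.arr k = b.arr k := fun k => by
    rw [hc, denote_arr f (by cases k <;> rfl)]; rfl
  have hcf : c.var .found = b.var .found := by rw [hc, denote_var f rfl]; simp
  have hcs : c.var .step = j := by rw [hc, denote_var f rfl]; simp
  rw [denote_when]
  simp only [eval_var]
  rcases hf with ⟨h0, hn⟩ | ⟨x, hx, hcur, hrx⟩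
  · rw [if_pos h0]
    simp only [Store.set_arr] at hn
    simp only [Searching, hca, hcf]
    exact ⟨⟨e1, e2, e3⟩, ⟨r, hS.next r⟩, .inl hn⟩
  · replace hrx : b.arr .reach x = 1 := hrx
    replace hcur : c.var .cur = x + 1 := hcur
    rw [if_neg (by omega)]
    simp only [denote_seq, denote_set, denote_put]
    set d := (c.set .row ((BExpr.var .cur - 1).eval Γ c)).put .reach
      ((BExpr.var .row).eval Γ (c.set .row ((BExpr.var .cur - 1).eval Γ c)))
      ((BExpr.var .step + 2).eval Γ (c.set .row ((BExpr.var .cur - 1).eval Γ c))) with hd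
    have hda : ∀ k, k ≠ .reach → d.arr k = b.arr k := fun k hk => by
      ext; simp [hd, hca, hk]
    have hdr : ∀ z, d.arr .reach z = if z = x then j + 2 else b.arr .reach z := fun z => by
      simp [hd, hcur, hcs, hca]
    have hdf : d.var .found = b.var .found := by simp [hd, hcf]
    have hdrow : d.var .row = x := by simp [hd, hcur]
    have hE : d.edges Γ.n = a.edges Γ.n := by
      unfold Store.edges; rw [hda _ (by simp), e1]
    have hS' := hS.scan hrx hdr
    obtain ⟨h1, h2⟩ := scanRow_spec (Γ := Γ) (a := d) (j := j + 1) (r := x)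
      (by rwa [hE, hda _ (by simp), hda _ (by simp), e2, e3])
      (by rwa [hE, hda .par (by simp), hda .mateL (by simp), hda .mateR (by simp), e2, e3, hdf])
      hx hdrow (by rw [hdr, if_pos rfl]; omega)
    rw [hE, hda .mateL (by simp), hda .mateR (by simp), e2, e3] at h1
    refine ⟨⟨?_, ?_, ?_⟩, ⟨x, h1⟩, ?_⟩
    · rw [denote_arr scanRow rfl, hda _ (by simp), e1]
    · rw [denote_arr scanRow rfl, hda _ (by simp), e2]
    · rw [denote_arr scanRow rfl, hda _ (by simp), e3]
    · right
      have hp := hp.resolve_left fun h' => h' x hx hrx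
      have : (Finset.range Γ.n).filter (fun z => 2 ≤ (scanRow.denote Γ d).arr .reach z)
          = insert x ((Finset.range Γ.n).filter fun z => 2 ≤ b.arr .reach z) := by
        ext z
        simp only [Finset.mem_filter, Finset.mem_range, Finset.mem_insert, h2, hdr]
        by_cases hz : z = x
        · subst hz; simp [hx]
        · simp [hz]
      rw [this, Finset.card_insert_of_notMem (by simp [hrx])]
      omega

/-- The search ends with an augmenting path, or with a certificate that there is none. -/
theorem search_spec {a : Store}
    (hM : IsMate Γ.n (a.edges Γ.n) (a.arr .mateL) (a.arr .mateR)) :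
    let b := search.denote Γ a
    (b.arr .edge = a.arr .edge ∧ b.arr .mateL = a.arr .mateL ∧ b.arr .mateR = a.arr .mateR) ∧
    (∃ r, Search Γ.n (a.edges Γ.n) (a.arr .mateL) (a.arr .mateR) (b.arr .reach) (b.arr .par)
      (b.var .found) Γ.n r Γ.n) ∧ ∀ x < Γ.n, b.arr .reach x ≠ 1 := by
  intro b
  set init := BProg.loop .i 0
    (.put .reach (.var .i) (same (elem .mateL (.var .i)) 0) ;; .put .par (.var .i) 0)
  set c := init.denote Γ a with hc
  have hinit : ∀ x < Γ.n, c.arr .reach x = (if a.arr .mateL x = 0 then 1 else 0) ∧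
      c.arr .par x = 0 := by
    refine denote_for (P := fun m c => c.arr .mateL = a.arr .mateL ∧ ∀ x < m,
        c.arr .reach x = (if a.arr .mateL x = 0 then 1 else 0) ∧ c.arr .par x = 0)
      (Q := fun c => ∀ x < Γ.n,
        c.arr .reach x = (if a.arr .mateL x = 0 then 1 else 0) ∧ c.arr .par x = 0)
      ⟨rfl, by simp⟩ ?_ ?_
    · rintro m hm d ⟨e, h⟩
      refine ⟨by ext; simp [e], fun x hx => ?_⟩
      by_cases hxm : x = m
      · subst hxm; simp [e]
      · simpa [hxm] using h x (by omega)
    · rintro d ⟨e, h⟩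
      simpa using h
  have hpar : ∀ y < Γ.n, c.arr .par y = 0 := fun y hy => (hinit y hy).2
  have h0 : Searching Γ.n a 0 (c.set .found 0) := by
    refine ⟨⟨?_, ?_, ?_⟩, ⟨0, ?_, ?_, ?_, ?_, ?_, ?_, ?_, ?_⟩, .inr (Nat.zero_le _)⟩
    · rw [Store.set_arr, hc, denote_arr init rfl]
    · rw [Store.set_arr, hc, denote_arr init rfl]
    · rw [Store.set_arr, hc, denote_arr init rfl]
    · intro x hx hx0; simp [(hinit x hx).1, hx0]
    · intro x hx hx2
      rw [Store.set_arr, (hinit x hx).1] at hx2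
      split_ifs at hx2 <;> omega
    · exact fun y hy hpy => absurd (hpar y hy) hpy
    · exact fun y hy hpy => absurd (hpar y hy) hpy
    · exact fun y hy hpy => absurd (hpar y hy) hpy
    · intro h; simp at h
    · intro x hx hx0
      rw [Store.set_arr, (hinit x hx).1] at hx0
      left; by_contra h'; simp [h'] at hx0
    · intro x hx
      rw [Store.set_arr, (hinit x hx).1]
      split_ifs <;> omega
  have hfin : Searching Γ.n a Γ.n b :=
    denote_for (x := .step) (k := 0) (p := searchStep) (a := c.set .found 0)
      (P := Searching Γ.n a) (Q := Searching Γ.n a Γ.n) h0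
      (fun j _ d hd => searchStep_spec hM hd) fun d hd => by simpa [Searching] using hd
  refine ⟨hfin.1, hfin.2.1, ?_⟩
  -- If all `n` rounds made progress, every vertex has been scanned, so again no entry equals 1.
  rcases hfin.2.2 with h | h
  · exact h
  · intro x hx
    have := Finset.eq_of_subset_of_card_le (Finset.filter_subset _ _)
      (show (Finset.range Γ.n).card ≤ _ by simpa using h)
    have hx' := Finset.mem_range.2 hx
    rw [← this] at hx'
    have := (Finset.mem_filter.1 hx').2
    omega

theorem augmentStep_spec {a b : Store} {mR₀ : ℕ → ℕ} {found r j : ℕ}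
    (hS : Search Γ.n (a.edges Γ.n) (a.arr .mateL) mR₀ (a.arr .reach) (a.arr .par) found Γ.n r Γ.n)
    (hpar : b.arr .par = a.arr .par)
    (h : Augment Γ.n (a.edges Γ.n) (a.arr .mateL) (a.arr .reach) (a.arr .par) (b.arr .mateL)
      (b.arr .mateR) (b.var .tip) j) :
    let c := augmentStep.denote Γ b
    Augment Γ.n (a.edges Γ.n) (a.arr .mateL) (a.arr .reach) (a.arr .par) (c.arr .mateL)
      (c.arr .mateR) (c.var .tip) (j + 1) := by
  intro c
  by_cases ht : b.var .tip = 0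
  · have : c = b := by simp only [c, augmentStep, denote_when, eval_var, if_pos ht]
    rw [this]
    exact ⟨h.mate, h.size_eq, fun h' => absurd ht h'⟩
  · have := h.step hS ht (mL' := c.arr .mateL) (mR' := c.arr .mateR) ?_ ?_
    · convert this using 1
      simp only [c, augmentStep, denote_when, eval_var, if_neg ht, denote_seq, denote_set]
      simp only [denote_put, hpar, eval_elem, eval_var, eval_sub, eval_ofNat, Store.set_var,
        Store.set_arr, reduceCtorEq, if_true, if_false]
      split_ifs <;> simp
    · intro z
      simp only [c, augmentStep, denote_when, eval_var, if_neg ht, denote_seq, denote_set]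
      split_ifs <;> simp_all
    · intro z
      simp only [c, augmentStep, denote_when, eval_var, if_neg ht, denote_seq, denote_set]
      split_ifs <;> simp_all

/-- The matching in the store is valid, and it is maximum or has at least `j` edges. -/
def Matched (n : ℕ) (a : Store) (j : ℕ) (b : Store) : Prop :=
  b.arr .edge = a.arr .edge ∧ IsMate n (a.edges n) (b.arr .mateL) (b.arr .mateR) ∧
  ((∀ M, IsMatching (fun x y => x < n ∧ y < n ∧ a.edges n x y) M →
    M.card ≤ size n (b.arr .mateL)) ∨ j ≤ size n (b.arr .mateL))

/-- A search without success certifies that the matching is maximum; a successful one is followed by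
an augmentation that adds one edge. A maximum matching cannot become smaller in later rounds either
way. -/
theorem round_spec {a b : Store} {j : ℕ} (h : Matched Γ.n a j b) :
    Matched Γ.n a (j + 1) ((search ;; augment).denote Γ b) := by
  obtain ⟨e, hM, hmax⟩ := h
  have hE : b.edges Γ.n = a.edges Γ.n := by unfold Store.edges; rw [e]
  obtain ⟨⟨e1, e2, e3⟩, ⟨r, hS⟩, hr⟩ := search_spec (Γ := Γ) (a := b) (by rwa [hE])
  rw [denote_seq]
  set c := search.denote Γ b with hc
  rw [hE] at hS
  have hE' : c.edges Γ.n = a.edges Γ.n := by unfold Store.edges; rw [e1, e]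
  rw [← hE', ← e2] at hS
  have hM' : IsMate Γ.n (c.edges Γ.n) (c.arr .mateL) (c.arr .mateR) := by rwa [hE', e2, e3]
  have hfor : augment.denote Γ c = (BProg.loop .i 0 augmentStep).denote Γ
      (c.set .tip (c.var .found)) := rfl
  by_cases hf : c.var .found = 0
  · have h1 : (augment.denote Γ c).arr = c.arr := by
      rw [hfor]
      refine denote_for (a := c.set .tip (c.var .found))
        (P := fun _ d => d.var .tip = 0 ∧ d.arr = c.arr)
        (Q := fun d => d.arr = c.arr) ⟨by simpa using hf, rfl⟩ ?_ fun d hd => by simpa using hd.2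
      rintro m - d ⟨h1, h2⟩
      simp [augmentStep, denote_when, h1, h2]
    rw [hf] at hS
    refine ⟨by rw [h1, e1, e], by rwa [h1, ← hE'], .inl fun M hmat => ?_⟩
    rw [h1]
    rw [← hE'] at hmat
    exact hS.maximum (by rwa [← e3]) hr hmat
  · obtain ⟨-, hfin⟩ : (augment.denote Γ c).arr .par = c.arr .par ∧
        Augment Γ.n (c.edges Γ.n) (c.arr .mateL) (c.arr .reach) (c.arr .par)
          ((augment.denote Γ c).arr .mateL) ((augment.denote Γ c).arr .mateR)
          ((augment.denote Γ c).var .tip) Γ.n := by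
      rw [hfor]
      refine denote_for (x := .i) (k := 0) (a := c.set .tip (c.var .found))
        (Γ := Γ) (P := fun j d => d.arr .par = c.arr .par ∧
          Augment Γ.n (c.edges Γ.n) (c.arr .mateL) (c.arr .reach) (c.arr .par)
            (d.arr .mateL) (d.arr .mateR) (d.var .tip) j)
        (Q := fun d => d.arr .par = c.arr .par ∧
          Augment Γ.n (c.edges Γ.n) (c.arr .mateL) (c.arr .reach) (c.arr .par)
            (d.arr .mateL) (d.arr .mateR) (d.var .tip) Γ.n) ⟨rfl, hM', ?_, ?_⟩ ?_
        fun d hd => by simpa using hd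
      · simp [hf]
      · intro _
        obtain ⟨y, hy, h1, h2, h3⟩ := hS.found hf
        refine ⟨y, hy, by simpa using h1, by rw [Store.set_arr, e3]; exact h3, h2,
          fun x _ _ => rfl, ?_⟩
        obtain ⟨x, hx, h4, -⟩ := hS.parent y hy h2
        rw [h4, Nat.add_sub_cancel]
        simpa using hS.le x hx
      · rintro m - d ⟨h1, h2⟩
        refine ⟨by rw [denote_arr augmentStep rfl]; exact h1, ?_⟩
        exact augmentStep_spec hS (b := d.set .i m) h1 (by simpa using h2)
    -- After `n` steps an unfinished path would have a parent with number at most 1, but parents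
    -- have been scanned and have numbers at least 2.
    have htip : (augment.denote Γ c).var .tip = 0 := by
      by_contra h0
      obtain ⟨y, hy, -, -, h2, -, h3⟩ := hfin.tip h0
      obtain ⟨x, hx, h4, h5, -⟩ := hS.parent y hy h2
      rw [h4, Nat.add_sub_cancel] at h3
      omega
    have hsz := hfin.size_eq
    rw [if_pos htip, e2] at hsz
    refine ⟨by rw [denote_arr augment rfl, e1, e], hE' ▸ hfin.mate, ?_⟩
    rw [hsz]
    exact hmax.imp (fun h M hmat => (h M hmat).trans (Nat.le_succ _)) Nat.succ_le_succ

/-- The program computes the size of a maximum matching. -/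
theorem matching_spec (a : Store) :
    let b := matching.denote Γ a
    (∃ M, IsMatching (fun x y => x < Γ.n ∧ y < Γ.n ∧ a.edges Γ.n x y) M ∧ M.card = b.var .cnt) ∧
    ∀ M, IsMatching (fun x y => x < Γ.n ∧ y < Γ.n ∧ a.edges Γ.n x y) M → M.card ≤ b.var .cnt := by
  intro b
  set init := BProg.loop .i 0 (.put .mateL (.var .i) 0 ;; .put .mateR (.var .i) 0)
  set c := init.denote Γ a with hc
  set d := (BProg.loop .round 0 (search ;; augment)).denote Γ c with hd
  have hinit : ∀ x < Γ.n, c.arr .mateL x = 0 ∧ c.arr .mateR x = 0 := by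
    refine denote_for (P := fun m c => ∀ x < m, c.arr .mateL x = 0 ∧ c.arr .mateR x = 0)
      (Q := fun c => ∀ x < Γ.n, c.arr .mateL x = 0 ∧ c.arr .mateR x = 0) (by simp) ?_
      fun d hd => by simpa using hd
    intro m hm d h x hx
    by_cases hxm : x = m
    · subst hxm; simp
    · simpa [hxm] using h x (by omega)
  have hM : IsMate Γ.n (a.edges Γ.n) (c.arr .mateL) (c.arr .mateR) := by
    refine ⟨fun x hx => ?_, fun x hx => ?_, fun x hx y hy => ?_, fun x hx y hy h => ?_⟩
    · simp [(hinit x hx).1]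
    · simp [(hinit x hx).2]
    · simp [(hinit x hx).1, (hinit y hy).2]
    · simp [(hinit x hx).1] at h
  have hfin : Matched Γ.n a Γ.n d :=
    denote_for (P := Matched Γ.n a) (Q := Matched Γ.n a Γ.n)
      ⟨by rw [hc, denote_arr init rfl], hM, .inr (Nat.zero_le _)⟩
      (fun j _ d hd => round_spec hd) fun d hd => by simpa [Matched] using hd
  have hcnt : b.var .cnt = size Γ.n (d.arr .mateL) := by
    refine denote_for (a := d.set .cnt 0) (P := fun m b => b.arr .mateL = d.arr .mateL ∧
        b.var .cnt = size m (d.arr .mateL)) (Q := fun b => b.var .cnt = size Γ.n (d.arr .mateL))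
      ⟨rfl, by simp [size]⟩ ?_ fun d hd => by simpa using hd.2
    rintro m - b ⟨h1, h2⟩
    have : size (m + 1) (d.arr .mateL)
        = size m (d.arr .mateL) + if d.arr .mateL m = 0 then 0 else 1 := by
      unfold size
      rw [Finset.range_add_one, Finset.filter_insert]
      by_cases h3 : d.arr .mateL m = 0
      · simp [h3]
      · simp [h3, Finset.card_insert_of_notMem]
    rw [denote_when, this]
    by_cases h3 : d.arr .mateL m = 0 <;> simp [h1, h2, h3]
  rw [hcnt]
  refine ⟨hfin.2.1.exists_isMatching, fun M hmat => ?_⟩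
  -- If all `n` rounds were augmentations, the matching has at least `n` edges, and no matching is
  -- larger.
  rcases hfin.2.2 with h | h
  · exact h M hmat
  · exact (card_le_of_isMatching hmat).trans h

end WordRAM.Bounded

/-! ### Sliding tokens -/

namespace Discovery

section Slides

variable {V : Type*} [DecidableEq V] {G : SimpleGraph V} {S S' T U : Finset V} {l m : ℕ}

theorem ReachableIn.refl (S : Finset V) : ReachableIn G 0 S S :=
  ⟨fun _ => S, rfl, rfl, fun _ h => absurd h (Nat.not_lt_zero _)⟩

theorem ReachableIn.cons (h : Slide G S S') (h' : ReachableIn G l S' T) :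
    ReachableIn G (l + 1) S T := by
  obtain ⟨C, h0, hl, hs⟩ := h'
  refine ⟨fun i => Nat.casesOn i S C, rfl, hl, fun i hi => ?_⟩
  cases i with
  | zero => simpa [h0] using h
  | succ i => exact hs i (by omega)

theorem ReachableIn.exists_cons (h : ReachableIn G (l + 1) S T) :
    ∃ S', Slide G S S' ∧ ReachableIn G l S' T := by
  obtain ⟨C, h0, hl, hs⟩ := h
  exact ⟨C 1, h0 ▸ hs 0 (by omega), fun i => C (i + 1), rfl, hl, fun i hi => hs _ (by omega)⟩

theorem ReachableIn.trans (h : ReachableIn G l S T) (h' : ReachableIn G m T U) :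
    ReachableIn G (l + m) S U := by
  induction l generalizing S with
  | zero =>
    obtain ⟨C, h0, hl, -⟩ := h
    obtain rfl : S = T := h0.symm.trans hl
    simpa using h'
  | succ l ih =>
    obtain ⟨S', hs, h⟩ := h.exists_cons
    rw [Nat.add_right_comm]
    exact (ih h).cons hs

/-- A token can be moved along a walk to a free vertex, even if there are tokens in its way. -/
theorem exists_reachableIn_of_walk {a d : V} (p : G.Walk a d) (ha : a ∈ S) (hd : d ∉ S) :
    ∃ l ≤ p.length, ReachableIn G l S ((S ∪ {d}) \ {a}) := by
  induction p generalizing S with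
  | nil => exact absurd ha hd
  | @cons a x d hax p ih =>
    have hne : a ≠ x := hax.ne
    have had : a ≠ d := by rintro rfl; exact hd ha
    -- If the next vertex `x` is occupied, its token first continues to `d`, and then the token on
    -- `a` slides to the freed `x`. Tokens are indistinguishable, so the resulting set is the same.
    by_cases hx : x ∈ S
    · obtain ⟨l, hl, h⟩ := ih hx hd
      have hxd : x ≠ d := by rintro rfl; exact hd hx
      refine ⟨l + 1, by simpa using hl, h.trans ((ReachableIn.refl _).cons
        ⟨a, by simp [ha, hne], x, by simp, hax, ?_⟩)⟩
      ext z
      simp only [Finset.mem_sdiff, Finset.mem_union, Finset.mem_singleton]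
      by_cases hzx : z = x
      · subst hzx; simp [hx]
      · simp [hzx]
    · have hs : Slide G S ((S ∪ {x}) \ {a}) := ⟨a, ha, x, hx, hax, rfl⟩
      by_cases hxd : x = d
      · subst hxd
        exact ⟨1, by simp, (ReachableIn.refl _).cons hs⟩
      · obtain ⟨l, hl, h⟩ := ih (S := (S ∪ {x}) \ {a}) (by simp [hne.symm])
          (by simp [hd, Ne.symm hxd])
        refine ⟨l + 1, by simpa using hl, ?_⟩
        convert h.cons hs using 1
        ext z
        simp only [Finset.mem_sdiff, Finset.mem_union, Finset.mem_singleton]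
        by_cases hzx : z = x
        · subst hzx; simp [hx, hxd]
        · by_cases hzd : z = d
          · subst hzd; simp [hzx, had.symm]
          · simp [hzx, hzd]

/-- The targets are served one at a time. Injectivity of `f` keeps the token on `f d` in place until
its turn, and `d` is still free then; tokens along the walk do no harm. -/
theorem exists_reachableIn_of_assignment {D : Finset V} (hD : Disjoint D S) {f : V → V}
    (hf : Set.InjOn f D) (hfS : ∀ d ∈ D, f d ∈ S) {w : V → ℕ}
    (hw : ∀ d ∈ D, ∃ p : G.Walk (f d) d, p.length ≤ w d) :
    ∃ l ≤ ∑ d ∈ D, w d, ReachableIn G l S ((S ∪ D) \ D.image f) := by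
  induction D using Finset.induction_on with
  | empty => exact ⟨0, le_rfl, by simpa using ReachableIn.refl S⟩
  | insert d D hdD ih =>
    rw [Finset.disjoint_insert_left] at hD
    rw [Finset.coe_insert] at hf
    obtain ⟨l, hl, h⟩ := ih hD.2 (hf.mono (Set.subset_insert _ _))
      (fun e he => hfS e (Finset.mem_insert_of_mem he))
      (fun e he => hw e (Finset.mem_insert_of_mem he))
    obtain ⟨p, hp⟩ := hw d (Finset.mem_insert_self _ _)
    have hfd := hfS d (Finset.mem_insert_self _ _)
    have hfdD : f d ∉ D.image f := by
      simp only [Finset.mem_image, not_exists, not_and]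
      rintro e he hed
      obtain rfl := hf (Set.mem_insert_of_mem _ he) (Set.mem_insert _ _) hed
      exact hdD he
    obtain ⟨l', hl', h'⟩ := exists_reachableIn_of_walk (S := (S ∪ D) \ D.image f) p
      (by simp only [Finset.mem_sdiff, Finset.mem_union]; exact ⟨.inl hfd, hfdD⟩)
      (by simp [hD.1, hdD])
    refine ⟨l + l', ?_, ?_⟩
    · rw [Finset.sum_insert hdD]; omega
    · convert h.trans h' using 1
      have hdi : d ∉ D.image f := by
        simp only [Finset.mem_image, not_exists, not_and]
        rintro e he rfl
        exact hD.1 (hfS e (Finset.mem_insert_of_mem he))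
      ext z
      simp only [Finset.mem_sdiff, Finset.mem_union, Finset.mem_singleton, Finset.mem_insert,
        Finset.image_insert]
      by_cases hz : z = d
      · subst hz; simp [hdi]
      · simp [hz]; tauto

theorem sum_ite_le_of_injOn {s : Finset V} {f : V → V} (hf : Set.InjOn f s) (y : V) (c : ℕ∞) :
    ∑ d ∈ s, (if f d = y then c else 0) ≤ c := by
  by_cases h : ∃ d ∈ s, f d = y
  · obtain ⟨d, hd, rfl⟩ := h
    rw [Finset.sum_eq_single_of_mem d hd fun e he hne => if_neg fun h => hne (hf he hd h),
      if_pos rfl]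
  · push Not at h
    rw [Finset.sum_eq_zero fun d hd => if_neg (h d hd)]
    exact zero_le

/-- Induction on the first slide, from `x` to `y`: an assignment for the configuration after the
slide is repaired to one for `S`, and the cost grows by at most the length 1 of the slide. The four
cases depend on which of `x` and `y` lie in `R`. -/
theorem ReachableIn.exists_assignment (h : ReachableIn G l S T) {R : Finset V} (hR : R ⊆ T) :
    ∃ f : V → V, Set.InjOn f (R \ S : Finset V) ∧ (∀ d ∈ R \ S, f d ∈ S \ R) ∧
      ∑ d ∈ R \ S, G.edist (f d) d ≤ l := by
  induction l generalizing S with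
  | zero =>
    obtain ⟨C, h0, hl, -⟩ := h
    obtain rfl : S = T := h0.symm.trans hl
    rw [Finset.sdiff_eq_empty_iff_subset.2 hR]
    exact ⟨id, by simp, by simp, by simp⟩
  | succ l ih =>
    obtain ⟨S', ⟨x, hx, y, hy, hxy, rfl⟩, h⟩ := h.exists_cons
    obtain ⟨f, hf, hfm, hfs⟩ := ih h
    have hne : x ≠ y := hxy.ne
    have hd1 : G.edist x y = 1 := SimpleGraph.edist_eq_one_iff_adj.2 hxy
    have hcast : ((l + 1 : ℕ) : ℕ∞) = l + 1 := by push_cast; rfl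
    rw [hcast]
    set R' := R \ ((S ∪ {y}) \ {x}) with hR'
    have mS {z : V} (hz : z ∈ ((S ∪ {y}) \ {x}) \ R) (hzy : z ≠ y) : z ∈ S \ R := by
      simp only [Finset.mem_sdiff, Finset.mem_union, Finset.mem_singleton] at hz ⊢
      tauto
    by_cases hyR : y ∈ R
    · have hyR' : y ∉ R' := by simp [hR', hne.symm]
      have hfy {d : V} (hd : d ∈ R') : f d ∈ S \ R := mS (hfm d hd) (by
        rintro rfl; exact (Finset.mem_sdiff.1 (hfm d hd)).2 hyR)
      -- Here `y` is a target for `S`, while `x` is one only after the slide. The token assigned to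
      -- `x` is redirected to `y`, one step further.
      by_cases hxR : x ∈ R
      · have hxR' : x ∈ R' := by simp [hR', hxR]
        have e : R \ S = insert y (R'.erase x) := by
          ext z
          simp only [hR', Finset.mem_sdiff, Finset.mem_insert, Finset.mem_erase,
            Finset.mem_union, Finset.mem_singleton]
          by_cases hzy : z = y
          · subst hzy; simp [hyR, hy]
          · by_cases hzx : z = x
            · subst hzx; simp [hzy, hx]
            · simp [hzy, hzx]
        have hyE : y ∉ R'.erase x := fun h => hyR' (Finset.mem_of_mem_erase h)
        have hup : ∀ d ∈ R'.erase x, Function.update f y (f x) d = f d := fun d hd =>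
          Function.update_of_ne (by rintro rfl; exact hyE hd) _ _
        refine ⟨Function.update f y (f x), ?_, ?_, ?_⟩
        · rw [e, Finset.coe_insert, Set.injOn_insert (by exact_mod_cast hyE)]
          refine ⟨fun a ha b hb hab => ?_, ?_⟩
          · rw [hup a ha, hup b hb] at hab
            exact hf (Finset.mem_of_mem_erase ha) (Finset.mem_of_mem_erase hb) hab
          · rintro ⟨d, hd, hd'⟩
            rw [hup d hd, Function.update_self] at hd'
            exact Finset.ne_of_mem_erase hd (hf (Finset.mem_of_mem_erase hd) hxR' hd')
        · rw [e]
          intro d hd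
          rcases Finset.mem_insert.1 hd with rfl | hd
          · rw [Function.update_self]; exact hfy hxR'
          · rw [hup d hd]; exact hfy (Finset.mem_of_mem_erase hd)
        · rw [e, Finset.sum_insert hyE, Function.update_self,
            Finset.sum_congr rfl fun d hd => by rw [hup d hd]]
          rw [← Finset.add_sum_erase _ _ hxR'] at hfs
          calc _ ≤ (G.edist (f x) x + 1) + ∑ d ∈ R'.erase x, G.edist (f d) d := by
                gcongr; rw [← hd1]; exact SimpleGraph.edist_triangle
            _ = (G.edist (f x) x + ∑ d ∈ R'.erase x, G.edist (f d) d) + 1 := by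
                rw [add_right_comm]
            _ ≤ _ := by gcongr
      -- The token on `x` itself is assigned to the additional target `y`, at distance 1.
      · have e : R \ S = insert y R' := by
          ext z
          simp only [hR', Finset.mem_sdiff, Finset.mem_insert,
            Finset.mem_union, Finset.mem_singleton]
          by_cases hzy : z = y
          · subst hzy; simp [hyR, hy]
          · by_cases hzx : z = x
            · subst hzx; simp [hzy, hxR]
            · simp [hzy, hzx]
        have hup : ∀ d ∈ R', Function.update f y x d = f d := fun d hd =>
          Function.update_of_ne (by rintro rfl; exact hyR' hd) _ _
        refine ⟨Function.update f y x, ?_, ?_, ?_⟩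
        · rw [e, Finset.coe_insert, Set.injOn_insert (by simpa using hyR')]
          refine ⟨fun a ha b hb hab => ?_, ?_⟩
          · rw [hup a ha, hup b hb] at hab
            exact hf ha hb hab
          · rintro ⟨d, hd, hd'⟩
            rw [hup d hd, Function.update_self] at hd'
            have := hfm d hd
            simp [hd'] at this
        · rw [e]
          intro d hd
          rcases Finset.mem_insert.1 hd with rfl | hd
          · rw [Function.update_self]; exact Finset.mem_sdiff.2 ⟨hx, hxR⟩
          · rw [hup d hd]; exact hfy hd
        · rw [e, Finset.sum_insert hyR', Function.update_self,
            Finset.sum_congr rfl fun d hd => by rw [hup d hd], hd1, add_comm]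
          gcongr
    · by_cases hxR : x ∈ R
      · have hxS : x ∉ R \ S := by simp [hx]
        have e : R' = insert x (R \ S) := by
          ext z
          simp only [hR', Finset.mem_sdiff, Finset.mem_insert,
            Finset.mem_union, Finset.mem_singleton]
          by_cases hzx : z = x
          · subst hzx; simp [hxR]
          · by_cases hzy : z = y
            · subst hzy; simp [hyR, hzx]
            · simp [hzy, hzx]
        have hsub : ∀ d ∈ R \ S, d ∈ R' := fun d hd => e ▸ Finset.mem_insert_of_mem hd
        have hxR' : x ∈ R' := e ▸ Finset.mem_insert_self _ _
        have hfx : ∀ d ∈ R \ S, f d ≠ f x := fun d hd hdx =>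
          hxS (hf (hsub d hd) hxR' hdx ▸ hd)
        -- The target `x` disappears. If some other target used the token on `y`, it now uses the
        -- token `f x` along a path through `x` and `y`, paid for by the former cost of `x` and one
        -- step.
        refine ⟨fun d => if f d = y then f x else f d, ?_, ?_, ?_⟩
        · intro a ha b hb hab
          simp only at hab
          have hfa := hfx a ha
          have hfb := hfx b hb
          refine hf (hsub a ha) (hsub b hb) ?_
          split_ifs at hab with h1 h2 h2
          · rw [h1, h2]
          · exact absurd hab.symm hfb
          · exact absurd hab hfa
          · exact hab
        · intro d hd
          simp only
          split_ifs with h1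
          · exact mS (hfm x hxR') fun h2 => hfx d hd (h1.trans h2.symm)
          · exact mS (hfm d (hsub d hd)) h1
        · rw [e, Finset.sum_insert hxS] at hfs
          calc _ ≤ ∑ d ∈ R \ S, (G.edist (f d) d + if f d = y then G.edist (f x) x + 1 else 0) := by
                refine Finset.sum_le_sum fun d hd => ?_
                simp only
                split_ifs with h1
                · rw [h1]
                  calc G.edist (f x) d ≤ G.edist (f x) x + G.edist x d := SimpleGraph.edist_triangle
                    _ ≤ G.edist (f x) x + (G.edist x y + G.edist y d) := by
                      gcongr; exact SimpleGraph.edist_triangle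
                    _ = _ := by rw [hd1]; ring
                · simp
            _ ≤ ∑ d ∈ R \ S, G.edist (f d) d + (G.edist (f x) x + 1) := by
                rw [Finset.sum_add_distrib]
                gcongr
                exact sum_ite_le_of_injOn (hf.mono hsub) _ _
            _ = (G.edist (f x) x + ∑ d ∈ R \ S, G.edist (f d) d) + 1 := by ring
            _ ≤ _ := by gcongr
      · have e : R \ S = R' := by
          ext z
          simp only [hR', Finset.mem_sdiff,
            Finset.mem_union, Finset.mem_singleton]
          by_cases hzx : z = x
          · subst hzx; simp [hxR]
          · by_cases hzy : z = y
            · subst hzy; simp [hyR]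
            · simp [hzy, hzx]
        have hfx : ∀ d ∈ R', f d ≠ x := fun d hd hdx => by
          have := hfm d hd
          simp [hdx] at this
        rw [e]
        -- The targets are the same. The token on `y` came from `x`, and by injectivity at most one
        -- target pays the additional step.
        refine ⟨fun d => if f d = y then x else f d, ?_, ?_, ?_⟩
        · intro a ha b hb hab
          simp only at hab
          have hfa := hfx a ha
          have hfb := hfx b hb
          refine hf ha hb ?_
          split_ifs at hab with h1 h2 h2
          · rw [h1, h2]
          · exact absurd hab.symm hfb
          · exact absurd hab hfa
          · exact hab
        · intro d hd
          simp only
          split_ifs with h1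
          · exact Finset.mem_sdiff.2 ⟨hx, hxR⟩
          · exact mS (hfm d hd) h1
        · calc _ ≤ ∑ d ∈ R', (G.edist (f d) d + if f d = y then 1 else 0) := by
                refine Finset.sum_le_sum fun d hd => ?_
                simp only
                split_ifs with h1
                · rw [h1, add_comm, ← hd1]; exact SimpleGraph.edist_triangle
                · simp
            _ ≤ ∑ d ∈ R', G.edist (f d) d + 1 := by
                rw [Finset.sum_add_distrib]
                gcongr
                exact sum_ite_le_of_injOn hf _ _
            _ ≤ _ := by gcongr

end Slides

end Discovery

/-! ### Reduction to bipartite matching -/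

/-- An exchange: if `y` is unmatched, the edge `(x, y)` replaces the at most one edge at `x`. -/
theorem IsMatching.exists_cover {α β : Type*} [DecidableEq α] [DecidableEq β] {E : α → β → Prop}
    {M : Finset (α × β)} (hM : IsMatching E M) {x : α} {y : β} (h : E x y) :
    ∃ M', IsMatching E M' ∧ M.card ≤ M'.card ∧ ∃ z, (z, y) ∈ M' := by
  by_cases hy : ∃ z, (z, y) ∈ M
  · exact ⟨M, hM, le_rfl, hy⟩
  · push Not at hy
    have hx : (x, y) ∉ M.filter fun p => p.1 ≠ x := by simp
    refine ⟨insert (x, y) (M.filter fun p => p.1 ≠ x), ⟨?_, ?_, ?_⟩, ?_, x, by simp⟩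
    · intro p hp
      rcases Finset.mem_insert.1 hp with rfl | hp
      · exact h
      · exact hM.edge p (Finset.mem_filter.1 hp).1
    · rw [Finset.coe_insert, Set.injOn_insert (by exact_mod_cast hx)]
      refine ⟨hM.fst.mono (by exact_mod_cast Finset.filter_subset _ _), ?_⟩
      rintro ⟨p, hp, hpx⟩
      exact (Finset.mem_filter.1 hp).2 hpx
    · rw [Finset.coe_insert, Set.injOn_insert (by exact_mod_cast hx)]
      refine ⟨hM.snd.mono (by exact_mod_cast Finset.filter_subset _ _), ?_⟩
      rintro ⟨p, hp, hpy⟩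
      refine hy p.1 ?_
      simp only at hpy
      rw [← hpy]
      exact (Finset.mem_filter.1 hp).1
    · rw [Finset.card_insert_of_notMem hx, ← Finset.card_filter_add_card_filter_not
        (s := M) (fun p => p.1 ≠ x)]
      gcongr
      rw [Finset.card_le_one]
      intro p hp q hq
      simp only [not_not, Finset.mem_filter] at hp hq
      exact hM.fst hp.1 hq.1 (hp.2.trans hq.2.symm)

/-- A matching extends to an injection if there is enough room. -/
theorem IsMatching.exists_extension {V : Type*} [DecidableEq V] {E : V → V → Prop}
    {M : Finset (V × V)} (hM : IsMatching E M) {D A : Finset V}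
    (hE : ∀ x y, E x y → x ∈ D ∧ y ∈ A) (h : D.card ≤ A.card) :
    ∃ f : V → V, Set.InjOn f D ∧ (∀ d ∈ D, f d ∈ A) ∧ ∀ p ∈ M, f p.1 = p.2 := by
  classical
  have hg : ∀ d : D, d.1 ∈ M.image Prod.fst → ∃ y, (d.1, y) ∈ M := by
    intro d hd
    obtain ⟨p, hp, h⟩ := Finset.mem_image.1 hd
    exact ⟨p.2, h ▸ hp⟩
  have : ∃ g : D → V, ∀ d : D, d.1 ∈ M.image Prod.fst → (d.1, g d) ∈ M :=
    ⟨fun d => if h : d.1 ∈ M.image Prod.fst then (hg d h).choose else d.1,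
      fun d h => by simpa only [h, dif_pos] using (hg d h).choose_spec⟩
  obtain ⟨g, hg⟩ := this
  set s : Finset D := Finset.univ.filter fun d => d.1 ∈ M.image Prod.fst with hs
  have hms {d : D} (hd : d ∈ s) : (d.1, g d) ∈ M := hg d (Finset.mem_filter.1 hd).2
  have hsub : s.image g ⊆ A := by
    intro y hy
    obtain ⟨d, hd, rfl⟩ := Finset.mem_image.1 hy
    exact (hE _ _ (hM.edge _ (hms hd))).2
  have hsc : (s.image g).card ≤ D.card := by
    refine Finset.card_image_le.trans ?_
    simpa using s.card_le_univ
  obtain ⟨t, hst, htA, ht⟩ := Finset.exists_subsuperset_card_eq hsub hsc h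
  have hinj : Set.InjOn g s := fun d hd e he hde => by
    have := hM.snd (hms hd) (hms he) hde
    exact Subtype.ext (Prod.ext_iff.1 this).1
  obtain ⟨φ, hφ⟩ := Finset.exists_equiv_extend_of_card_eq (by simp [ht]) hst hinj
  refine ⟨fun d => if hd : d ∈ D then (φ ⟨d, hd⟩).1 else d, ?_, ?_, ?_⟩
  · intro d hd e he hde
    have hd' : d ∈ D := hd
    have he' : e ∈ D := he
    simp only [hd', he', dif_pos] at hde
    have := φ.injective (Subtype.ext hde)
    exact (Subtype.mk.inj this)
  · intro d hd
    simp only [hd, dif_pos]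
    exact htA (φ _).2
  · intro p hp
    have hd := (hE _ _ (hM.edge p hp)).1
    have hps : (⟨p.1, hd⟩ : D) ∈ s := by
      rw [hs, Finset.mem_filter]
      exact ⟨Finset.mem_univ _, Finset.mem_image_of_mem _ hp⟩
    simp only [hd, dif_pos]
    rw [hφ _ hps]
    exact (Prod.ext_iff.1 (hM.fst (hms hps) hp rfl)).2

/-! ### Costs of moves in split graphs, and the matching criterion -/

namespace Discovery

open scoped Classical

section

variable {V : Type*} (G : SimpleGraph V)

/-- The distance of vertices in a split graph, unless it is `0` or `∞`. -/
noncomputable def weight (a d : V) : ℕ :=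
  if G.Adj a d then 1 else if ∃ u, G.Adj a u ∧ G.Adj u d then 2 else 3

variable {G}

/-- This half holds in every graph, since `weight` is capped at 3. The converse estimate needs the
split structure and is proved only for available tokens and missing vertices of a candidate. -/
theorem weight_le_edist {a d : V} (h : a ≠ d) : (weight G a d : ℕ∞) ≤ G.edist a d := by
  unfold weight
  split_ifs with h1 h2
  · rw [SimpleGraph.edist_eq_one_iff_adj.2 h1]; rfl
  · have : ¬ G.edist a d ≤ 1 := by
      rw [SimpleGraph.edist_le_one_iff_adj_or_eq]; tauto
    exact Order.add_one_le_of_lt (not_le.1 this)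
  · refine Order.add_one_le_of_lt (x := (2 : ℕ∞)) ?_
    by_cases ht : G.edist a d = ⊤
    · rw [ht]; exact ENat.natCast_lt_top 2
    · obtain ⟨p, hp⟩ := SimpleGraph.exists_walk_of_edist_ne_top ht
      rw [← hp]
      match p, h with
      | .nil, h => exact absurd rfl h
      | .cons h' .nil, _ => exact absurd h' h1
      | .cons h' (.cons h'' .nil), _ => exact absurd ⟨_, h', h''⟩ h2
      | .cons _ (.cons _ (.cons _ p)), _ =>
        simp only [SimpleGraph.Walk.length_cons]
        norm_cast
        omega

theorem one_le_weight (a d : V) : 1 ≤ weight G a d := by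
  unfold weight; split_ifs <;> omega

theorem weight_le_three (a d : V) : weight G a d ≤ 3 := by
  unfold weight; split_ifs <;> omega

theorem exists_adj_of_edist_ne_top {a d : V} (h : a ≠ d) (h' : G.edist a d ≠ ⊤) :
    ∃ w, G.Adj a w := by
  obtain ⟨p, -⟩ := SimpleGraph.exists_walk_of_edist_ne_top h'
  cases p with
  | nil => exact absurd rfl h
  | cons h _ => exact ⟨_, h⟩

end

section

variable {V : Type*} [Fintype V] [DecidableEq V] (G : SimpleGraph V) (Q S : Finset V) (c : Option V)

/-- The candidates for vertex covers in a split graph: the clique `Q`, and the neighbourhoods of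
its vertices. -/
noncomputable def candidate : Finset V :=
  match c with
  | none => Q
  | some v => Finset.univ.filter fun u => G.Adj v u

/-- The vertices of the candidate that have no token. -/
noncomputable def deficit : Finset V := candidate G Q c \ S

/-- The tokens that may be moved to the candidate. -/
noncomputable def available : Finset V :=
  (S \ candidate G Q c).filter fun u => ∃ w, G.Adj u w

/-- The pairs of vertices that are closer than in the worst case. -/
def Close (d a : V) : Prop :=
  d ∈ deficit G Q S c ∧ a ∈ available G Q S c ∧
    if c = some a then d ∉ Q ∨ deficit G Q S c ⊆ Q
    else if d ∈ Q then G.Adj a d else ∃ u, G.Adj a u ∧ G.Adj u d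

/-- A token on the vertex whose neighbourhood is the candidate can save two steps. -/
noncomputable def bonus : ℕ :=
  if (∃ v ∈ S, c = some v) ∧ ¬ deficit G Q S c ⊆ Q then 1 else 0

/-- The candidate can be reached in at most `b` steps, in terms of matchings. -/
def Good (b : ℕ) : Prop :=
  (deficit G Q S c).card ≤ (available G Q S c).card ∧
    ∃ M, IsMatching (Close G Q S c) M ∧
      2 * (deficit G Q S c).card + (deficit G Q S c \ Q).card ≤ b + bonus G Q S c + M.card

variable {G Q S c}

variable (hQ : G.IsClique Q) (hI : G.IsIndepSet (Qᶜ : Finset V)) (hc : ∀ v, c = some v → v ∈ Q)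

include hQ hI hc in
-- Every edge has an end in `Q`. The neighbourhood of `v ∈ Q` contains the rest of `Q`, and the
-- edges at `v` are covered by their other ends.
theorem isVertexCover_of_candidate_subset {T : Finset V} (hT : candidate G Q c ⊆ T) :
    G.IsVertexCover (T : Set V) := by
  intro u w huw
  have hIuw : u ∈ Q ∨ w ∈ Q := by
    by_contra h
    push Not at h
    exact hI (by simpa using h.1) (by simpa using h.2) huw.ne huw
  cases c with
  | none => exact hIuw.imp (fun h => hT h) (fun h => hT h)
  | some v =>
    have key {x : V} (hx : G.Adj v x) : x ∈ T := hT (by simpa [candidate] using hx)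
    have hv := hc v rfl
    have key' {x y : V} (hxy : G.Adj x y) (hx : x ∈ Q) : x ∈ T ∨ y ∈ T := by
      by_cases hxv : x = v
      · exact .inr (key (hxv ▸ hxy))
      · exact .inl (key (hQ hv hx (Ne.symm hxv)))
    exact hIuw.elim (key' huw) fun h => (key' huw.symm h).symm

theorem exists_candidate_subset {T : Finset V} (hT : G.IsVertexCover (T : Set V)) :
    ∃ c : Option V, (∀ v, c = some v → v ∈ Q) ∧ candidate G Q c ⊆ T := by
  by_cases h : Q ⊆ T
  · exact ⟨none, by simp, h⟩
  · obtain ⟨v, hvQ, hvT⟩ := Finset.not_subset.1 h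
    refine ⟨some v, by simpa using hvQ, fun u hu => ?_⟩
    have hvu : G.Adj v u := by simpa [candidate] using hu
    exact (hT hvu).resolve_left hvT

theorem adj_of_mem_deficit {a d : V} (hd : d ∈ deficit G Q S c) (ha : c = some a) :
    G.Adj a d := by
  subst ha
  simpa [candidate] using (Finset.mem_sdiff.1 hd).1

theorem deficit_none_subset : deficit G Q S none ⊆ Q := Finset.sdiff_subset

theorem ne_of_mem {a d : V} (hd : d ∈ deficit G Q S c) (ha : a ∈ S) : a ≠ d := by
  rintro rfl
  exact (Finset.mem_sdiff.1 hd).2 ha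

include hQ hc in
/-- Tokens outside of the candidate are outside of the clique, with one exception. -/
theorem eq_some_of_mem_available {a : V} (ha : a ∈ available G Q S c) (haQ : a ∈ Q) :
    c = some a := by
  have h := (Finset.mem_sdiff.1 (Finset.mem_filter.1 ha).1).2
  cases c with
  | none => exact absurd haQ h
  | some v =>
    by_contra hne
    exact h (by simpa [candidate] using hQ (hc v rfl) haQ fun h' => hne (by rw [h']))

include hQ hI in
-- A non-isolated vertex outside the clique has all its neighbours inside it, so every vertex of the
-- clique is at distance at most 2. Being non-isolated is what `available` demands of a token.
theorem weight_le_two {a d : V} (hd : d ∈ Q) (hne : a ≠ d) (ha : ∃ w, G.Adj a w) :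
    weight G a d ≤ 2 := by
  unfold weight
  split_ifs with h1 h2
  · omega
  · omega
  · exfalso
    obtain ⟨w, hw⟩ := ha
    by_cases haQ : a ∈ Q
    · exact h1 (hQ haQ hd hne)
    · have hwQ : w ∈ Q := by
        by_contra hwQ
        exact hI (by simpa using haQ) (by simpa using hwQ) hw.ne hw
      by_cases hwd : w = d
      · exact h1 (hwd ▸ hw)
      · exact h2 ⟨w, hw, hQ hwQ hd hwd⟩

include hQ hI hc in
-- Only a target outside `Q` can be at distance 3. It then lies in the candidate of some `v ∈ Q`,
-- and the walk runs from `a` to a neighbour in the clique, to `v`, and to the target.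
theorem exists_walk_length_le_weight {a d : V} (ha : a ∈ available G Q S c)
    (hd : d ∈ deficit G Q S c) : ∃ p : G.Walk a d, p.length ≤ weight G a d := by
  have haS := (Finset.mem_sdiff.1 (Finset.mem_filter.1 ha).1).1
  have hw := (Finset.mem_filter.1 ha).2
  have hne := ne_of_mem hd haS
  have h2 (hdQ : d ∈ Q) := weight_le_two hQ hI hdQ hne hw
  unfold weight at h2 ⊢
  split_ifs at h2 ⊢ with h1 h2'
  · exact ⟨.cons h1 .nil, by simp⟩
  · obtain ⟨u, h3, h4⟩ := h2'
    exact ⟨.cons h3 (.cons h4 .nil), by simp⟩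
  · cases c with
    | none => exact absurd (h2 (deficit_none_subset hd)) (by omega)
    | some v =>
      have hv := hc v rfl
      have hvd := adj_of_mem_deficit hd rfl
      obtain ⟨w, hw⟩ := hw
      have haQ : a ∉ Q := fun haQ =>
        h1 (adj_of_mem_deficit hd (eq_some_of_mem_available hQ hc ha haQ))
      have hwQ : w ∈ Q := by
        by_contra hwQ
        exact hI (by simpa using haQ) (by simpa using hwQ) hw.ne hw
      have hwv : w ≠ v := by rintro rfl; exact h2' ⟨w, hw, hvd⟩
      exact ⟨.cons hw (.cons (hQ hwQ hv hwv) (.cons hvd .nil)), by simp⟩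

/-- This is the total base cost, against which the savings of a matching and of the bonus are
measured. -/
theorem sum_base {V : Type*} [DecidableEq V] (D Q : Finset V) :
    ∑ d ∈ D, (if d ∈ Q then 2 else 3) = 2 * D.card + (D \ Q).card := by
  have : ∀ d ∈ D, (if d ∈ Q then 2 else 3) = 2 + if d ∉ Q then 1 else 0 := fun d _ => by
    split_ifs <;> rfl
  rw [Finset.sum_congr rfl this, Finset.sum_add_distrib, Finset.sum_boole, Finset.sum_const,
    smul_eq_mul, mul_comm]
  have : (D.filter fun d => d ∉ Q) = D \ Q := by ext d; simp
  rw [this, Nat.cast_id]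

theorem bonus_eq_one (h : ∃ v ∈ S, c = some v) (h' : ¬ deficit G Q S c ⊆ Q) :
    bonus G Q S c = 1 := if_pos ⟨h, h'⟩

include hQ hI hc in
-- The matching consists of the pairs of an optimal-or-better-than-`b` assignment that are close.
-- Finite total distance forces the tokens used to be non-isolated, hence available.
theorem good_of_reachableIn {b l : ℕ} {T : Finset V} (hT : candidate G Q c ⊆ T) (hl : l ≤ b)
    (h : ReachableIn G l S T) : Good G Q S c b := by
  obtain ⟨f, hf, hfm, hfs⟩ := h.exists_assignment hT
  change Set.InjOn f (deficit G Q S c) at hf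
  change ∀ d ∈ deficit G Q S c, _ at hfm
  change ∑ d ∈ deficit G Q S c, _ ≤ _ at hfs
  have hne {d : V} (hd : d ∈ deficit G Q S c) : f d ≠ d :=
    ne_of_mem hd (Finset.mem_sdiff.1 (hfm d hd)).1
  have hfA : ∀ d ∈ deficit G Q S c, f d ∈ available G Q S c := by
    intro d hd
    refine Finset.mem_filter.2 ⟨hfm d hd, ?_⟩
    have hfin : G.edist (f d) d ≠ ⊤ := by
      refine ne_top_of_le_ne_top (ENat.natCast_ne_top l) (le_trans ?_ hfs)
      exact Finset.single_le_sum (f := fun d => G.edist (f d) d) (fun _ _ => zero_le) hd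
    exact exists_adj_of_edist_ne_top (hne hd) hfin
  have hws : ∑ d ∈ deficit G Q S c, weight G (f d) d ≤ l := by
    have : ((∑ d ∈ deficit G Q S c, weight G (f d) d : ℕ) : ℕ∞) ≤ l := by
      push_cast
      exact (Finset.sum_le_sum fun d hd => weight_le_edist (hne hd)).trans hfs
    exact_mod_cast this
  set D := deficit G Q S c with hD
  set N := D.filter fun d => Close G Q S c d (f d) with hN
  refine ⟨Finset.card_le_card_of_injOn f hfA hf, N.image fun d => (d, f d), ⟨?_, ?_, ?_⟩, ?_⟩
  · intro p hp
    obtain ⟨d, hd, rfl⟩ := Finset.mem_image.1 hp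
    exact (Finset.mem_filter.1 hd).2
  · intro p hp q hq hpq
    obtain ⟨d, hd, rfl⟩ := Finset.mem_image.1 hp
    obtain ⟨e, he, rfl⟩ := Finset.mem_image.1 hq
    simp only at hpq
    rw [hpq]
  · intro p hp q hq hpq
    obtain ⟨d, hd, rfl⟩ := Finset.mem_image.1 hp
    obtain ⟨e, he, rfl⟩ := Finset.mem_image.1 hq
    simp only at hpq
    rw [hf (Finset.mem_filter.1 hd).1 (Finset.mem_filter.1 he).1 hpq]
  · rw [Finset.card_image_of_injective _ fun d e h => (Prod.ext_iff.1 h).1, ← sum_base]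
    -- For each target, the saving against the base cost is at most 1 for a close pair, plus the
    -- bonus for the token on `v`. A pair of this token with a target in `Q` that is not close is
    -- paid for by the bonus alone.
    have point : ∀ d ∈ D, (if d ∈ Q then 2 else 3) ≤ weight G (f d) d +
        (if Close G Q S c d (f d) then 1 else 0) +
        (if c = some (f d) then bonus G Q S c else 0) := by
      intro d hd
      have hA := hfA d hd
      have hfS : f d ∈ S := (Finset.mem_sdiff.1 (hfm d hd)).1
      have h1 := one_le_weight (G := G) (f d) d
      by_cases hcf : c = some (f d)
      · rw [if_pos hcf]
        by_cases hDQ : D ⊆ Q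
        · have : Close G Q S c d (f d) := ⟨hd, hA, by rw [if_pos hcf]; exact .inr hDQ⟩
          rw [if_pos this, if_pos (hDQ hd)]
          omega
        · rw [bonus_eq_one ⟨_, hfS, hcf⟩ hDQ]
          by_cases hdQ : d ∈ Q
          · rw [if_pos hdQ]; omega
          · have : Close G Q S c d (f d) := ⟨hd, hA, by rw [if_pos hcf]; exact .inl hdQ⟩
            rw [if_pos this, if_neg hdQ]
            omega
      · have hfQ : f d ∉ Q := fun h' => hcf (eq_some_of_mem_available hQ hc hA h')
        rw [if_neg hcf]
        by_cases hdQ : d ∈ Q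
        · rw [if_pos hdQ]
          by_cases hadj : G.Adj (f d) d
          · have : Close G Q S c d (f d) :=
              ⟨hd, hA, by rw [if_neg hcf, if_pos hdQ]; exact hadj⟩
            rw [if_pos this]
            omega
          · have : 2 ≤ weight G (f d) d := by
              unfold weight; rw [if_neg hadj]; split_ifs <;> omega
            omega
        · rw [if_neg hdQ]
          have hadj : ¬ G.Adj (f d) d := fun hadj =>
            hI (by simpa using hfQ) (by simpa using hdQ) hadj.ne hadj
          by_cases hcom : ∃ u, G.Adj (f d) u ∧ G.Adj u d
          · have : Close G Q S c d (f d) :=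
              ⟨hd, hA, by rw [if_neg hcf, if_neg hdQ]; exact hcom⟩
            have h2 : weight G (f d) d = 2 := by
              unfold weight; rw [if_neg hadj, if_pos hcom]
            rw [if_pos this]
            omega
          · have h2 : weight G (f d) d = 3 := by
              unfold weight; rw [if_neg hadj, if_neg hcom]
            omega
    have h1 := Finset.sum_le_sum point
    rw [Finset.sum_add_distrib, Finset.sum_add_distrib, Finset.sum_boole] at h1
    -- By injectivity the token on `v` serves at most one target, so the bonus is counted at most
    -- once.
    have h2 : ∑ d ∈ D, (if c = some (f d) then bonus G Q S c else 0) ≤ bonus G Q S c := by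
      by_cases hex : ∃ d ∈ D, c = some (f d)
      · obtain ⟨d, hd, hcd⟩ := hex
        rw [Finset.sum_eq_single_of_mem d hd fun e he hne => if_neg fun h => hne
          (hf he hd (Option.some.inj (h.symm.trans hcd))), if_pos hcd]
      · push Not at hex
        rw [Finset.sum_eq_zero fun d hd => if_neg (hex d hd)]
        exact Nat.zero_le _
    simp only [Nat.cast_id] at h1
    rw [← hN] at h1
    rw [← hD]
    omega

include hQ hI hc in
-- A matching extends to an assignment of all targets because enough tokens are available, and the
-- unmatched targets cost at most the base price. The bonus is earned only if the token on `v` is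
-- used, which an exchange ensures.
theorem exists_reachableIn_of_good {b : ℕ} (h : Good G Q S c b) :
    ∃ T, candidate G Q c ⊆ T ∧ ∃ l ≤ b, ReachableIn G l S T := by
  obtain ⟨hcard, M, hM, hb⟩ := h
  -- With a positive bonus, some target outside `Q` is close to `v`, so `IsMatching.exists_cover`
  -- matches `v` without losing edges.
  obtain ⟨M', hM', hMM', hcov⟩ : ∃ M', IsMatching (Close G Q S c) M' ∧ M.card ≤ M'.card ∧
      (bonus G Q S c = 1 → ∃ v z, c = some v ∧ (z, v) ∈ M') := by
    by_cases hbon : (∃ v ∈ S, c = some v) ∧ ¬ deficit G Q S c ⊆ Q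
    · obtain ⟨⟨v, hv, hcv⟩, hDQ⟩ := hbon
      obtain ⟨d, hd, hdQ⟩ := Finset.not_subset.1 hDQ
      have hvR : v ∉ candidate G Q c := by subst hcv; simp [candidate]
      have hvA : v ∈ available G Q S c :=
        Finset.mem_filter.2 ⟨Finset.mem_sdiff.2 ⟨hv, hvR⟩, d, adj_of_mem_deficit hd hcv⟩
      have hclose : Close G Q S c d v := ⟨hd, hvA, by rw [if_pos hcv]; exact .inl hdQ⟩
      obtain ⟨M', h1, h2, z, h3⟩ := hM.exists_cover hclose
      exact ⟨M', h1, h2, fun _ => ⟨v, z, hcv, h3⟩⟩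
    · exact ⟨M, hM, le_rfl, fun h => by simp [bonus, hbon] at h⟩
  obtain ⟨f, hf, hfA, hfM⟩ := hM'.exists_extension (fun x y h => ⟨h.1, h.2.1⟩) hcard
  set D := deficit G Q S c with hD
  have hfR {d : V} (hd : d ∈ D) : f d ∈ S \ candidate G Q c :=
    (Finset.mem_filter.1 (hfA d hd)).1
  have hDS : Disjoint D S := Finset.sdiff_disjoint
  obtain ⟨l, hl, hreach⟩ := exists_reachableIn_of_assignment hDS hf
    (fun d hd => (Finset.mem_sdiff.1 (hfR hd)).1)
    (fun d hd => exists_walk_length_le_weight hQ hI hc (hfA d hd) hd)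
  refine ⟨_, fun r hr => ?_, l, hl.trans ?_, hreach⟩
  · refine Finset.mem_sdiff.2 ⟨?_, fun h => ?_⟩
    · by_cases hrS : r ∈ S
      · exact Finset.mem_union_left _ hrS
      · exact Finset.mem_union_right _ (Finset.mem_sdiff.2 ⟨hr, hrS⟩)
    · obtain ⟨d, hd, rfl⟩ := Finset.mem_image.1 h
      exact (Finset.mem_sdiff.1 (hfR hd)).2 hr
  · have point : ∀ d ∈ D, weight G (f d) d + (if (d, f d) ∈ M' then 1 else 0) +
        (if c = some (f d) then bonus G Q S c else 0) ≤ if d ∈ Q then 2 else 3 := by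
      intro d hd
      have hA := hfA d hd
      have hfS : f d ∈ S := (Finset.mem_sdiff.1 (hfR hd)).1
      have hw3 := weight_le_three (G := G) (f d) d
      have hw2 (hdQ : d ∈ Q) :=
        weight_le_two hQ hI hdQ (ne_of_mem hd hfS) (Finset.mem_filter.1 hA).2
      have hcl (h : (d, f d) ∈ M') : Close G Q S c d (f d) := hM'.edge _ h
      by_cases hcf : c = some (f d)
      · rw [if_pos hcf]
        have hadj : G.Adj (f d) d := adj_of_mem_deficit hd hcf
        have hw1 : weight G (f d) d = 1 := if_pos hadj
        rw [hw1]
        by_cases hDQ : D ⊆ Q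
        · have : bonus G Q S c = 0 := if_neg fun h => h.2 hDQ
          rw [this, if_pos (hDQ hd)]
          split_ifs <;> omega
        · have hb1 := bonus_eq_one ⟨_, hfS, hcf⟩ hDQ
          obtain ⟨v, z, hcv, hzv⟩ := hcov hb1
          obtain rfl : v = f d := Option.some.inj (hcv.symm.trans hcf)
          have hz : f z = f d := hfM _ hzv
          have hzD : z ∈ D := (hM'.edge _ hzv).1
          -- The target of the token on `v` is its partner in `M'`. It lies outside `Q`, so the
          -- distance 1 leaves a saving of 2: one for the edge, one for the bonus.
          obtain rfl := hf hzD hd hz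
          have hcl := hcl hzv
          have hzQ : z ∉ Q := by
            have := hcl.2.2
            rw [if_pos hcf] at this
            exact this.resolve_right hDQ
          rw [if_neg hzQ, hb1]
          split_ifs
          omega
      · rw [if_neg hcf]
        by_cases hm : (d, f d) ∈ M'
        · rw [if_pos hm]
          have := (hcl hm).2.2
          rw [if_neg hcf] at this
          by_cases hdQ : d ∈ Q
          · rw [if_pos hdQ] at this ⊢
            have hw1 : weight G (f d) d = 1 := if_pos this
            omega
          · rw [if_neg hdQ] at this ⊢
            have : weight G (f d) d ≤ 2 := by
              unfold weight; split_ifs <;> omega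
            omega
        · rw [if_neg hm]
          by_cases hdQ : d ∈ Q
          · have := hw2 hdQ; rw [if_pos hdQ]; omega
          · rw [if_neg hdQ]; omega
    have h1 := Finset.sum_le_sum point
    rw [Finset.sum_add_distrib, Finset.sum_add_distrib, Finset.sum_boole, sum_base] at h1
    simp only [Nat.cast_id] at h1
    have h2 : M'.card ≤ (D.filter fun d => (d, f d) ∈ M').card := by
      refine Finset.card_le_card_of_injOn Prod.fst (fun p hp => ?_) hM'.fst
      have : (p.1, f p.1) = p := Prod.ext rfl (hfM p hp)
      refine Finset.mem_coe.2 (Finset.mem_filter.2 ⟨(hM'.edge p hp).1, ?_⟩)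
      rw [this]; exact hp
    have h3 : bonus G Q S c ≤ ∑ d ∈ D, (if c = some (f d) then bonus G Q S c else 0) := by
      by_cases hb0 : bonus G Q S c = 0
      · omega
      · have hb1 : bonus G Q S c = 1 := by
          unfold bonus at hb0 ⊢
          split_ifs at hb0 ⊢
          · rfl
          · exact absurd rfl hb0
        obtain ⟨v, z, hcv, hzv⟩ := hcov hb1
        have hz : f z = v := hfM _ hzv
        have hzD : z ∈ D := (hM'.edge _ hzv).1
        refine le_trans ?_ (Finset.single_le_sum
          (f := fun d => if c = some (f d) then bonus G Q S c else 0)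
          (fun _ _ => Nat.zero_le _) hzD)
        rw [if_pos (by rw [hz, hcv])]
    omega

include hQ hI in
/-- Vertex cover discovery in split graphs reduces to bipartite matching. -/
theorem vcd_iff_exists_good {b : ℕ} :
    VCD G S b ↔ ∃ c : Option V, (∀ v, c = some v → v ∈ Q) ∧ Good G Q S c b := by
  constructor
  · rintro ⟨T, hT, l, hl, h⟩
    obtain ⟨c, hc, hcT⟩ := exists_candidate_subset (Q := Q) hT
    exact ⟨c, hc, good_of_reachableIn hQ hI hc hcT hl h⟩
  · rintro ⟨c, hc, h⟩
    obtain ⟨T, hT, l, hl, hr⟩ := exists_reachableIn_of_good hQ hI hc h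
    exact ⟨T, isVertexCover_of_candidate_subset hQ hI hc hT, l, hl, hr⟩

end

end Discovery

/-! ### Split partitions from degrees and neighbourhoods -/

namespace Discovery

open scoped Classical

/-- The vertex set of the graph is partitioned into the clique `Q` and an independent set. -/
def IsSplitting {V : Type*} [Fintype V] (G : SimpleGraph V) (Q : Finset V) : Prop :=
  G.IsClique Q ∧ G.IsIndepSet (Qᶜ : Finset V)

theorem IsSplit.exists_isSplitting {V : Type*} [Fintype V] {G : SimpleGraph V} (h : IsSplit G) :
    ∃ Q, IsSplitting G Q := by
  obtain ⟨Q, I, hQI, hQ, hI⟩ := h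
  refine ⟨Q.toFinset, by simpa using hQ, ?_⟩
  rw [hQI.symm.eq_compl] at hI
  simpa using hI

/-- The clique can be chosen as the set of the vertices of large degree, or as the neighbourhood
of a vertex. -/
theorem IsSplit.exists_threshold_or_neighbors {V : Type*} [Fintype V] {G : SimpleGraph V}
    (h : IsSplit G) :
    (∃ k ≤ Fintype.card V, IsSplitting G (Finset.univ.filter fun u => k ≤ G.degree u)) ∨
      ∃ v, IsSplitting G (Finset.univ.filter fun u => G.Adj v u) := by
  -- A splitting with the smallest clique: then no vertex of `Q` can be moved to the independent
  -- side.
  obtain ⟨Q, hQ, hmin⟩ := Finset.exists_min_image (Finset.univ.filter (IsSplitting G)) Finset.card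
    (by obtain ⟨Q, hQ⟩ := h.exists_isSplitting; exact ⟨Q, by simpa using hQ⟩)
  replace hQ : IsSplitting G Q := by simpa using hQ
  replace hmin : ∀ Q', IsSplitting G Q' → Q.card ≤ Q'.card := by simpa using hmin
  have hnQ {i : V} (hi : i ∉ Q) : G.neighborFinset i ⊆ Q := fun u hu => by
    by_contra huQ
    rw [SimpleGraph.mem_neighborFinset] at hu
    exact hQ.2 (by simpa using hi) (by simpa using huQ) hu.ne hu
  -- The neighbours of a vertex outside `Q` lie in `Q`, so a degree of at least `Q.card` makes its
  -- neighbourhood equal to `Q`. Otherwise the threshold `Q.card` separates the two sides.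
  by_cases hi : ∃ i ∉ Q, Q.card ≤ G.degree i
  · obtain ⟨i, hi, hd⟩ := hi
    right
    refine ⟨i, ?_⟩
    have : (Finset.univ.filter fun u => G.Adj i u) = Q := by
      rw [← Finset.eq_of_subset_of_card_le (hnQ hi) hd]
      ext u; simp
    rwa [this]
  · push Not at hi
    left
    refine ⟨Q.card, Q.card_le_univ, ?_⟩
    have : (Finset.univ.filter fun u => Q.card ≤ G.degree u) = Q := by
      ext q
      simp only [Finset.mem_filter, Finset.mem_univ, true_and]
      refine ⟨fun hd => by_contra fun hq => absurd hd (not_le.2 (hi q hq)), fun hq => ?_⟩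
      -- By minimality `q` has a neighbour outside `Q`. Together with the rest of `Q` this gives it
      -- degree at least `Q.card`.
      have hex : ∃ u ∉ Q, G.Adj q u := by
        by_contra hno
        push Not at hno
        have : IsSplitting G (Q.erase q) := by
          refine ⟨hQ.1.subset (by simp), fun u hu w hw huw hadj => ?_⟩
          have hu' : u = q ∨ u ∉ Q := by
            by_contra h; push Not at h; simp [h] at hu
          have hw' : w = q ∨ w ∉ Q := by
            by_contra h; push Not at h; simp [h] at hw
          rcases hu' with rfl | hu' <;> rcases hw' with rfl | hw'
          · exact huw rfl
          · exact hno w hw' hadj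
          · exact hno u hu' hadj.symm
          · exact hQ.2 (by simpa using hu') (by simpa using hw') huw hadj
        have h1 := hmin _ this
        have h2 := Finset.card_erase_lt_of_mem hq
        omega
      obtain ⟨u, huQ, hqu⟩ := hex
      have hsub : insert u (Q.erase q) ⊆ G.neighborFinset q := by
        intro w hw
        rw [SimpleGraph.mem_neighborFinset]
        rcases Finset.mem_insert.1 hw with rfl | hw
        · exact hqu
        · exact hQ.1 hq (Finset.mem_of_mem_erase hw) (Finset.ne_of_mem_erase hw).symm
      have h1 := Finset.card_le_card hsub
      rw [Finset.card_insert_of_notMem (fun h => huQ (Finset.mem_of_mem_erase h)),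
        Finset.card_erase_of_mem hq] at h1
      have h2 := Finset.card_pos.2 ⟨q, hq⟩
      rw [SimpleGraph.card_neighborFinset_eq_degree] at h1
      omega
    rwa [this]

end Discovery

/-! ### Counting loops and loops that fill arrays -/

namespace WordRAM.Bounded

open BProg BExpr

variable {Γ : Input}

/-- A loop that counts. -/
theorem denote_count {x y : Var} (hxy : x ≠ y) {k : ℕ} {e : BExpr}
    (he : ∀ (a : Store) (v : ℕ), e.eval Γ (a.set y v) = e.eval Γ a) (a : Store) :
    (BProg.loop x k (when e (.set y (.var y + 1)))).denote Γ a =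
      (a.set y (a.var y + ((Finset.range (Γ.n + k)).filter
        fun j => e.eval Γ (a.set x j) ≠ 0).card)).set x (Γ.n + k) := by
  have comm (a : Store) (v w : ℕ) : (a.set y v).set x w = (a.set x w).set y v := by
    ext z
    · by_cases h1 : z = x
      · subst h1; simp [hxy]
      · simp [h1]
    · rfl
  -- Between passes the loop variable holds a leftover value. The invariant compares stores only
  -- after it has been overwritten.
  refine denote_for (P := fun m b => ∀ v, b.set x v =
      (a.set y (a.var y +
        ((Finset.range m).filter fun j => e.eval Γ (a.set x j) ≠ 0).card)).set x v)
    (Q := fun b => b = (a.set y (a.var y + ((Finset.range (Γ.n + k)).filter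
        fun j => e.eval Γ (a.set x j) ≠ 0).card)).set x (Γ.n + k)) ?_ ?_ fun b hb => hb _
  · intro v; ext z
    · by_cases h1 : z = y <;> simp [h1]
    · rfl
  · intro m _ b hb v
    rw [hb, denote_when, comm, he, Finset.range_add_one, Finset.filter_insert]
    by_cases h : e.eval Γ (a.set x m) = 0
    · rw [if_pos h, if_neg (by simpa using h)]
      ext z
      · by_cases h1 : z = x <;> by_cases h2 : z = y <;> simp [h1, h2]
      · rfl
    · rw [if_neg h, if_pos h, Finset.card_insert_of_notMem (by simp)]
      ext z
      · by_cases h1 : z = x <;> by_cases h2 : z = y <;> simp [h1, h2, add_assoc]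
      · rfl

/-- A loop that fills an array. -/
theorem denote_fill {x : Var} {k : Arr} {p : BProg} {val : ℕ → ℕ} {I : Store → Prop}
    (hset : ∀ b v, I b → I (b.set x v))
    (hp : ∀ i < Γ.n, ∀ b, I b → b.var x = i → I (p.denote Γ b) ∧
      ∀ j, (p.denote Γ b).arr k j = if j = i then val i else b.arr k j) {a : Store} (ha : I a) :
    I ((BProg.loop x 0 p).denote Γ a) ∧
      ∀ i < Γ.n, ((BProg.loop x 0 p).denote Γ a).arr k i = val i := by
  refine denote_for (P := fun m b => I b ∧ ∀ i < m, b.arr k i = val i)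
    (Q := fun b => I b ∧ ∀ i < Γ.n, b.arr k i = val i) ⟨ha, by simp⟩ ?_
    fun b hb => ⟨hset _ _ hb.1, by simpa using hb.2⟩
  rintro m hm b ⟨h1, h2⟩
  obtain ⟨h3, h4⟩ := hp m (by simpa using hm) (b.set x m) (hset _ _ h1) (by simp)
  refine ⟨h3, fun i hi => ?_⟩
  rw [h4]
  split_ifs with h
  · rw [h]
  · exact h2 i (by omega)

theorem mul_add_eq_iff {n i j i' j' : ℕ} (hj : j < n) (hj' : j' < n) :
    i * n + j = i' * n + j' ↔ i = i' ∧ j = j' := by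
  constructor
  · intro h
    have h1 : i = i' := by
      rcases lt_trichotomy i i' with h' | h' | h'
      · have := Nat.mul_le_mul_right n (show i + 1 ≤ i' from h')
        rw [add_mul] at this; omega
      · exact h'
      · have := Nat.mul_le_mul_right n (show i' + 1 ≤ i from h')
        rw [add_mul] at this; omega
    subst h1
    exact ⟨rfl, by omega⟩
  · rintro ⟨rfl, rfl⟩; rfl

/-- Two nested loops that fill a matrix. -/
theorem denote_fill₂ {x y : Var} (hxy : x ≠ y) {k : Arr} {p : BProg} (hpx : p.writes x = false)
    {val : ℕ → ℕ → ℕ}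
    {I : Store → Prop} (hset : ∀ b z v, z = x ∨ z = y → I b → I (b.set z v))
    (hp : ∀ i < Γ.n, ∀ j < Γ.n, ∀ b, I b → b.var x = i → b.var y = j → I (p.denote Γ b) ∧
      ∀ m, (p.denote Γ b).arr k m = if m = i * Γ.n + j then val i j else b.arr k m)
    {a : Store} (ha : I a) :
    I ((BProg.loop x 0 (.loop y 0 p)).denote Γ a) ∧ ∀ i < Γ.n, ∀ j < Γ.n,
      ((BProg.loop x 0 (.loop y 0 p)).denote Γ a).arr k (i * Γ.n + j) = val i j := by
  refine denote_for (P := fun m b => I b ∧ ∀ i < m, ∀ j < Γ.n, b.arr k (i * Γ.n + j) = val i j)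
    (Q := fun b => I b ∧ ∀ i < Γ.n, ∀ j < Γ.n, b.arr k (i * Γ.n + j) = val i j)
    ⟨ha, by simp⟩ ?_ fun b hb => ⟨hset _ _ _ (.inl rfl) hb.1, by simpa using hb.2⟩
  rintro m hm b ⟨h1, h2⟩
  rw [add_zero] at hm
  refine denote_for (P := fun m' b' => (I b' ∧ b'.var x = m) ∧
      (∀ i < m, ∀ j < Γ.n, b'.arr k (i * Γ.n + j) = val i j) ∧
      ∀ j < m', b'.arr k (m * Γ.n + j) = val m j)
    (Q := fun b => I b ∧ ∀ i < m + 1, ∀ j < Γ.n, b.arr k (i * Γ.n + j) = val i j)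
    ⟨⟨hset _ _ _ (.inl rfl) h1, by simp⟩, by simpa using h2, by simp⟩ ?_ ?_
  · rintro m' hm' b' ⟨⟨h3, h4⟩, h5, h6⟩
    rw [add_zero] at hm'
    obtain ⟨h7, h8⟩ := hp m hm m' hm' (b'.set y m') (hset _ _ _ (.inr rfl) h3)
      (by simp [hxy, h4]) (by simp)
    refine ⟨⟨h7, by rw [denote_var p hpx]; simp [hxy, h4]⟩, fun i hi j hj => ?_, fun j hj => ?_⟩
    · rw [h8, if_neg (by rw [mul_add_eq_iff hj hm']; omega)]
      exact h5 i hi j hj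
    · by_cases h : j = m'
      · rw [h8, h, if_pos rfl]
      · rw [h8, if_neg (by omega)]
        exact h6 j (by omega)
  · rintro b' ⟨⟨h3, -⟩, h5, h6⟩
    refine ⟨hset _ _ _ (.inr rfl) h3, fun i hi j hj => ?_⟩
    rw [Store.set_arr]
    rcases Nat.lt_succ_iff_lt_or_eq.1 hi with h | rfl
    · exact h5 i h j hj
    · exact h6 j (by omega)

theorem card_range_filter {n : ℕ} (p : ℕ → Prop) [DecidablePred p] :
    ((Finset.range n).filter p).card = (Finset.univ.filter fun i : Fin n => p i).card := by
  refine (Finset.card_bij (fun i _ => i.val) (by simp) (fun i _ j _ h => Fin.ext h) ?_).symm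
  intro i hi
  simp only [Finset.mem_filter, Finset.mem_range] at hi
  exact ⟨⟨i, hi.1⟩, by simpa using hi.2, rfl⟩

end WordRAM.Bounded

/-! ### Preprocessing: degrees, common neighbours and a split partition -/

namespace WordRAM.Bounded

open BProg BExpr Discovery

open scoped Classical

/-- Compute the degrees of the vertices. -/
def degrees : BProg :=
  .loop .i 0 (.set .cnt 0 ;;
    .loop .j 0 (when (adj (.var .i) (.var .j)) (.set .cnt (.var .cnt + 1))) ;;
    .put .deg (.var .i) (.var .cnt))

/-- Compute the numbers of common neighbours. -/
def commonNeighbors : BProg :=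
  .loop .i 0 (.loop .j 0 (.set .cnt 0 ;;
    .loop .l 0 (when (adj (.var .i) (.var .l) * adj (.var .l) (.var .j))
      (.set .cnt (.var .cnt + 1))) ;;
    .put .common (.var .i * order + .var .j) (.var .cnt)))

/-- The pair `(i, j)` shows that `cand` is not a clique whose complement is independent. -/
def violation : BExpr :=
  same (same (.var .i) (.var .j)) 0 *
      (elem .cand (.var .i) * elem .cand (.var .j) * same (adj (.var .i) (.var .j)) 0) +
    same (elem .cand (.var .i)) 0 * same (elem .cand (.var .j)) 0 * adj (.var .i) (.var .j)

/-- Copy the set `cand` to `part` if it splits the graph. -/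
def testSplitting : BProg :=
  .set .cnt 0 ;;
  .loop .i 0 (.loop .j 0 (when violation (.set .cnt (.var .cnt + 1)))) ;;
  when (same (.var .cnt) 0) (.loop .i 0 (.put .part (.var .i) (elem .cand (.var .i))))

/-- Find a partition into a clique and an independent set. -/
def partition : BProg :=
  .loop .c 1 (
    .loop .i 0 (.put .cand (.var .i) (1 - less (elem .deg (.var .i)) (.var .c))) ;;
    testSplitting ;;
    .loop .i 0 (.put .cand (.var .i) (less 0 (adj (.var .c) (.var .i)))) ;;
    testSplitting)

variable {n : ℕ} (G : SimpleGraph (Fin n)) (S : Finset (Fin n)) (b : ℕ)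

/-- The input as seen by the programs. -/
noncomputable def inputOf : Input := ⟨n, b, (Discovery.input G S b).mem⟩

@[simp] theorem inputOf_n : (inputOf G S b).n = n := rfl

@[simp] theorem inputOf_b : (inputOf G S b).b = b := rfl

theorem mul_add_lt {i j n : ℕ} (hi : i < n) (hj : j < n) : i * n + j < n * n := by
  have := Nat.mul_le_mul_right n (show i + 1 ≤ n from hi)
  rw [add_mul] at this
  omega

@[simp] theorem inputOf_mem_adj (i j : Fin n) :
    (inputOf G S b).mem (i * n + j) = if G.Adj i j then 1 else 0 := by
  have h : ((∃ i' j' : Fin n, (i * n + j : ℕ) = i'.val * n + j'.val ∧ G.Adj i' j') ∨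
      ∃ i' : Fin n, (i * n + j : ℕ) = n * n + i'.val ∧ i' ∈ S) ↔ G.Adj i j := by
    constructor
    · rintro (⟨i', j', h, h'⟩ | ⟨i', h, -⟩)
      · rw [mul_add_eq_iff j.2 j'.2] at h
        rwa [Fin.ext h.1, Fin.ext h.2]
      · have := mul_add_lt i.2 j.2
        omega
    · exact fun h => .inl ⟨i, j, rfl, h⟩
  simp only [inputOf, Discovery.input, h]

@[simp] theorem inputOf_mem_token (i : Fin n) :
    (inputOf G S b).mem (n * n + i) = if i ∈ S then 1 else 0 := by
  have h : ((∃ i' j' : Fin n, (n * n + i : ℕ) = i'.val * n + j'.val ∧ G.Adj i' j') ∨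
      ∃ i' : Fin n, (n * n + i : ℕ) = n * n + i'.val ∧ i' ∈ S) ↔ i ∈ S := by
    constructor
    · rintro (⟨i', j', h, -⟩ | ⟨i', h, h'⟩)
      · have := mul_add_lt i'.2 j'.2
        omega
      · obtain rfl : i = i' := Fin.ext (by omega)
        exact h'
    · exact fun h => .inr ⟨i, rfl, h⟩
  simp only [inputOf, Discovery.input, h]

theorem inputOf_valid : (inputOf G S b).Valid := by
  intro a ha
  simp only [inputOf_n] at ha
  refine if_neg ?_
  rintro (⟨i, j, h, -⟩ | ⟨i, h, -⟩)
  · have := mul_add_lt i.2 j.2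
    omega
  · omega

/-- The set of vertices that is stored in an array. -/
def Store.vertexSet (n : ℕ) (a : Store) (k : Arr) : Finset (Fin n) :=
  Finset.univ.filter fun u => a.arr k u ≠ 0

@[simp] theorem Store.mem_vertexSet {a : Store} {k : Arr} {u : Fin n} :
    u ∈ a.vertexSet n k ↔ a.arr k u ≠ 0 := by simp [Store.vertexSet]

variable {G S b}

theorem fill_spec {x : Var} {k : Arr} {p : BProg} {val : Fin n → ℕ} {I : Store → Prop}
    (hset : ∀ d v, I d → I (d.set x v))
    (hp : ∀ (i : Fin n) (d), I d → d.var x = i → I (p.denote (inputOf G S b) d) ∧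
      ∀ j, (p.denote (inputOf G S b) d).arr k j = if j = i then val i else d.arr k j)
    {a : Store} (ha : I a) :
    I ((BProg.loop x 0 p).denote (inputOf G S b) a) ∧
      ∀ i : Fin n, ((BProg.loop x 0 p).denote (inputOf G S b) a).arr k i = val i := by
  obtain ⟨h1, h2⟩ := denote_fill (Γ := inputOf G S b) (x := x) (k := k) (p := p)
    (val := fun i => if h : i < n then val ⟨i, h⟩ else 0) (I := I) hset
    (fun i hi d hd hdi => by
      have hi' : i < n := hi
      simp only [dif_pos hi']
      exact hp ⟨i, hi'⟩ d hd hdi) ha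
  exact ⟨h1, fun i => by rw [h2 i i.2, dif_pos i.2]⟩

theorem fill₂_spec {x y : Var} (hxy : x ≠ y) {k : Arr} {p : BProg} (hpx : p.writes x = false)
    {val : Fin n → Fin n → ℕ} {I : Store → Prop}
    (hset : ∀ d z v, z = x ∨ z = y → I d → I (d.set z v))
    (hp : ∀ (i j : Fin n) (d), I d → d.var x = i → d.var y = j →
      I (p.denote (inputOf G S b) d) ∧ ∀ m, (p.denote (inputOf G S b) d).arr k m =
        if m = i * n + j then val i j else d.arr k m)
    {a : Store} (ha : I a) :
    I ((BProg.loop x 0 (.loop y 0 p)).denote (inputOf G S b) a) ∧ ∀ i j : Fin n,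
      ((BProg.loop x 0 (.loop y 0 p)).denote (inputOf G S b) a).arr k (i * n + j) = val i j := by
  obtain ⟨h1, h2⟩ := denote_fill₂ (Γ := inputOf G S b) hxy (k := k) (p := p) hpx
    (val := fun i j => if h : i < n ∧ j < n then val ⟨i, h.1⟩ ⟨j, h.2⟩ else 0) (I := I) hset
    (fun i hi j hj d hd hdi hdj => by
      have hij : i < n ∧ j < n := ⟨hi, hj⟩
      simp only [dif_pos hij]
      exact hp ⟨i, hi⟩ ⟨j, hj⟩ d hd hdi hdj) ha
  refine ⟨h1, fun i j => ?_⟩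
  have := h2 i i.2 j j.2
  rwa [dif_pos ⟨i.2, j.2⟩] at this

/-- A loop that computes the size of a set of vertices. -/
theorem count_spec {x y : Var} (hxy : x ≠ y) {e : BExpr}
    (he : ∀ (a : Store) (v : ℕ), e.eval (inputOf G S b) (a.set y v) = e.eval (inputOf G S b) a)
    (a : Store) (U : Finset (Fin n))
    (hU : ∀ u : Fin n, e.eval (inputOf G S b) (a.set x u) ≠ 0 ↔ u ∈ U) :
    (BProg.loop x 0 (when e (.set y (.var y + 1)))).denote (inputOf G S b) (a.set y 0) =
      (a.set y U.card).set x n := by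
  rw [denote_count hxy he]
  have h1 (j : ℕ) : e.eval (inputOf G S b) ((a.set y 0).set x j)
      = e.eval (inputOf G S b) (a.set x j) := by
    rw [← he (a.set x j) 0]
    congr 1
    ext z
    · by_cases h1 : z = x
      · subst h1; simp [hxy]
      · simp [h1]
    · rfl
  have h2 : ((Finset.range ((inputOf G S b).n + 0)).filter fun j =>
      e.eval (inputOf G S b) ((a.set y 0).set x j) ≠ 0).card = U.card := by
    simp only [h1, add_zero, inputOf_n]
    rw [card_range_filter]
    congr 1
    ext u
    simpa using hU u
  rw [h2]
  ext z
  · by_cases h1 : z = x <;> by_cases h2 : z = y <;> simp [h1, h2]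
  · rfl

variable (G S b)

theorem degrees_spec (a : Store) (u : Fin n) :
    (degrees.denote (inputOf G S b) a).arr .deg u = G.degree u := by
  refine (fill_spec (k := .deg) (val := fun u => G.degree u) (I := fun _ => True)
    (fun _ _ _ => trivial) (fun i d _ hdi => ⟨trivial, fun j => ?_⟩) trivial).2 u
  simp only [denote_seq, denote_set, denote_put, eval_ofNat]
  rw [count_spec (by decide) (fun a v => by simp) d (G.neighborFinset i) (fun u => by simp [hdi])]
  simp [hdi]

theorem commonNeighbors_spec (a : Store) (u w : Fin n) :
    (commonNeighbors.denote (inputOf G S b) a).arr .common (u * n + w) ≠ 0 ↔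
      ∃ x, G.Adj u x ∧ G.Adj x w := by
  have := (fill₂_spec (G := G) (S := S) (b := b) (x := .i) (y := .j) (by decide) (k := .common)
    (p := .set .cnt 0 ;;
      .loop .l 0 (when (adj (.var .i) (.var .l) * adj (.var .l) (.var .j))
        (.set .cnt (.var .cnt + 1))) ;;
      .put .common (.var .i * order + .var .j) (.var .cnt)) (by decide)
    (val := fun u w => (Finset.univ.filter fun x => G.Adj u x ∧ G.Adj x w).card)
    (I := fun _ => True) (fun _ _ _ _ _ => trivial)
    (fun i j d _ hdi hdj => ⟨trivial, fun m => ?_⟩) (a := a) trivial).2 u w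
  · rw [commonNeighbors, this]
    simp [Finset.filter_eq_empty_iff]
  · simp only [denote_seq, denote_set, denote_put, eval_ofNat]
    rw [count_spec (by decide) (fun a v => by simp) d
      (Finset.univ.filter fun x => G.Adj i x ∧ G.Adj x j) (fun u => by simp [hdi, hdj, and_comm])]
    simp [hdi, hdj]

theorem violation_iff (a : Store) : (∀ i j : Fin n,
      violation.eval (inputOf G S b) ((a.set .i i).set .j j) = 0) ↔
    IsSplitting G (a.vertexSet n .cand) := by
  have (i j : Fin n) : violation.eval (inputOf G S b) ((a.set .i i).set .j j) = 0 ↔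
      (i ≠ j → i ∈ a.vertexSet n .cand → j ∈ a.vertexSet n .cand → G.Adj i j) ∧
      (i ∉ a.vertexSet n .cand → j ∉ a.vertexSet n .cand → ¬ G.Adj i j) := by
    simp [violation, Fin.ext_iff]
    tauto
  simp only [this]
  constructor
  · intro h
    refine ⟨fun i hi j hj hij => (h i j).1 hij hi hj, fun i hi j hj _ => ?_⟩
    exact (h i j).2 (by simpa using hi) (by simpa using hj)
  · intro h i j
    refine ⟨fun hij hi hj => h.1 hi hj hij, fun hi hj hij => ?_⟩
    exact h.2 (by simpa using hi) (by simpa using hj) hij.ne hij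

theorem testSplitting_spec (a : Store) :
    (testSplitting.denote (inputOf G S b) a).vertexSet n .part =
      if IsSplitting G (a.vertexSet n .cand) then a.vertexSet n .cand
      else a.vertexSet n .part := by
  set f := BProg.loop .i 0 (.loop .j 0 (when violation (.set .cnt (.var .cnt + 1)))) with hf
  set d := f.denote (inputOf G S b) (a.set .cnt 0) with hd
  have hda (k : Arr) : d.arr k = a.arr k := by
    rw [hd, denote_arr f (by cases k <;> rfl), Store.set_arr]
  have hviol {d d' : Store} (h : d.arr = d'.arr) (hi : d.var .i = d'.var .i)
      (hj : d.var .j = d'.var .j) :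
      violation.eval (inputOf G S b) d = violation.eval (inputOf G S b) d' := by
    simp [violation, h, hi, hj]
  -- The counter never decreases, so it is enough to track whether it is still `0`, not how many
  -- violations there are.
  have hcnt : d.var .cnt = 0 ↔ IsSplitting G (a.vertexSet n .cand) := by
    rw [← violation_iff G S b]
    refine denote_for (a := a.set .cnt 0) (P := fun m d => d.arr = a.arr ∧ (d.var .cnt = 0 ↔
        ∀ i j : Fin n, i < m → violation.eval (inputOf G S b) ((a.set .i i).set .j j) = 0))
      (Q := fun d => d.var .cnt = 0 ↔
        ∀ i j : Fin n, violation.eval (inputOf G S b) ((a.set .i i).set .j j) = 0)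
      ⟨rfl, by simp⟩ ?_ fun d hd => by simpa using hd.2
    rintro m hm d ⟨h1, h2⟩
    refine denote_for (a := d.set .i m) (P := fun m' d' => (d'.arr = a.arr ∧ d'.var .i = m) ∧
        (d'.var .cnt = 0 ↔ (∀ i j : Fin n, i < m →
          violation.eval (inputOf G S b) ((a.set .i i).set .j j) = 0) ∧ ∀ j : Fin n, j < m' →
          violation.eval (inputOf G S b) ((a.set .i m).set .j j) = 0))
      (Q := fun d => d.arr = a.arr ∧ (d.var .cnt = 0 ↔
        ∀ i j : Fin n, i < m + 1 → violation.eval (inputOf G S b) ((a.set .i i).set .j j) = 0))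
      ⟨⟨h1, by simp⟩, by simpa using h2⟩ ?_ ?_
    · rintro m' hm' d' ⟨⟨h3, h4⟩, h5⟩
      have hm'' : m' < n := hm'
      have e1 : violation.eval (inputOf G S b) (d'.set .j m')
          = violation.eval (inputOf G S b) ((a.set .i m).set .j m') :=
        hviol h3 (by simp [h4]) (by simp)
      have e2 : (∀ j : Fin n, j < m' + 1 →
          violation.eval (inputOf G S b) ((a.set .i m).set .j j) = 0) ↔
          (∀ j : Fin n, j < m' →
            violation.eval (inputOf G S b) ((a.set .i m).set .j j) = 0) ∧
          violation.eval (inputOf G S b) ((a.set .i m).set .j m') = 0 := by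
        constructor
        · exact fun h => ⟨fun j hj => h j (by omega), h ⟨m', hm''⟩ (Nat.lt_succ_self m')⟩
        · rintro ⟨h6, h7⟩ j hj
          rcases Nat.lt_succ_iff_lt_or_eq.1 hj with h | h
          · exact h6 j h
          · rw [h]; exact h7
      rw [denote_when, e1, e2]
      split_ifs with h
      · exact ⟨⟨h3, by simp [h4]⟩, by simp [h5, h]⟩
      · exact ⟨⟨h3, by simp [h4]⟩, by simp [h]⟩
    · rintro d' ⟨⟨h3, h4⟩, h5⟩
      refine ⟨h3, ?_⟩
      have hm'' : m < n := hm
      rw [Store.set_var, if_neg (by decide), h5]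
      constructor
      · rintro ⟨h6, h7⟩ i j hi
        rcases Nat.lt_succ_iff_lt_or_eq.1 hi with h | h
        · exact h6 i j h
        · rw [h]; exact h7 j j.2
      · exact fun h => ⟨fun i j hi => h i j (by omega),
          fun j _ => h ⟨m, hm''⟩ j (Nat.lt_succ_self m)⟩
  have hdV (k : Arr) : d.vertexSet n k = a.vertexSet n k := by simp [Store.vertexSet, hda]
  have htest : testSplitting.denote (inputOf G S b) a =
      if d.var .cnt = 0 then
        (BProg.loop .i 0 (.put .part (.var .i) (elem .cand (.var .i)))).denote (inputOf G S b) d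
      else d := by
    simp only [testSplitting, denote_seq, denote_set, eval_ofNat, ← hf, ← hd]
    rw [denote_when]
    by_cases h : d.var .cnt = 0 <;> simp [h]
  rw [htest]
  by_cases h : IsSplitting G (a.vertexSet n .cand)
  · rw [if_pos (hcnt.2 h), if_pos h]
    have := (fill_spec (G := G) (S := S) (b := b) (x := .i) (k := .part)
      (p := .put .part (.var .i) (elem .cand (.var .i))) (val := fun u => a.arr .cand u)
      (I := fun d => d.arr .cand = a.arr .cand) (fun _ _ h => h)
      (fun i d hd hdi => ⟨by ext; simp [hd], fun j => by simp [hdi, hd]⟩)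
      (a := d) (hda _)).2
    ext u
    simp [this]
  · rw [if_neg (fun h' => h (hcnt.1 h')), if_neg h, hdV]

/-- The variable `c` serves both as a threshold and as a vertex. It runs up to `n` because the
threshold `n` may be needed. For `c = n` the row that is read is not part of the adjacency matrix,
which is harmless: `testSplitting` overwrites `part` only by genuine splittings. -/
theorem partition_spec (hG : IsSplit G) {a : Store} (ha : ∀ u : Fin n, a.arr .deg u = G.degree u) :
    IsSplitting G ((partition.denote (inputOf G S b) a).vertexSet n .part) := by
  refine denote_for (a := a) (P := fun m d => (∀ u : Fin n, d.arr .deg u = G.degree u) ∧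
      (IsSplitting G (d.vertexSet n .part) ∨ ∀ k < m,
        ¬ IsSplitting G (Finset.univ.filter fun u => k ≤ G.degree u) ∧
        ∀ v : Fin n, v = k → ¬ IsSplitting G (Finset.univ.filter fun u => G.Adj v u)))
    (Q := fun d => IsSplitting G (d.vertexSet n .part)) ⟨ha, by simp⟩ ?_ ?_
  · rintro m hm d ⟨h1, h2⟩
    set f₁ := BProg.loop .i 0 (.put .cand (.var .i) (1 - less (elem .deg (.var .i)) (.var .c)))
    set f₂ := BProg.loop .i 0 (.put .cand (.var .i) (less 0 (adj (.var .c) (.var .i))))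
    simp only [denote_seq]
    set d₁ := f₁.denote (inputOf G S b) (d.set .c m) with hd₁
    set d₂ := testSplitting.denote (inputOf G S b) d₁ with hd₂
    set d₃ := f₂.denote (inputOf G S b) d₂ with hd₃
    set d₄ := testSplitting.denote (inputOf G S b) d₃ with hd₄
    have hc₁ : d₁.var .c = m := by rw [hd₁, denote_var f₁ rfl]; simp
    have hc₂ : d₂.var .c = m := by rw [hd₂, denote_var testSplitting rfl, hc₁]
    have hdeg : d₄.arr .deg = d.arr .deg := by
      rw [hd₄, denote_arr testSplitting rfl, hd₃, denote_arr f₂ rfl, hd₂,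
        denote_arr testSplitting rfl, hd₁, denote_arr f₁ rfl, Store.set_arr]
    have e₁ : d₁.vertexSet n .cand = Finset.univ.filter fun u => m ≤ G.degree u := by
      have := (fill_spec (G := G) (S := S) (b := b) (x := .i) (k := .cand)
        (p := .put .cand (.var .i) (1 - less (elem .deg (.var .i)) (.var .c)))
        (val := fun u => 1 - if G.degree u < m then 1 else 0)
        (I := fun d' => d'.arr .deg = d.arr .deg ∧ d'.var .c = m)
        (fun _ _ h => ⟨h.1, by simpa using h.2⟩)
        (fun i d' hd hdi => ⟨⟨by ext; simp [hd.1], by simp [hd.2]⟩,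
          fun j => by simp [hdi, hd, h1]⟩)
        (a := d.set .c m) ⟨rfl, by simp⟩).2
      ext u
      rw [Store.mem_vertexSet, hd₁, this]
      by_cases h : G.degree u < m
      · simp [h]
      · have h' := not_lt.1 h
        simp [h, h']
    have e₃ (v : Fin n) (hv : v = m) :
        d₃.vertexSet n .cand = Finset.univ.filter fun u => G.Adj v u := by
      have := (fill_spec (G := G) (S := S) (b := b) (x := .i) (k := .cand)
        (p := .put .cand (.var .i) (less 0 (adj (.var .c) (.var .i))))
        (val := fun u => if G.Adj v u then 1 else 0)
        (I := fun d' => d'.var .c = m)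
        (fun _ _ h => by simpa using h)
        (fun i d' hd hdi => ⟨by simp [hd],
          fun j => by by_cases h : G.Adj v i <;> simp [hdi, hd, ← hv, h]⟩)
        (a := d₂) hc₂).2
      ext u
      rw [Store.mem_vertexSet, hd₃, this]
      simp
    have p₁ : d₁.vertexSet n .part = d.vertexSet n .part := by
      unfold Store.vertexSet; rw [hd₁, denote_arr f₁ rfl, Store.set_arr]
    have p₂ := testSplitting_spec G S b d₁
    have p₃ : d₃.vertexSet n .part = d₂.vertexSet n .part := by
      unfold Store.vertexSet; rw [hd₃, denote_arr f₂ rfl]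
    have p₄ := testSplitting_spec G S b d₃
    rw [← hd₂, p₁, e₁] at p₂
    rw [← hd₄, p₃] at p₄
    refine ⟨fun u => by rw [hdeg, h1], ?_⟩
    by_cases h4 : IsSplitting G (d₃.vertexSet n .cand)
    · left; rw [p₄, if_pos h4]; exact h4
    · rw [if_neg h4] at p₄
      by_cases h3 : IsSplitting G (Finset.univ.filter fun u => m ≤ G.degree u)
      · left; rw [p₄, p₂, if_pos h3]; exact h3
      · rw [if_neg h3] at p₂
        rw [p₄, p₂]
        refine h2.imp id fun h k hk => ?_
        rcases Nat.lt_succ_iff_lt_or_eq.1 hk with h' | rfl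
        · exact h k h'
        · exact ⟨h3, fun v hv => e₃ v hv ▸ h4⟩
  · rintro d ⟨-, h⟩
    change IsSplitting G (d.vertexSet n .part)
    refine h.resolve_right fun h => ?_
    rcases hG.exists_threshold_or_neighbors with ⟨k, hk, h'⟩ | ⟨v, h'⟩
    · rw [Fintype.card_fin] at hk
      exact (h k (Nat.lt_succ_of_le hk)).1 (by convert h')
    · exact (h v (by simp)).2 v rfl (by convert h')

end WordRAM.Bounded

/-! ### The decision program and its correctness -/

namespace WordRAM.Bounded

open BProg BExpr Discovery

open scoped Classical

/-- The candidate with the number `c`: the clique if `c = n`, and the neighbourhood of the vertex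
`c` otherwise. -/
def computeCandidate : BProg :=
  .loop .i 0 (.put .req (.var .i) (less 0
    (same (.var .c) order * elem .part (.var .i) +
      less (.var .c) order * adj (.var .c) (.var .i))))

/-- Test whether the vertex lies in the candidate and has no token. -/
def inDeficit (e : BExpr) : BExpr := elem .req e * same (token e) 0

/-- Test whether the vertex lies outside of the candidate and has a token that can move. -/
def isAvailable (e : BExpr) : BExpr := same (elem .req e) 0 * token e * elem .deg e

/-- Count tokens. -/
def countTokens : BProg :=
  .set .deficit 0 ;;
  .loop .i 0 (when (inDeficit (.var .i)) (.set .deficit (.var .deficit + 1))) ;;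
  .set .outside 0 ;;
  .loop .i 0 (when (inDeficit (.var .i) * same (elem .part (.var .i)) 0)
    (.set .outside (.var .outside + 1))) ;;
  .set .avail 0 ;;
  .loop .i 0 (when (isAvailable (.var .i)) (.set .avail (.var .avail + 1)))

/-- Build the bipartite graph. -/
def buildGraph : BProg :=
  .loop .i 0 (.loop .j 0 (.put .edge (.var .i * order + .var .j) (less 0
    (inDeficit (.var .i) * isAvailable (.var .j) *
      (same (.var .j) (.var .c) * (same (elem .part (.var .i)) 0 + same (.var .outside) 0) +
        same (same (.var .j) (.var .c)) 0 *
          (elem .part (.var .i) * adj (.var .j) (.var .i) +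
            same (elem .part (.var .i)) 0 * elem .common (.var .j * order + .var .i)))))))

/-- Compare the cost to the budget. -/
def compareCost : BProg :=
  when (same (less (.var .avail) (.var .deficit)) 0 *
      same (less (budget + less 0 (less (.var .c) order * token (.var .c) * .var .outside) +
        .var .cnt) (2 * .var .deficit + .var .outside)) 0)
    (.set .ans 1)

/-- Decide whether the candidate with the number `c` can be reached. -/
def checkCandidate : BProg :=
  computeCandidate ;; countTokens ;; buildGraph ;; matching ;; compareCost

/-- Decide vertex cover discovery in split graphs. -/
def discovery : BProg :=
  degrees ;; commonNeighbors ;; partition ;;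
  .set .ans 0 ;;
  .loop .c 1 (when (same (.var .c) order + elem .part (.var .c)) checkCandidate)

variable {n : ℕ} (G : SimpleGraph (Fin n)) (S : Finset (Fin n)) (b : ℕ)

/-- The candidate with a given number. -/
def candidateIndex (n c : ℕ) : Option (Fin n) := if h : c < n then some ⟨c, h⟩ else none

theorem candidateIndex_eq_some {c : ℕ} {v : Fin n} : candidateIndex n c = some v ↔ c = v := by
  unfold candidateIndex
  split_ifs with h
  · simp [Fin.ext_iff]
  · simp only [false_iff]
    have := v.2
    omega

/-- The data that the check of a candidate relies on. -/
structure Prepared (Q : Finset (Fin n)) (a : Store) : Prop where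
  part : a.vertexSet n .part = Q
  deg : ∀ u : Fin n, a.arr .deg u ≠ 0 ↔ ∃ w, G.Adj u w
  common : ∀ u w : Fin n, a.arr .common (u * n + w) ≠ 0 ↔ ∃ x, G.Adj u x ∧ G.Adj x w

variable {G S b} {Q : Finset (Fin n)} {c : ℕ} {a : Store}

theorem Prepared.congr {a' : Store} (h : Prepared G Q a) (h₁ : a'.arr .part = a.arr .part)
    (h₂ : a'.arr .deg = a.arr .deg) (h₃ : a'.arr .common = a.arr .common) : Prepared G Q a' where
  part := by rw [← h.part]; unfold Store.vertexSet; rw [h₁]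
  deg u := by rw [h₂, h.deg]
  common u w := by rw [h₃, h.common]

theorem Prepared.mem_part (h : Prepared G Q a) {u : Fin n} : a.arr .part u ≠ 0 ↔ u ∈ Q := by
  rw [← h.part, Store.mem_vertexSet]

theorem computeCandidate_spec (h : Prepared G Q a) (hc : a.var .c = c) (hcn : c ≤ n) :
    (computeCandidate.denote (inputOf G S b) a).vertexSet n .req =
      candidate G Q (candidateIndex n c) := by
  have := (fill_spec (G := G) (S := S) (b := b) (x := .i) (k := .req)
    (p := .put .req (.var .i) (less 0
      (same (.var .c) order * elem .part (.var .i) +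
        less (.var .c) order * adj (.var .c) (.var .i))))
    (val := fun u => if u ∈ candidate G Q (candidateIndex n c) then 1 else 0)
    (I := fun d => d.arr .part = a.arr .part ∧ d.var .c = c)
    (fun d v hd => ⟨hd.1, by simpa using hd.2⟩) ?_ (a := a) ⟨rfl, hc⟩).2
  · ext u
    rw [Store.mem_vertexSet, computeCandidate, this]
    simp
  · rintro i d ⟨h1, h2⟩ hdi
    refine ⟨⟨by ext; simp [h1], by simpa using h2⟩, fun j => ?_⟩
    rw [denote_put, Store.put_arr]
    have e1 : (BExpr.var .i).eval (inputOf G S b) d = i := hdi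
    have e2 : (less 0 (same (.var .c) order * elem .part (.var .i) +
        less (.var .c) order * adj (.var .c) (.var .i))).eval (inputOf G S b) d =
        if i ∈ candidate G Q (candidateIndex n c) then 1 else 0 := by
      have hm := h.mem_part (u := i)
      by_cases hlt : c < n
      · have h3 : candidateIndex n c = some ⟨c, hlt⟩ := dif_pos hlt
        have h4 := inputOf_mem_adj G S b ⟨c, hlt⟩ i
        simp only at h4
        have h5 : c ≠ n := by omega
        by_cases hadj : G.Adj ⟨c, hlt⟩ i <;>
          simp [h2, hdi, h3, h4, h5, hlt, candidate, hadj]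
      · obtain rfl : c = n := by omega
        have h3 : candidateIndex c c = none := dif_neg hlt
        simp only [eval_less, eval_add, eval_mul, eval_same, eval_var, eval_order, eval_elem,
          eval_ofNat, h2, hdi, h1, h3, inputOf_n, candidate, ← hm]
        simp [Nat.pos_iff_ne_zero]
    rw [e1, e2]
    simp

section
variable (G S b) (d : Store) (i : Fin n)

theorem eval_inDeficit {x : Var} (hr : d.vertexSet n .req = candidate G Q (candidateIndex n c))
    (hx : d.var x = i) : (inDeficit (.var x)).eval (inputOf G S b) d ≠ 0 ↔
      i ∈ deficit G Q S (candidateIndex n c) := by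
  have h1 : d.arr .req i ≠ 0 ↔ i ∈ candidate G Q (candidateIndex n c) := by
    rw [← hr, Store.mem_vertexSet]
  simp [inDeficit, deficit, hx, ← h1, and_comm]

theorem eval_isAvailable {x : Var} (hd : Prepared G Q d)
    (hr : d.vertexSet n .req = candidate G Q (candidateIndex n c))
    (hx : d.var x = i) : (isAvailable (.var x)).eval (inputOf G S b) d ≠ 0 ↔
      i ∈ available G Q S (candidateIndex n c) := by
  have h1 : d.arr .req i ≠ 0 ↔ i ∈ candidate G Q (candidateIndex n c) := by
    rw [← hr, Store.mem_vertexSet]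
  simp [isAvailable, available, hx, ← h1, ← hd.deg]
  tauto

end

theorem countTokens_spec (h : Prepared G Q a)
    (hr : a.vertexSet n .req = candidate G Q (candidateIndex n c)) :
    let d := countTokens.denote (inputOf G S b) a
    d.var .deficit = (deficit G Q S (candidateIndex n c)).card ∧
    d.var .outside = (deficit G Q S (candidateIndex n c) \ Q).card ∧
    d.var .avail = (available G Q S (candidateIndex n c)).card := by
  intro d
  simp only [d, countTokens, denote_seq, denote_set, eval_ofNat]
  have hP {d : Store} (hd : d.arr = a.arr) : Prepared G Q d :=
    h.congr (by rw [hd]) (by rw [hd]) (by rw [hd])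
  have hR {d : Store} (hd : d.arr = a.arr) :
      d.vertexSet n .req = candidate G Q (candidateIndex n c) := by
    rw [← hr]; unfold Store.vertexSet; rw [hd]
  have hI (d : Store) (hd : d.arr = a.arr) (u : Fin n) :=
    eval_inDeficit G S b (d.set .i u) u (x := .i) (hR hd) (by simp)
  rw [count_spec (x := .i) (y := .deficit) (e := inDeficit (.var .i)) (by decide)
    (fun a v => by simp [inDeficit]) a (deficit G Q S (candidateIndex n c)) (hI a rfl)]
  set a₁ := (a.set .deficit (deficit G Q S (candidateIndex n c)).card).set .i n
  rw [count_spec (x := .i) (y := .outside)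
    (e := inDeficit (.var .i) * same (elem .part (.var .i)) 0) (by decide)
    (fun a v => by simp [inDeficit]) a₁ (deficit G Q S (candidateIndex n c) \ Q) (fun u => by
      rw [eval_mul, mul_ne_zero_iff, hI a₁ rfl, Finset.mem_sdiff, ← h.mem_part]
      simp [a₁])]
  set a₂ := (a₁.set .outside (deficit G Q S (candidateIndex n c) \ Q).card).set .i n
  rw [count_spec (x := .i) (y := .avail) (e := isAvailable (.var .i)) (by decide)
    (fun a v => by simp [isAvailable]) a₂ (available G Q S (candidateIndex n c))
    (fun u => eval_isAvailable G S b (a₂.set .i u) u (hP rfl) (hR rfl) (by simp))]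
  simp [a₂, a₁]

/-- The condition that the deficit lies in `Q` is tested as `outside = 0`. The program evaluates
`Close` as a sum of products that correspond to its cases. -/
theorem buildGraph_spec (h : Prepared G Q a)
    (hr : a.vertexSet n .req = candidate G Q (candidateIndex n c)) (hc : a.var .c = c)
    (hout : a.var .outside = (deficit G Q S (candidateIndex n c) \ Q).card) (u w : Fin n) :
    (buildGraph.denote (inputOf G S b) a).arr .edge (u * n + w) ≠ 0 ↔
      Close G Q S (candidateIndex n c) u w := by
  have := (fill₂_spec (G := G) (S := S) (b := b) (x := .i) (y := .j) (by decide) (k := .edge)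
    (p := .put .edge (.var .i * order + .var .j) (less 0
      (inDeficit (.var .i) * isAvailable (.var .j) *
        (same (.var .j) (.var .c) * (same (elem .part (.var .i)) 0 + same (.var .outside) 0) +
          same (same (.var .j) (.var .c)) 0 *
            (elem .part (.var .i) * adj (.var .j) (.var .i) +
              same (elem .part (.var .i)) 0 * elem .common (.var .j * order + .var .i))))))
    (by decide)
    (val := fun u w => if Close G Q S (candidateIndex n c) u w then 1 else 0)
    (I := fun d => (∀ k, k ≠ .edge → d.arr k = a.arr k) ∧ d.var .c = c ∧
      d.var .outside = (deficit G Q S (candidateIndex n c) \ Q).card)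
    ?_ ?_ (a := a) ⟨fun _ _ => rfl, hc, hout⟩).2 u w
  · rw [buildGraph, this]
    simp
  · rintro d z v (rfl | rfl) ⟨h1, h2, h3⟩
    · exact ⟨h1, by simpa using h2, by simpa using h3⟩
    · exact ⟨h1, by simpa using h2, by simpa using h3⟩
  · rintro i j d ⟨h1, h2, h3⟩ hdi hdj
    refine ⟨⟨fun k hk => by ext; simp [hk, h1], by simpa using h2, by simpa using h3⟩,
      fun m => ?_⟩
    have hP : Prepared G Q d :=
      h.congr (h1 _ (by decide)) (h1 _ (by decide)) (h1 _ (by decide))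
    have hR : d.vertexSet n .req = candidate G Q (candidateIndex n c) := by
      rw [← hr]; unfold Store.vertexSet; rw [h1 _ (by decide)]
    have e1 := eval_inDeficit G S b d i hR hdi
    have e2 := eval_isAvailable G S b d j hP hR hdj
    have e3 : candidateIndex n c = some j ↔ (j : ℕ) = c := by
      rw [candidateIndex_eq_some, eq_comm]
    have e4 : deficit G Q S (candidateIndex n c) ⊆ Q ↔
        (deficit G Q S (candidateIndex n c) \ Q).card = 0 := by
      rw [Finset.card_eq_zero, Finset.sdiff_eq_empty_iff_subset]
    have e5 := hP.mem_part (u := i)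
    have e6 := hP.common j i
    rw [denote_put, Store.put_arr]
    simp only [eval_less, eval_add, eval_mul, eval_same, eval_var, eval_order, eval_elem,
      eval_ofNat, eval_adj, hdi, hdj, h2, h3, inputOf_n, inputOf_mem_adj]
    have key : (0 < (inDeficit (.var .i)).eval (inputOf G S b) d *
        (isAvailable (.var .j)).eval (inputOf G S b) d *
        ((if (j : ℕ) = c then 1 else 0) * ((if d.arr .part i = 0 then 1 else 0) +
          (if (deficit G Q S (candidateIndex n c) \ Q).card = 0 then 1 else 0)) +
        (if (if (j : ℕ) = c then 1 else 0) = 0 then 1 else 0) *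
          (d.arr .part i * (if G.Adj j i then 1 else 0) +
            (if d.arr .part i = 0 then 1 else 0) * d.arr .common (j * n + i)))) ↔
        Close G Q S (candidateIndex n c) i j := by
      unfold Close
      simp only [e3, e4, ← e1, ← e2, ← e5, ← e6]
      rw [Nat.pos_iff_ne_zero, mul_ne_zero_iff, mul_ne_zero_iff, and_assoc]
      refine and_congr_right fun _ => and_congr_right fun _ => ?_
      by_cases hjc : (j : ℕ) = c <;> by_cases hp : d.arr .part i = 0 <;>
        by_cases hadj : G.Adj j i <;> simp [hjc, hp, hadj]
    simp only [key]
    simp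

theorem isMatching_map {E : ℕ → ℕ → Prop} {F : Fin n → Fin n → Prop}
    (hEF : ∀ u w : Fin n, E u w ↔ F u w) {m : ℕ}
    (h : (∃ M, IsMatching (fun x y => x < n ∧ y < n ∧ E x y) M ∧ M.card = m) ∧
      ∀ M, IsMatching (fun x y => x < n ∧ y < n ∧ E x y) M → M.card ≤ m) :
    (∃ M, IsMatching F M ∧ M.card = m) ∧ ∀ M, IsMatching F M → M.card ≤ m := by
  obtain ⟨⟨M, hM, hm⟩, hmax⟩ := h
  set φ : Fin n × Fin n ↪ ℕ × ℕ := ⟨fun p => (p.1, p.2), fun p q h => by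
    rw [Prod.ext_iff] at h
    exact Prod.ext (Fin.ext h.1) (Fin.ext h.2)⟩ with hφ
  constructor
  · set M' := Finset.univ.filter fun p => φ p ∈ M with hM'
    have hφM' : M'.map φ = M := by
      ext p
      simp only [Finset.mem_map, hM', Finset.mem_filter, Finset.mem_univ, true_and]
      constructor
      · rintro ⟨q, hq, rfl⟩; exact hq
      · intro hp
        obtain ⟨h1, h2, -⟩ := hM.edge p hp
        exact ⟨(⟨p.1, h1⟩, ⟨p.2, h2⟩), hp, rfl⟩
    refine ⟨M', ⟨fun p hp => ?_, fun p hp q hq hpq => ?_, fun p hp q hq hpq => ?_⟩, ?_⟩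
    · exact (hEF _ _).1 (hM.edge _ (Finset.mem_filter.1 hp).2).2.2
    · exact φ.injective (hM.fst (Finset.mem_filter.1 hp).2 (Finset.mem_filter.1 hq).2
        (congrArg Fin.val hpq))
    · exact φ.injective (hM.snd (Finset.mem_filter.1 hp).2 (Finset.mem_filter.1 hq).2
        (congrArg Fin.val hpq))
    · rw [← hm, ← hφM', Finset.card_map]
  · intro M' hM'
    rw [← Finset.card_map φ]
    refine hmax _ ⟨fun p hp => ?_, fun p hp q hq hpq => ?_, fun p hp q hq hpq => ?_⟩
    · obtain ⟨q, hq, rfl⟩ := Finset.mem_map.1 hp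
      exact ⟨q.1.2, q.2.2, (hEF _ _).2 (hM'.edge q hq)⟩
    · obtain ⟨p, hp', rfl⟩ := Finset.mem_map.1 (Finset.mem_coe.1 hp)
      obtain ⟨q, hq', rfl⟩ := Finset.mem_map.1 (Finset.mem_coe.1 hq)
      rw [hM'.fst hp' hq' (Fin.ext hpq)]
    · obtain ⟨p, hp', rfl⟩ := Finset.mem_map.1 (Finset.mem_coe.1 hp)
      obtain ⟨q, hq', rfl⟩ := Finset.mem_map.1 (Finset.mem_coe.1 hq)
      rw [hM'.snd hp' hq' (Fin.ext hpq)]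

theorem checkCandidate_spec (h : Prepared G Q a) (hc : a.var .c = c) (hcn : c ≤ n) :
    (checkCandidate.denote (inputOf G S b) a).var .ans =
      if Good G Q S (candidateIndex n c) b then 1 else a.var .ans := by
  simp only [checkCandidate, denote_seq]
  set d₁ := computeCandidate.denote (inputOf G S b) a with hd₁
  set d₂ := countTokens.denote (inputOf G S b) d₁ with hd₂
  set d₃ := buildGraph.denote (inputOf G S b) d₂ with hd₃
  set d₄ := matching.denote (inputOf G S b) d₃ with hd₄
  have hr₁ := computeCandidate_spec (S := S) (b := b) h hc hcn
  rw [← hd₁] at hr₁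
  have h₁ : Prepared G Q d₁ := h.congr (denote_arr computeCandidate rfl a)
    (denote_arr computeCandidate rfl a) (denote_arr computeCandidate rfl a)
  obtain ⟨n₁, n₂, n₃⟩ := countTokens_spec (S := S) (b := b) h₁ hr₁
  rw [← hd₂] at n₁ n₂ n₃
  have h₂ : Prepared G Q d₂ := h₁.congr (denote_arr countTokens rfl d₁)
    (denote_arr countTokens rfl d₁) (denote_arr countTokens rfl d₁)
  have hr₂ : d₂.vertexSet n .req = candidate G Q (candidateIndex n c) := by
    rw [← hr₁]; unfold Store.vertexSet; rw [hd₂, denote_arr countTokens rfl]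
  have hc₁ : d₁.var .c = c := by rw [hd₁, denote_var computeCandidate rfl, hc]
  have hc₂ : d₂.var .c = c := by rw [hd₂, denote_var countTokens rfl, hc₁]
  have hE := buildGraph_spec (b := b) h₂ hr₂ hc₂ n₂
  rw [← hd₃] at hE
  have hm := matching_spec (Γ := inputOf G S b) d₃
  rw [← hd₄] at hm
  obtain ⟨⟨M, hM, hMc⟩, hmax⟩ := isMatching_map (n := n) hE hm
  have v (x : Var) (hx₃ : buildGraph.writes x = false) (hx₄ : matching.writes x = false) :
      d₄.var x = d₂.var x := by
    rw [hd₄, denote_var matching hx₄, hd₃, denote_var buildGraph hx₃]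
  have hans : d₄.var .ans = a.var .ans := by
    rw [v _ rfl rfl, hd₂, denote_var countTokens rfl, hd₁, denote_var computeCandidate rfl]
  -- The factor for `c < n` masks the token entry when the candidate is the clique, which earns no
  -- bonus.
  have hbonus : (if 0 < (if c < n then 1 else 0) * (inputOf G S b).mem (n * n + c) *
      (deficit G Q S (candidateIndex n c) \ Q).card then 1 else 0)
      = bonus G Q S (candidateIndex n c) := by
    unfold bonus
    have e4 : deficit G Q S (candidateIndex n c) ⊆ Q ↔
        (deficit G Q S (candidateIndex n c) \ Q).card = 0 := by
      rw [Finset.card_eq_zero, Finset.sdiff_eq_empty_iff_subset]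
    simp only [candidateIndex_eq_some, e4]
    congr 1
    by_cases hlt : c < n
    · have h4 := inputOf_mem_token G S b ⟨c, hlt⟩
      simp only at h4
      have h5 : (∃ v ∈ S, c = v) ↔ (⟨c, hlt⟩ : Fin n) ∈ S := by
        constructor
        · rintro ⟨v, hv, rfl⟩; exact hv
        · exact fun h => ⟨_, h, rfl⟩
      rw [h4, h5]
      by_cases h6 : (⟨c, hlt⟩ : Fin n) ∈ S <;> simp [hlt, h6, Nat.pos_iff_ne_zero]
    · have h5 : ¬ ∃ v ∈ S, c = v := by
        rintro ⟨v, -, rfl⟩; exact hlt v.2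
      simp [hlt, h5]
  -- The matching enters `Good` only through its size, and larger is better, so the maximum decides.
  have hgood : Good G Q S (candidateIndex n c) b ↔
      (deficit G Q S (candidateIndex n c)).card ≤ (available G Q S (candidateIndex n c)).card ∧
      2 * (deficit G Q S (candidateIndex n c)).card +
        (deficit G Q S (candidateIndex n c) \ Q).card ≤
        b + bonus G Q S (candidateIndex n c) + d₄.var .cnt := by
    refine and_congr_right fun _ => ⟨?_, fun h => ⟨M, hM, by rwa [hMc]⟩⟩
    rintro ⟨M', hM', h⟩
    have := hmax M' hM'
    omega
  rw [compareCost, denote_when]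
  simp only [eval_mul, eval_same, eval_less, eval_add, eval_var, eval_order, eval_budget,
    eval_token, eval_ofNat, inputOf_n, inputOf_b, v .avail rfl rfl, v .deficit rfl rfl,
    v .outside rfl rfl, v .c rfl rfl, n₁, n₂, n₃, hc₂, hbonus]
  by_cases hg : Good G Q S (candidateIndex n c) b
  · have hg' := hgood.1 hg
    simp [hg, not_lt.2 hg'.1, not_lt.2 hg'.2]
  · rw [if_neg hg, if_pos, hans]
    by_cases h₁ : (available G Q S (candidateIndex n c)).card <
        (deficit G Q S (candidateIndex n c)).card
    · simp [h₁]
    · have h₂ := fun h => hg (hgood.2 ⟨not_lt.1 h₁, h⟩)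
      simp [not_le.1 h₂]

theorem discovery_spec (hG : IsSplit G) :
    ((discovery.denote (inputOf G S b) a).var .ans = 1 ↔ VCD G S b) ∧
    (discovery.denote (inputOf G S b) a).var .ans ≤ 1 := by
  simp only [discovery, denote_seq, denote_set, eval_ofNat]
  set d₁ := degrees.denote (inputOf G S b) a with hd₁
  set d₂ := commonNeighbors.denote (inputOf G S b) d₁ with hd₂
  set d₃ := partition.denote (inputOf G S b) d₂ with hd₃
  have hdeg₂ (u : Fin n) : d₂.arr .deg u = G.degree u := by
    rw [hd₂, denote_arr commonNeighbors rfl, hd₁, degrees_spec]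
  have hQ : IsSplitting G (d₃.vertexSet n .part) := partition_spec G S b hG hdeg₂
  set Q := d₃.vertexSet n .part with hQdef
  have hP : Prepared G Q (d₃.set .ans 0) := by
    refine ⟨rfl, fun u => ?_, fun u w => ?_⟩
    · rw [Store.set_arr, hd₃, denote_arr partition rfl, hdeg₂, ← Nat.pos_iff_ne_zero,
        SimpleGraph.degree_pos_iff_exists_adj]
    · rw [Store.set_arr, hd₃, denote_arr partition rfl, hd₂, commonNeighbors_spec]
  have hfin : ((BProg.loop .c 1 (when (same (.var .c) order + elem .part (.var .c))
        checkCandidate)).denote (inputOf G S b) (d₃.set .ans 0)).var .ans =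
      if ∃ c, c < n + 1 ∧ (∀ v, candidateIndex n c = some v → v ∈ Q) ∧
        Good G Q S (candidateIndex n c) b then 1 else 0 := by
    refine denote_for (a := d₃.set .ans 0) (P := fun m d => Prepared G Q d ∧ d.var .ans =
        if ∃ c, c < m ∧ (∀ v, candidateIndex n c = some v → v ∈ Q) ∧
          Good G Q S (candidateIndex n c) b then 1 else 0)
      (Q := fun d => d.var .ans =
        if ∃ c, c < n + 1 ∧ (∀ v, candidateIndex n c = some v → v ∈ Q) ∧
          Good G Q S (candidateIndex n c) b then 1 else 0) ⟨hP, by simp⟩ ?_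
      fun d hd => by simpa using hd.2
    rintro m hm d ⟨h1, h2⟩
    have hm' : m < n + 1 := hm
    have h1' : Prepared G Q (d.set .c m) := h1.congr rfl rfl rfl
    -- For `m = n` the first summand opens the guard whatever `part` holds in cell `n`, in
    -- accordance with the vacuous condition on `none`.
    have hguard : (same (.var .c) order + elem .part (.var .c)).eval (inputOf G S b) (d.set .c m)
        ≠ 0 ∨ ¬ ∀ v, candidateIndex n m = some v → v ∈ Q := by
      by_cases hmn : m = n
      · left; simp [hmn]
      · by_cases hq : d.arr .part m = 0
        · right
          intro hall
          have hlt : m < n := by omega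
          have := hall ⟨m, hlt⟩ (dif_pos hlt)
          exact (h1.mem_part.2 this) hq
        · left; simp [hq]
    have hguard' : (same (.var .c) order + elem .part (.var .c)).eval (inputOf G S b) (d.set .c m)
        ≠ 0 → ∀ v, candidateIndex n m = some v → v ∈ Q := by
      intro h0 v hv
      obtain rfl := candidateIndex_eq_some.1 hv
      have := v.2
      have hne : (v : ℕ) ≠ n := by omega
      rw [← h1.mem_part]
      simpa [hne] using h0
    have hsplit : (∃ c, c < m + 1 ∧ (∀ v, candidateIndex n c = some v → v ∈ Q) ∧
          Good G Q S (candidateIndex n c) b) ↔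
        (∃ c, c < m ∧ (∀ v, candidateIndex n c = some v → v ∈ Q) ∧
          Good G Q S (candidateIndex n c) b) ∨
        (∀ v, candidateIndex n m = some v → v ∈ Q) ∧ Good G Q S (candidateIndex n m) b := by
      constructor
      · rintro ⟨c, hc, h⟩
        rcases Nat.lt_succ_iff_lt_or_eq.1 hc with h' | rfl
        · exact .inl ⟨c, h', h⟩
        · exact .inr h
      · rintro (⟨c, hc, h⟩ | h)
        · exact ⟨c, by omega, h⟩
        · exact ⟨m, by omega, h⟩
    rw [denote_when]
    simp only [hsplit]
    by_cases h0 : (same (.var .c) order + elem .part (.var .c)).eval (inputOf G S b)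
        (d.set .c m) = 0
    · rw [if_pos h0]
      have := hguard.resolve_left (fun h => h h0)
      refine ⟨h1', ?_⟩
      simp [h2, this]
    · rw [if_neg h0]
      refine ⟨h1'.congr (denote_arr checkCandidate rfl _) (denote_arr checkCandidate rfl _)
        (denote_arr checkCandidate rfl _), ?_⟩
      rw [checkCandidate_spec h1' (c := m) (by simp) (by omega)]
      have := hguard' h0
      by_cases hg : Good G Q S (candidateIndex n m) b
      · rw [if_pos hg, if_pos (.inr ⟨this, hg⟩)]
      · simp [hg, h2]
  rw [hfin]
  have hiff : VCD G S b ↔ ∃ c, c < n + 1 ∧ (∀ v, candidateIndex n c = some v → v ∈ Q) ∧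
      Good G Q S (candidateIndex n c) b := by
    rw [vcd_iff_exists_good hQ.1 (by convert hQ.2)]
    constructor
    · rintro ⟨c, hc, h⟩
      cases c with
      | none => exact ⟨n, by omega, by simpa [candidateIndex] using h⟩
      | some v =>
        have : candidateIndex n v = some v := candidateIndex_eq_some.2 rfl
        exact ⟨v, by omega, by rw [this]; exact ⟨hc, h⟩⟩
    · rintro ⟨c, -, hc, h⟩
      exact ⟨_, hc, h⟩
  rw [hiff]
  constructor
  · simp
  · split_ifs <;> omega

end WordRAM.Bounded

/-! ### Bounds on time and word size -/

namespace WordRAM.Bounded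

open Discovery

theorem State.bounded_input {n : ℕ} (G : SimpleGraph (Fin n)) (S : Finset (Fin n)) (b : ℕ) :
    (Discovery.input G S b).Bounded (n + b + 1) := by
  constructor
  · intro x
    simp only [Discovery.input]
    split_ifs <;> omega
  · intro a
    simp only [Discovery.input]
    split_ifs <;> omega

theorem represents_input {n : ℕ} (G : SimpleGraph (Fin n)) (S : Finset (Fin n)) (b : ℕ) :
    Represents (inputOf G S b) (Discovery.input G S b) Store.zero where
  size := rfl
  budget := rfl
  var _ := rfl
  inp _ _ := rfl
  arr _ _ := inputOf_valid G S b _ (Nat.le_add_right _ _)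

/-- A number that is at most linear in `x ^ 4` is bounded by a power of `x`. -/
theorem exists_pow_bound (A : ℕ) : ∃ e, ∀ x, 2 ≤ x → A * x ^ 4 ≤ x ^ e :=
  ⟨A + 4, fun x hx => by
    rw [pow_add]
    exact Nat.mul_le_mul_right _ ((Nat.lt_two_pow_self.le).trans (Nat.pow_le_pow_left hx _))⟩

/-- The depth 4 arises from the loop over candidates around the three nested loops of rounds, search
steps and neighbours in `matching`. A final assignment moves the answer to register `0`. -/
theorem exists_program :
    ∃ (p : WordRAM.Prog) (c d : ℕ),
      ∀ (n : ℕ) (G : SimpleGraph (Fin n)) (S : Finset (Fin n)) (b : ℕ), Discovery.IsSplit G →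
        ∃ (t : ℕ) (s : WordRAM.State),
          WordRAM.Exec ((n + b + 2) ^ d) p (Discovery.input G S b) t s ∧
          t ≤ c * (n ^ 4 + 1) ∧
          (Discovery.VCD G S b → s.reg 0 = 1) ∧
          (¬ Discovery.VCD G S b → s.reg 0 = 0) := by
  set p : Prog := .seq discovery.compile (.assign 0 (.reg (Var.ans.ctorIdx + 2))) with hp
  have tame : p.tame = true := by decide
  have wf : discovery.wf = true := by decide
  have depth : discovery.depth = 4 := by decide
  -- The two constants of the program are made opaque, so that they are not evaluated in the
  -- arithmetic below.
  obtain ⟨F, hF⟩ : ∃ F, F = discovery.factor := ⟨_, rfl⟩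
  obtain ⟨K, hK⟩ : ∃ K, K = p.weight := ⟨_, rfl⟩
  -- With `x = n + b + 2` and time at most `(F + 2) * x ^ 4`, the base `M + K * t + 2` in `Run.exec`
  -- is at most `K * (F + 2) * x ^ 4 + x + 1`, and `x + 1 ≤ 3 * x ^ 4`. Raising to the power `K`
  -- gives the exponent `e * K`.
  obtain ⟨e, he⟩ := exists_pow_bound (K * (F + 2) + 3)
  -- The 16 comes from `(n + 1) ^ 4 ≤ 16 * (n ^ 4 + 1)`, and the 2 is the cost of the final
  -- assignment.
  refine ⟨p, 16 * F + 2, e * K, fun n G S b hG => ?_⟩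
  obtain ⟨t, s, r, hs, ht⟩ :=
    discovery.run_compile (inputOf_valid G S b) wf (represents_input G S b)
  rw [← hF, depth, inputOf_n] at ht
  have hpow : (n + 1) ^ 4 ≤ 16 * (n ^ 4 + 1) := by
    rcases Nat.eq_zero_or_pos n with rfl | hn
    · norm_num
    · calc (n + 1) ^ 4 ≤ (2 * n) ^ 4 := Nat.pow_le_pow_left (by omega) _
        _ = 16 * n ^ 4 := by ring
        _ ≤ 16 * (n ^ 4 + 1) := by omega
  have run : Run p (Discovery.input G S b) (t + 2) _ := .seq r (.assign _ _ s)
  obtain ⟨ex, -⟩ := run.exec (W := (n + b + 2) ^ (e * K)) (State.bounded_input G S b) tame hK.ge (by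
    rw [pow_mul]
    refine Nat.pow_le_pow_left (le_trans ?_ (he (n + b + 2) (by omega))) _
    have h₁ : t + 2 ≤ (F + 2) * (n + b + 2) ^ 4 := by
      have h₂ : (n + 1) ^ 4 ≤ (n + b + 2) ^ 4 := Nat.pow_le_pow_left (by omega) _
      have h₃ : 1 ≤ (n + b + 2) ^ 4 := Nat.one_le_pow _ _ (by omega)
      have h₄ := Nat.mul_le_mul_left F h₂
      rw [add_mul]
      omega
    have h₅ : n + b + 2 ≤ (n + b + 2) ^ 4 := Nat.le_self_pow (by decide) _
    have h₆ := Nat.mul_le_mul_left K h₁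
    rw [add_mul, mul_assoc]
    omega)
  obtain ⟨hans, hle⟩ := discovery_spec (S := S) (b := b) (a := Store.zero) hG
  have hreg := hs.var .ans
  refine ⟨_, _, ex, ?_, fun h => ?_, fun h => ?_⟩
  · have := Nat.mul_le_mul_left F hpow
    have h₁ : F * (16 * (n ^ 4 + 1)) = 16 * F * (n ^ 4 + 1) := by ring
    rw [add_mul]
    omega
  · simpa [Expr.eval, hreg] using hans.2 h
  · have h₀ := mt hans.1 h
    simp only [Function.update_self, Expr.eval, hreg]
    omega

end WordRAM.Bounded

theorem theorem4 :
    ∃ (p : WordRAM.Prog) (c d : ℕ),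
      ∀ (n : ℕ) (G : SimpleGraph (Fin n)) (S : Finset (Fin n)) (b : ℕ), Discovery.IsSplit G →
        ∃ (t : ℕ) (s : WordRAM.State),
          WordRAM.Exec ((n + b + 2) ^ d) p (Discovery.input G S b) t s ∧
          t ≤ c * (n ^ 4 + 1) ∧
          (Discovery.VCD G S b → s.reg 0 = 1) ∧
          (¬ Discovery.VCD G S b → s.reg 0 = 0) :=
  WordRAM.Bounded.exists_program
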